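/- **Setting.** There are $N$ agents with costs $J_k:\mathbb R^M\to\mathbb R$ and minimizers $w_k^o$ ($k=1,\dots,N$), and $\mathcal W^o=\mathrm{col}\{w_1^o,\dots,w_N^o\}\in\mathbb R^{NM}$. The agents are partitioned into groups $\mathcal G_1,\dots,\mathcal G_G$, with $N_m^g=|\mathcal G_m|$; agents of one group have the same minimizer, and each group is connected through the neighborhoods $\mathcal N_k\ni k$ of its agents. $\|\cdot\|$ is the Euclidean norm of vectors and the 2-induced norm of matrices. *Combination weights.* $a_{\ell k}>0$ if $\ell\in\mathcal N_k$ and $\ell,k$ are in the same group, $a_{\ell k}=0$ otherwise, and $\sum_\ell a_{\ell k}=1$ for all $k$. For every group $\mathcal G_m$, the vector $(p_k)_{k\in\mathcal G_m}$ satisfies $\sum_{k\in\mathcal G_m}a_{\ell k}p_k=p_\ell$ for $\ell\in\mathcal G_m$ and $\sum_{k\in\mathcal G_m}p_k=1$ (the Perron vector of the group). *Costs.* Each $J_k$ is strictly convex and twice differentiable, with $\lambda_{k,L}I\le\nabla^2J_k(w)\le\lambda_{k,U}I$ for all $w$, where $0\le\lambda_{k,L}\le\lambda_{k,U}<\infty$;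 each group contains an agent with $\lambda_{k,L}>0$; and $\mathcal W\mapsto\mathrm{diag}\{\nabla^2J_1(w_1),\dots,\nabla^2J_N(w_N)\}$ is Lipschitz. Put $H_k=\nabla^2J_k(w_k^o)$. *Gradient noise.* Let $\{\mathbb F_i\}$ be a filtration of a probability space, and let $\widehat{\nabla J_k}$ be the random approximation of $\nabla J_k$ used at iteration $i$, with network noise $\mathcal S_i(\mathcal W)=\mathrm{col}\{\widehat{\nabla J_k}(w_k)-\nabla J_k(w_k)\}_{k=1}^N$; the approximations and the constants below do not depend on the step-sizes. For every $i\ge0$ and every $\mathbb F_{i-1}$-measurable $\mathcal W$ with $\mathbb E\|\mathcal W\|^4<\infty$, the vector $\mathcal S_i(\mathcal W)$ is $\mathbb F_i$-measurable with finite fourth moment and, almost surely, with $\mathcal R_{s,i}(\mathcal W)=\mathbb E[\mathcal S_i(\mathcal W)\mathcal S_i(\mathcal W)^{\mathsf T}\mid\mathbb F_{i-1}]$, $$\mathbb E[\mathcal S_i(\mathcal W)\mid\mathbb F_{i-1}]=0,\qquad \mathbb E[\|\mathcal S_i(\mathcal W)\|^4\mid\mathbb F_{i-1}]\le\alpha^2\|\mathcal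 W^o-\mathcal W\|^4+\sigma_s^4,$$ $$\|\mathcal R_{s,i}(\mathcal W^o)-\mathcal R_{s,i}(\mathcal W)\|\le\kappa_s\|\mathcal W^o-\mathcal W\|^{\gamma_s},$$ with constants $\alpha,\sigma_s,\kappa_s\ge0$ and $0<\gamma_s\le4$. Moreover $\mathcal R_{s,i}(\mathcal W^o)\to\mathcal R_s$ almost surely as $i\to\infty$, where $\mathcal R_s$ is a constant symmetric positive definite matrix. Let $R_{k\ell}$ be the $(k,\ell)$-th $M\times M$ block of $\mathcal R_s$, and $R_k=R_{kk}$. *Algorithm.* For step-sizes $\mu_k>0$ with $\mu_{\max}=\max_k\mu_k$, put $w_{k,-1}=0$ and, for $i\ge0$ and $k\in\mathcal G_m$, $$\psi_{k,i}=w_{k,i-1}-\mu_k\widehat{\nabla J_k}(w_{k,i-1}),\qquad w_{k,i}=\sum_{\ell\in\mathcal N_k\cap\mathcal G_m}a_{\ell k}\psi_{\ell,i},$$ and $\widetilde{\mathcal W}_i=\mathcal W^o-\mathrm{col}\{w_{1,i},\dots,w_{N,i}\}$. The limit $\mu_{\max}\to0$ is taken with the ratios $\mu_k/\mu_{\max}$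 fixed; the right-hand sides below depend only on these ratios. **Lemma (Steady-state normalized MSD).** The normalized total MSD is $$\lim_{\mu_{\max}\to0}\limsup_{i\to\infty}\mu_{\max}^{-1}\mathbb E\|\widetilde{\mathcal W}_i\|^2=\sum_{m=1}^G\frac{N_m^g}{2\mu_{\max}}\mathrm{Tr}\Big[\Big(\sum_{k\in\mathcal G_m}p_k\mu_kH_k\Big)^{-1}\Big(\sum_{k,\ell\in\mathcal G_m}p_kp_\ell\mu_k\mu_\ell R_{k\ell}\Big)\Big].$$ In particular, if the noises of distinct agents of the same group are asymptotically uncorrelated, that is, $R_{k\ell}=0$ whenever $k\ne\ell$ are in the same group, then $$\lim_{\mu_{\max}\to0}\limsup_{i\to\infty}\mu_{\max}^{-1}\mathbb E\|\widetilde{\mathcal W}_i\|^2=\sum_{m=1}^G\frac{N_m^g}{2\mu_{\max}}\mathrm{Tr}\Big[\Big(\sum_{k\in\mathcal G_m}p_k\mu_kH_k\Big)^{-1}\Big(\sum_{k\in\mathcal G_m}p_k^2\mu_k^2R_k\Big)\Big].$$ -/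

import Mathlib

open MeasureTheory ProbabilityTheory Filter Topology
open scoped ENNReal Matrix.Norms.L2Operator

/-- Network vectors `col{w₁, …, w_N}` with blocks `w_k ∈ ℝ^M`, under the Euclidean norm of `ℝ^{NM}`. -/
abbrev NetVec (N M : ℕ) : Type := PiLp 2 (fun _ : Fin N => EuclideanSpace ℝ (Fin M))

/-- Network matrices, of size `NM × NM`; `‖·‖` is the 2-induced norm. -/
abbrev NetMat (N M : ℕ) : Type := Matrix (Fin N × Fin M) (Fin N × Fin M) ℝ

/-- The `(k, l)` block, of size `M × M`, of a network matrix. -/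
def NetMat.block {N M : ℕ} (R : NetMat N M) (k l : Fin N) : Matrix (Fin M) (Fin M) ℝ :=
  Matrix.of fun a b => R (k, a) (l, b)

/-- The Hessian matrix of `f` at `w`: its `(a, b)` entry is `∂_b (∇ f)_a`. -/
noncomputable def hessianMatrix {M : ℕ} (f : EuclideanSpace ℝ (Fin M) → ℝ)
    (w : EuclideanSpace ℝ (Fin M)) : Matrix (Fin M) (Fin M) ℝ :=
  Matrix.of fun a b => (fderiv ℝ (gradient f) w (EuclideanSpace.single b 1)) a

/-- The network Hessian `diag{∇²J₁(w₁), …, ∇²J_N(w_N)}`. -/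
noncomputable def networkHessian {N M : ℕ} (J : Fin N → EuclideanSpace ℝ (Fin M) → ℝ)
    (W : NetVec N M) : NetMat N M :=
  Matrix.of fun x y => if x.1 = y.1 then hessianMatrix (J x.1) (W x.1) x.2 y.2 else 0

/-- The agents of group `m`. -/
def groupAgents {N G : ℕ} (group : Fin N → Fin G) (m : Fin G) : Finset (Fin N) :=
  Finset.univ.filter fun k => group k = m

/-- The groups partition the agents (agent `k` is in group `group k`); the agents of a group share
one minimizer, that is, they lie in one cluster; and every group is connected through the
neighborhoods `nbr k ∋ k` of its own agents. Links may be one-way, and then connectedness means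
that every agent of the group can reach every other one; for symmetric neighborhoods this is
ordinary connectedness. -/
structure IsGrouping {N M G : ℕ} (nbr : Fin N → Finset (Fin N)) (group : Fin N → Fin G)
    (wo : NetVec N M) : Prop where
  self_mem : ∀ k, k ∈ nbr k
  same_cluster : ∀ k l, group k = group l → wo k = wo l
  connected : ∀ k l, group k = group l →
    Relation.ReflTransGen (fun a b => a ∈ nbr b ∧ group a = group b) k l

/-- Combination weights `A l k = a_{lk}`: positive exactly for the neighbors `l` of `k` in the group
of `k`, and every column sums to one. -/
structure IsCombination {N G : ℕ} (nbr : Fin N → Finset (Fin N)) (group : Fin N → Fin G)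
    (A : Matrix (Fin N) (Fin N) ℝ) : Prop where
  pos : ∀ l k, l ∈ nbr k → group l = group k → 0 < A l k
  zero : ∀ l k, ¬ (l ∈ nbr k ∧ group l = group k) → A l k = 0
  col_sum : ∀ k, ∑ l, A l k = 1

/-- `p` stacks the right eigenvectors, at the eigenvalue one, of the diagonal blocks of `A` that
belong to the groups, each normalized so that its entries add up to one. -/
structure IsPerronVector {N G : ℕ} (group : Fin N → Fin G) (A : Matrix (Fin N) (Fin N) ℝ)
    (p : Fin N → ℝ) : Prop where
  eigen : ∀ m, ∀ l ∈ groupAgents group m, ∑ k ∈ groupAgents group m, A l k * p k = p l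
  sum_one : ∀ m, ∑ k ∈ groupAgents group m, p k = 1

/-- The conditions on the individual costs `J k` with minimizers `wo k`. -/
structure CostAssumption {N M G : ℕ} (group : Fin N → Fin G)
    (J : Fin N → EuclideanSpace ℝ (Fin M) → ℝ) (wo : NetVec N M) : Prop where
  minimizer : ∀ k, IsMinOn (J k) Set.univ (wo k)
  strictConvex : ∀ k, StrictConvexOn ℝ Set.univ (J k)
  differentiable : ∀ k, Differentiable ℝ (J k)
  twice_differentiable : ∀ k, Differentiable ℝ (gradient (J k))
  hessian_bounds : ∃ lamL lamU : Fin N → ℝ,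
    (∀ k, 0 ≤ lamL k ∧ lamL k ≤ lamU k ∧ ∀ w,
      (hessianMatrix (J k) w - lamL k • (1 : Matrix (Fin M) (Fin M) ℝ)).PosSemidef ∧
      (lamU k • (1 : Matrix (Fin M) (Fin M) ℝ) - hessianMatrix (J k) w).PosSemidef) ∧
    ∀ m, ∃ k ∈ groupAgents group m, 0 < lamL k
  hessian_lipschitz : ∃ kappaH : ℝ, 0 ≤ kappaH ∧ ∀ W₁ W₂ : NetVec N M,
    ‖networkHessian J W₁ - networkHessian J W₂‖ ≤ kappaH * ‖W₁ - W₂‖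

section Stochastic

/-- The network gradient noise at iteration `i`: the field
`W ↦ col{ĝ_{k,i}(w_k) - ∇J_k(w_k)}`, where `gradHat i k ω w` is the stochastic approximation of
`∇J_k(w)` used at iteration `i`. -/
noncomputable def gradNoise {N M : ℕ} {Ω : Type*}
    (J : Fin N → EuclideanSpace ℝ (Fin M) → ℝ)
    (gradHat : ℕ → Fin N → Ω → EuclideanSpace ℝ (Fin M) → EuclideanSpace ℝ (Fin M))
    (i : ℕ) (ω : Ω) (W : NetVec N M) : NetVec N M :=
  WithLp.toLp 2 fun k => gradHat i k ω (W k) - gradient (J k) (W k)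

/-- The conditional covariance, given `ℱ i`, of the network gradient noise at the random point
`W`. Here `ℱ i` is the information available before iteration `i`. -/
noncomputable def noiseCov {N M : ℕ} {Ω : Type*} [mΩ : MeasurableSpace Ω] (P : Measure Ω)
    (ℱ : Filtration ℕ mΩ)
    (J : Fin N → EuclideanSpace ℝ (Fin M) → ℝ)
    (gradHat : ℕ → Fin N → Ω → EuclideanSpace ℝ (Fin M) → EuclideanSpace ℝ (Fin M))
    (i : ℕ) (W : Ω → NetVec N M) (ω : Ω) : NetMat N M :=
  Matrix.of fun x y =>
    (P[fun ω' => gradNoise J gradHat i ω' (W ω') x.1 x.2 * gradNoise J gradHat i ω' (W ω') y.1 y.2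
      | ℱ i]) ω

/-- The conditions on the gradient noise, with limiting covariance `Rs`. The first four hold for
every `W` that is known before iteration `i` and has a finite fourth moment; for such `W` the noise
has a finite fourth moment too, so that all the conditional expectations are genuine. -/
structure NoiseAssumption {N M : ℕ} {Ω : Type*} [mΩ : MeasurableSpace Ω] (P : Measure Ω)
    (ℱ : Filtration ℕ mΩ)
    (J : Fin N → EuclideanSpace ℝ (Fin M) → ℝ) (wo : NetVec N M)
    (gradHat : ℕ → Fin N → Ω → EuclideanSpace ℝ (Fin M) → EuclideanSpace ℝ (Fin M))
    (Rs : NetMat N M) : Prop where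
  measurable : ∀ (i : ℕ) (W : Ω → NetVec N M), StronglyMeasurable[ℱ i] W → MemLp W 4 P →
    StronglyMeasurable[ℱ (i + 1)] (fun ω => gradNoise J gradHat i ω (W ω)) ∧
    MemLp (fun ω => gradNoise J gradHat i ω (W ω)) 4 P
  martingale_difference : ∀ (i : ℕ) (W : Ω → NetVec N M),
    StronglyMeasurable[ℱ i] W → MemLp W 4 P →
    P[fun ω => gradNoise J gradHat i ω (W ω) | ℱ i] =ᵐ[P] 0
  fourth_moment : ∃ α σ : ℝ, 0 ≤ α ∧ 0 ≤ σ ∧ ∀ (i : ℕ) (W : Ω → NetVec N M),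
    StronglyMeasurable[ℱ i] W → MemLp W 4 P →
    P[fun ω => ‖gradNoise J gradHat i ω (W ω)‖ ^ 4 | ℱ i] ≤ᵐ[P]
      fun ω => α ^ 2 * ‖wo - W ω‖ ^ 4 + σ ^ 4
  covariance_lipschitz : ∃ κ γ : ℝ, 0 ≤ κ ∧ 0 < γ ∧ γ ≤ 4 ∧ ∀ (i : ℕ) (W : Ω → NetVec N M),
    StronglyMeasurable[ℱ i] W → MemLp W 4 P →
    ∀ᵐ ω ∂P, ‖noiseCov P ℱ J gradHat i (fun _ => wo) ω - noiseCov P ℱ J gradHat i W ω‖ ≤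
      κ * ‖wo - W ω‖ ^ γ
  covariance_limit : ∀ᵐ ω ∂P,
    Tendsto (fun i => noiseCov P ℱ J gradHat i (fun _ => wo) ω) atTop (𝓝 Rs)
  covariance_posDef : Rs.PosDef

/-- The adapt-then-combine diffusion recursion inside the groups, with step-sizes `μ k`.
`diffusion … i` is the network estimate available before iteration `i`; the initial one is zero. -/
noncomputable def diffusion {N M G : ℕ} {Ω : Type*}
    (nbr : Fin N → Finset (Fin N)) (group : Fin N → Fin G) (A : Matrix (Fin N) (Fin N) ℝ)
    (gradHat : ℕ → Fin N → Ω → EuclideanSpace ℝ (Fin M) → EuclideanSpace ℝ (Fin M))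
    (μ : Fin N → ℝ) : ℕ → Ω → NetVec N M
  | 0, _ => 0
  | i + 1, ω => WithLp.toLp 2 fun k =>
      ∑ l ∈ nbr k ∩ groupAgents group (group k),
        A l k • (diffusion nbr group A gradHat μ i ω l
          - μ l • gradHat i l ω (diffusion nbr group A gradHat μ i ω l))

end Stochastic

/-- The largest step-size. -/
noncomputable def stepMax {N : ℕ} (μ : Fin N → ℝ) : ℝ := ⨆ k, μ k

/-- The normalized mean-square deviation `limsup_i μ_max⁻¹ E‖wo - W_i‖²`, as an extended
nonnegative real. -/
noncomputable def normalizedMSD {N M G : ℕ} {Ω : Type*} [MeasurableSpace Ω] (P : Measure Ω)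
    (nbr : Fin N → Finset (Fin N)) (group : Fin N → Fin G) (A : Matrix (Fin N) (Fin N) ℝ)
    (gradHat : ℕ → Fin N → Ω → EuclideanSpace ℝ (Fin M) → EuclideanSpace ℝ (Fin M))
    (wo : NetVec N M) (μ : Fin N → ℝ) : ℝ≥0∞ :=
  limsup (fun i => (ENNReal.ofReal (stepMax μ))⁻¹ *
    ∫⁻ ω, ‖wo - diffusion nbr group A gradHat μ i ω‖ₑ ^ 2 ∂P) atTop

/-- `∑_m N_m/(2 μ_max) Tr[(∑_{k ∈ G_m} p_k μ_k H_k)⁻¹ (∑_{k ∈ G_m} p_k² μ_k² R_k)]`, with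
`H_k = ∇²J_k(wo k)` and `R_k` the `k`-th diagonal block of `Rs`. -/
noncomputable def groupMSDSum {N M G : ℕ} (group : Fin N → Fin G)
    (J : Fin N → EuclideanSpace ℝ (Fin M) → ℝ) (wo : NetVec N M) (Rs : NetMat N M)
    (p μ : Fin N → ℝ) : ℝ :=
  ∑ m : Fin G, ((groupAgents group m).card : ℝ) / (2 * stepMax μ) *
    Matrix.trace
      ((∑ k ∈ groupAgents group m, (p k * μ k) • hessianMatrix (J k) (wo k))⁻¹ *
        ∑ k ∈ groupAgents group m, (p k ^ 2 * μ k ^ 2) • Rs.block k k)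

/-- The same sum with the cross-covariance blocks of agents of the same group retained:
`∑_m N_m/(2 μ_max) Tr[(∑_{k ∈ G_m} p_k μ_k H_k)⁻¹ (∑_{k, l ∈ G_m} p_k p_l μ_k μ_l R_{kl})]`. -/
noncomputable def groupMSDSumCross {N M G : ℕ} (group : Fin N → Fin G)
    (J : Fin N → EuclideanSpace ℝ (Fin M) → ℝ) (wo : NetVec N M) (Rs : NetMat N M)
    (p μ : Fin N → ℝ) : ℝ :=
  ∑ m : Fin G, ((groupAgents group m).card : ℝ) / (2 * stepMax μ) *
    Matrix.trace
      ((∑ k ∈ groupAgents group m, (p k * μ k) • hessianMatrix (J k) (wo k))⁻¹ *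
        ∑ k ∈ groupAgents group m, ∑ l ∈ groupAgents group m,
          (p k * p l * (μ k * μ l)) • Rs.block k l)

/-! The error `z = wo - W` obeys `z ↦ L (z + t D g(z)) + t L D s`, where `L` combines, `D` carries
the step-size ratios, `g(z)` stacks the gradients at `wo - z`, and `s` is a martingale difference.
Here `L` fixes `wo` because agents of a group share their minimizer.

Stability. By Jensen and the Perron property, `L` does not increase `∑ p_k ‖z_k‖²`; it loses a
weighted variance over neighborhoods, which by connectedness controls the squared deviation of `z`
from its group means. The drift is coercive only at agents with positive lower Hessian bound, but
one such agent per group plus the loss on deviations controls all of `z`. Hence the weighted squared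
norm contracts by `1 - ct` (`exists_drift_contraction`), and the noise leaves `E‖z‖⁴ = O(t²)`
(`IsNoisyRecursion.exists_fourth_moment_le`).

Separation of scales. The deviation from the group means contracts at a rate independent of `t`
under a forcing of size `t`, so its mean square is `O(t²)` (`IsNoisyRecursion.exists_deviation_le`).
At order `t` only the group means count, each repeated once per agent of its group; this is the
factor `N_m`.

Leading order. Project the mean of a group on a unit eigenvector `u` of `∑ p_k μ_k H_k` with
eigenvalue `λ`. Combination leaves this number `y` unchanged, so `y ↦ (1 - tλ) y + t r + t n` with
`E r² = O(t²)`. The variance of `n` tends to `v`, the quadratic form of the weighted noise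
covariance at `u`. Thus `E y² ↦ (1 - 2tλ) E y² + t² v + o(t²)`, which forces `E y² ≈ t v / (2λ)`
(`IsNoisyRecursion.eventually_abs_integral_functional_sq_sub_le`). Summing over an eigenbasis turns
`∑ v / (2λ)` into half the trace of the inverse Hessian times the covariance. -/

/-! ### Elementary inequalities. -/

/-- The distance to the fixed point `b / a` decays geometrically. Since the hypothesis is only
eventual, moment estimates valid from some iteration on can be fed into further recursions. -/
theorem eventually_le_of_linear_recursion {u : ℕ → ℝ} {a b c : ℝ} (ha : 0 < a) (ha1 : a ≤ 1)
    (h : ∀ᶠ i in atTop, u (i + 1) ≤ (1 - a) * u i + b) (hc : b / a < c) :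
    ∀ᶠ i in atTop, u i ≤ c := by
  obtain ⟨n, hn⟩ := eventually_atTop.1 h
  have key : ∀ j, u (n + j) ≤ b / a + (1 - a) ^ j * (u n - b / a) := by
    intro j
    induction j with
    | zero => simp
    | succ j ih =>
      have h1 := hn (n + j) (Nat.le_add_right _ _)
      have h2 := mul_le_mul_of_nonneg_left ih (sub_nonneg.2 ha1)
      have h3 : (1 - a) * (b / a) + b = b / a := by field_simp; ring
      rw [← add_assoc, pow_succ]
      linarith
  have hlim : Tendsto (fun j : ℕ => b / a + (1 - a) ^ j * (u n - b / a)) atTop (𝓝 (b / a)) := by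
    have := ((tendsto_pow_atTop_nhds_zero_of_lt_one (sub_nonneg.2 ha1)
      (by linarith : 1 - a < 1)).mul_const (u n - b / a)).const_add (b / a)
    simpa using this
  obtain ⟨m, hm⟩ := eventually_atTop.1 (hlim.eventually (gt_mem_nhds hc))
  refine eventually_atTop.2 ⟨n + m, fun i hi => ?_⟩
  obtain ⟨j, rfl⟩ := Nat.exists_eq_add_of_le (le_trans (Nat.le_add_right n m) hi)
  exact (key j).trans (hm j (by omega)).le

/-- By compactness `f` has a positive minimum on the unit sphere, and homogeneity spreads it. The
coercivity constants of the network estimates come from here, without any spectral computation. -/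
theorem exists_pos_mul_norm_sq_le {E : Type*} [NormedAddCommGroup E] [NormedSpace ℝ E]
    [FiniteDimensional ℝ E] {f : E → ℝ} (hf : Continuous f)
    (hom : ∀ (c : ℝ) x, f (c • x) = c ^ 2 * f x) (pos : ∀ x, x ≠ 0 → 0 < f x) :
    ∃ δ, 0 < δ ∧ ∀ x, δ * ‖x‖ ^ 2 ≤ f x := by
  have hf0 : f 0 = 0 := by simpa using hom 0 0
  rcases (Metric.sphere (0 : E) 1).eq_empty_or_nonempty with he | hne
  · refine ⟨1, one_pos, fun x => ?_⟩
    by_cases hx : x = 0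
    · simp [hx, hf0]
    · have : ‖x‖⁻¹ • x ∈ Metric.sphere (0 : E) 1 := by simp [norm_smul, hx]
      simp [he] at this
  · obtain ⟨x₀, hx₀, hmin⟩ := (isCompact_sphere (0 : E) 1).exists_isMinOn hne hf.continuousOn
    refine ⟨f x₀, pos x₀ ?_, fun x => ?_⟩
    · rintro rfl; simp at hx₀
    · by_cases hx : x = 0
      · simp [hx, hf0]
      have hx' : ‖x‖ ≠ 0 := norm_ne_zero_iff.2 hx
      have h1 : f x₀ ≤ f (‖x‖⁻¹ • x) := hmin (by simp [norm_smul, hx])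
      rw [hom] at h1
      calc f x₀ * ‖x‖ ^ 2 ≤ (‖x‖⁻¹ ^ 2 * f x) * ‖x‖ ^ 2 := by gcongr
        _ = f x := by field_simp

/-- The term linear in `b` is kept exactly, since it integrates to zero when `b` is a martingale
difference; the other mixed terms only need bounds. -/
theorem norm_add_pow_four_le {E : Type*} [NormedAddCommGroup E] [InnerProductSpace ℝ E] (a b : E) :
    ‖a + b‖ ^ 4 ≤ ‖a‖ ^ 4 + 4 * (‖a‖ ^ 2 * inner ℝ a b) + 8 * (‖a‖ ^ 2 * ‖b‖ ^ 2) + 3 * ‖b‖ ^ 4 := by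
  have h : ‖a + b‖ ^ 2 = ‖a‖ ^ 2 + 2 * inner ℝ a b + ‖b‖ ^ 2 := norm_add_sq_real a b
  have h4 : ‖a + b‖ ^ 4 = (‖a‖ ^ 2 + 2 * inner ℝ a b + ‖b‖ ^ 2) ^ 2 := by rw [← h]; ring
  have hi : |inner ℝ a b| ≤ ‖a‖ * ‖b‖ := abs_real_inner_le_norm a b
  have hi2 : (inner ℝ a b) ^ 2 ≤ ‖a‖ ^ 2 * ‖b‖ ^ 2 := by
    rw [← mul_pow, ← sq_abs]; gcongr
  have hi3 : inner ℝ a b * ‖b‖ ^ 2 ≤ (‖a‖ ^ 2 * ‖b‖ ^ 2 + ‖b‖ ^ 4) / 2 := by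
    calc inner ℝ a b * ‖b‖ ^ 2 ≤ (‖a‖ * ‖b‖) * ‖b‖ ^ 2 := by
          gcongr; exact (le_abs_self _).trans hi
      _ ≤ _ := by nlinarith [sq_nonneg (‖a‖ * ‖b‖ - ‖b‖ ^ 2)]
  rw [h4]
  nlinarith

/-! ### Second and fourth moments of martingale increments. -/

section Moments

variable {Ω : Type*} {m mΩ : MeasurableSpace Ω} {P : Measure Ω}
  {E : Type*} [NormedAddCommGroup E]

theorem MeasureTheory.MemLp.integrable_norm_pow_four {f : Ω → E} (hf : MemLp f 4 P) :
    Integrable (fun ω => ‖f ω‖ ^ 4) P := by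
  have := hf.integrable_norm_pow (p := 4) (by norm_num)
  simpa using this

theorem MeasureTheory.MemLp.integrable_norm_sq_mul_norm_sq {F : Type*} [NormedAddCommGroup F]
    {f : Ω → E} {g : Ω → F} (hf : MemLp f 4 P) (hg : MemLp g 4 P) :
    Integrable (fun ω => ‖f ω‖ ^ 2 * ‖g ω‖ ^ 2) P := by
  refine (hf.integrable_norm_pow_four.add hg.integrable_norm_pow_four).mono'
    ((hf.1.norm.pow 2).mul (hg.1.norm.pow 2)) (ae_of_all _ fun ω => ?_)
  rw [Real.norm_of_nonneg (by positivity)]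
  simp only [Pi.add_apply]
  nlinarith [sq_nonneg (‖f ω‖ ^ 2 - ‖g ω‖ ^ 2), sq_nonneg (‖f ω‖ ^ 2), sq_nonneg (‖g ω‖ ^ 2)]

variable [IsProbabilityMeasure P]

theorem MeasureTheory.MemLp.integrable_norm_sq_of_four {f : Ω → E} (hf : MemLp f 4 P) :
    Integrable (fun ω => ‖f ω‖ ^ 2) P :=
  (hf.mono_exponent (by norm_num : (2 : ℝ≥0∞) ≤ 4)).integrable_norm_pow (p := 2) (by norm_num)

theorem MeasureTheory.MemLp.integrable_of_four {f : Ω → E} (hf : MemLp f 4 P) :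
    Integrable f P :=
  hf.integrable (by norm_num)

/-- Young's inequality at scale `t`: `x² ≤ t + x⁴ / t`. -/
theorem integral_norm_sq_le_of_four {f : Ω → E} (hf : MemLp f 4 P) {t K : ℝ} (ht : 0 < t)
    (h : ∫ ω, ‖f ω‖ ^ 4 ∂P ≤ K * t ^ 2) : ∫ ω, ‖f ω‖ ^ 2 ∂P ≤ (1 + K) * t := by
  have h1 : ∫ ω, ‖f ω‖ ^ 2 ∂P ≤ ∫ ω, (t + t⁻¹ * ‖f ω‖ ^ 4) ∂P := by
    refine integral_mono hf.integrable_norm_sq_of_four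
      ((integrable_const _).add (hf.integrable_norm_pow_four.const_mul _)) fun ω => ?_
    have : ‖f ω‖ ^ 2 * t ≤ t ^ 2 + ‖f ω‖ ^ 4 := by
      nlinarith [sq_nonneg (‖f ω‖ ^ 2 - t), sq_nonneg (‖f ω‖ ^ 2), sq_nonneg t]
    calc ‖f ω‖ ^ 2 = t⁻¹ * (‖f ω‖ ^ 2 * t) := by field_simp
      _ ≤ t⁻¹ * (t ^ 2 + ‖f ω‖ ^ 4) := by gcongr
      _ = t + t⁻¹ * ‖f ω‖ ^ 4 := by field_simp
  rw [integral_add (integrable_const _) (hf.integrable_norm_pow_four.const_mul _),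
    integral_const_mul] at h1
  simp only [integral_const, probReal_univ, one_smul] at h1
  have h2 : t⁻¹ * ∫ ω, ‖f ω‖ ^ 4 ∂P ≤ t⁻¹ * (K * t ^ 2) := by gcongr
  have h3 : t⁻¹ * (K * t ^ 2) = K * t := by field_simp
  linarith

variable [InnerProductSpace ℝ E] [CompleteSpace E]

theorem integral_inner_eq_zero_of_condExp_eq_zero (hm : m ≤ mΩ) {X Y : Ω → E}
    (hX : StronglyMeasurable[m] X) (hXY : Integrable (fun ω => inner ℝ (X ω) (Y ω)) P)
    (hY : Integrable Y P) (h0 : P[Y | m] =ᵐ[P] 0) : ∫ ω, inner ℝ (X ω) (Y ω) ∂P = 0 := by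
  have h := condExp_bilin_of_stronglyMeasurable_left (μ := P) (m := m) (innerSL ℝ (E := E)) hX
    hXY hY
  rw [← integral_condExp hm, integral_congr_ae (g := fun _ => (0 : ℝ)), integral_zero]
  filter_upwards [h, h0] with ω h1 h2
  exact h1.trans (by simp [h2])

theorem integral_norm_add_sq_of_condExp_eq_zero (hm : m ≤ mΩ) {a b : Ω → E}
    (ha : StronglyMeasurable[m] a) (ha4 : MemLp a 4 P) (hb4 : MemLp b 4 P)
    (h0 : P[b | m] =ᵐ[P] 0) :
    ∫ ω, ‖a ω + b ω‖ ^ 2 ∂P = ∫ ω, ‖a ω‖ ^ 2 ∂P + ∫ ω, ‖b ω‖ ^ 2 ∂P := by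
  have hab : Integrable (fun ω => inner ℝ (a ω) (b ω)) P := by
    refine (ha4.integrable_norm_sq_of_four.add hb4.integrable_norm_sq_of_four).mono'
      (ha4.1.inner hb4.1) (ae_of_all _ fun ω => ?_)
    refine (norm_inner_le_norm _ _).trans ?_
    simp only [Pi.add_apply]
    nlinarith [sq_nonneg (‖a ω‖ - ‖b ω‖), sq_nonneg ‖a ω‖, sq_nonneg ‖b ω‖]
  have h1 : Integrable (fun ω => ‖a ω‖ ^ 2 + 2 * inner ℝ (a ω) (b ω)) P :=
    ha4.integrable_norm_sq_of_four.add (hab.const_mul 2)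
  simp_rw [norm_add_sq_real]
  rw [integral_add h1
      hb4.integrable_norm_sq_of_four,
    integral_add ha4.integrable_norm_sq_of_four (hab.const_mul 2), integral_const_mul,
    integral_inner_eq_zero_of_condExp_eq_zero hm ha hab hb4.integrable_of_four h0]
  ring

/-- The mixed term costs `θ` times the fourth moment of `a`. With `θ` proportional to the step-size,
this cost stays below the contraction. -/
theorem integral_norm_add_pow_four_le_of_condExp_eq_zero (hm : m ≤ mΩ) {a b : Ω → E}
    (ha : StronglyMeasurable[m] a) (ha4 : MemLp a 4 P) (hb4 : MemLp b 4 P)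
    (h0 : P[b | m] =ᵐ[P] 0) {θ : ℝ} (hθ : 0 < θ) :
    ∫ ω, ‖a ω + b ω‖ ^ 4 ∂P ≤
      (1 + θ) * ∫ ω, ‖a ω‖ ^ 4 ∂P + (16 / θ + 3) * ∫ ω, ‖b ω‖ ^ 4 ∂P := by
  have hI : Integrable (fun ω => inner ℝ (‖a ω‖ ^ 2 • a ω) (b ω)) P := by
    refine (ha4.integrable_norm_pow_four.add
      ((ha4.integrable_norm_sq_mul_norm_sq hb4))).mono'
      (((ha4.1.norm.pow 2).smul ha4.1).inner hb4.1) (ae_of_all _ fun ω => ?_)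
    refine (norm_inner_le_norm _ _).trans ?_
    simp only [Pi.add_apply, norm_smul, norm_pow, norm_norm]
    nlinarith [sq_nonneg (‖a ω‖ * (‖a ω‖ - ‖b ω‖)), sq_nonneg (‖a ω‖ * ‖a ω‖),
      sq_nonneg (‖a ω‖ * ‖b ω‖)]
  have hz := integral_inner_eq_zero_of_condExp_eq_zero hm ((ha.norm.pow 2).smul ha) hI
    hb4.integrable_of_four h0
  have ia := ha4.integrable_norm_pow_four
  have ib := hb4.integrable_norm_pow_four
  calc ∫ ω, ‖a ω + b ω‖ ^ 4 ∂P
      ≤ ∫ ω, ((1 + θ) * ‖a ω‖ ^ 4 + 4 * inner ℝ (‖a ω‖ ^ 2 • a ω) (b ω)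
          + (16 / θ + 3) * ‖b ω‖ ^ 4) ∂P := by
        refine integral_mono (ha4.add hb4).integrable_norm_pow_four
          (((ia.const_mul _).add (hI.const_mul _)).add (ib.const_mul _)) fun ω => ?_
        refine (norm_add_pow_four_le (a ω) (b ω)).trans ?_
        have h8 : 8 * (‖a ω‖ ^ 2 * ‖b ω‖ ^ 2) ≤ θ * ‖a ω‖ ^ 4 + 16 / θ * ‖b ω‖ ^ 4 := by
          have : 0 ≤ θ⁻¹ * (θ * ‖a ω‖ ^ 2 - 4 * ‖b ω‖ ^ 2) ^ 2 := by positivity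
          have h2 : θ⁻¹ * (θ * ‖a ω‖ ^ 2 - 4 * ‖b ω‖ ^ 2) ^ 2 =
            θ * ‖a ω‖ ^ 4 + 16 / θ * ‖b ω‖ ^ 4 - 8 * (‖a ω‖ ^ 2 * ‖b ω‖ ^ 2) := by
            field_simp; ring
          linarith
        simp only [inner_smul_left, conj_trivial]
        linarith
    _ = _ := by
        have h1 : Integrable (fun ω => (1 + θ) * ‖a ω‖ ^ 4 +
            4 * inner ℝ (‖a ω‖ ^ 2 • a ω) (b ω)) P := (ia.const_mul _).add (hI.const_mul _)
        have hz' : ∫ ω, inner ℝ (‖a ω‖ ^ 2 • a ω) (b ω) ∂P = 0 := hz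
        rw [integral_add h1 (ib.const_mul _),
          integral_add (ia.const_mul _) (hI.const_mul _), integral_const_mul, integral_const_mul,
          integral_const_mul, hz']
        ring

end Moments

/-! ### Network vectors, block maps and the weighted norm. -/

/-- Network vectors with blocks in `E`. -/
abbrev BlockVec (N : ℕ) (E : Type*) : Type _ := PiLp 2 (fun _ : Fin N => E)

theorem blockVec_norm_sq {N : ℕ} {E : Type*} [NormedAddCommGroup E] (z : BlockVec N E) :
    ‖z‖ ^ 2 = ∑ k, ‖z k‖ ^ 2 :=
  PiLp.norm_sq_eq_of_L2 _ z

section BlockMap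

variable {N : ℕ} {E : Type*} [NormedAddCommGroup E] [InnerProductSpace ℝ E]

/-- The action `z ↦ (B ⊗ I) z` of an `N × N` matrix on network vectors. -/
noncomputable def blockMap (B : Matrix (Fin N) (Fin N) ℝ) : BlockVec N E →L[ℝ] BlockVec N E where
  toFun z := WithLp.toLp 2 fun k => ∑ l, B k l • z l
  map_add' x y := by
    refine PiLp.ext fun k => ?_
    simp [smul_add, Finset.sum_add_distrib]
  map_smul' c x := by
    refine PiLp.ext fun k => ?_
    simp [Finset.smul_sum, smul_comm c]
  cont := by fun_prop

theorem blockMap_apply (B : Matrix (Fin N) (Fin N) ℝ) (z : BlockVec N E) (k : Fin N) :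
    blockMap B z k = ∑ l, B k l • z l := rfl

theorem blockMap_mul (B C : Matrix (Fin N) (Fin N) ℝ) (z : BlockVec N E) :
    blockMap (B * C) z = blockMap B (blockMap C z) := by
  refine PiLp.ext fun k => ?_
  simp only [blockMap_apply, Matrix.mul_apply, Finset.sum_smul, Finset.smul_sum, smul_smul]
  exact Finset.sum_comm

theorem blockMap_diagonal (c : Fin N → ℝ) (z : BlockVec N E) (k : Fin N) :
    blockMap (Matrix.diagonal c) z k = c k • z k := by
  simp [blockMap_apply, Matrix.diagonal_apply, ite_smul]

theorem blockVec_inner (x y : BlockVec N E) : inner ℝ x y = ∑ k, inner ℝ (x k) (y k) :=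
  PiLp.inner_apply x y

/-- Multiplication of the `k`-th block by `√(p k)`. -/
noncomputable def sqrtScale (p : Fin N → ℝ) : BlockVec N E →L[ℝ] BlockVec N E :=
  blockMap (Matrix.diagonal fun k => √(p k))

theorem inner_sqrtScale {p : Fin N → ℝ} (hp : ∀ k, 0 < p k) (x y : BlockVec N E) :
    inner ℝ (sqrtScale p x) (sqrtScale p y) = ∑ k, p k * inner ℝ (x k) (y k) := by
  rw [blockVec_inner]
  refine Finset.sum_congr rfl fun k _ => ?_
  rw [sqrtScale, blockMap_diagonal, blockMap_diagonal, real_inner_smul_left,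
    real_inner_smul_right, ← mul_assoc, Real.mul_self_sqrt (hp k).le]

theorem norm_sqrtScale_sq {p : Fin N → ℝ} (hp : ∀ k, 0 < p k) (x : BlockVec N E) :
    ‖sqrtScale p x‖ ^ 2 = ∑ k, p k * ‖x k‖ ^ 2 := by
  rw [← real_inner_self_eq_norm_sq, inner_sqrtScale hp]
  simp_rw [real_inner_self_eq_norm_sq]

theorem exists_norm_sq_le_norm_sqrtScale_sq [FiniteDimensional ℝ E] {p : Fin N → ℝ} (hp : ∀ k, 0 < p k) :
    ∃ δ, 0 < δ ∧ ∀ x : BlockVec N E, δ * ‖x‖ ^ 2 ≤ ‖sqrtScale p x‖ ^ 2 := by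
  refine exists_pos_mul_norm_sq_le (by fun_prop) (fun c x => ?_) fun x hx => ?_
  · rw [map_smul, norm_smul, mul_pow, Real.norm_eq_abs, sq_abs]
  · rw [norm_sqrtScale_sq hp]
    by_contra h
    have h0 := (Finset.sum_eq_zero_iff_of_nonneg fun k _ =>
      mul_nonneg (hp k).le (sq_nonneg ‖x k‖)).1 (le_antisymm (not_lt.1 h)
        (Finset.sum_nonneg fun k _ => mul_nonneg (hp k).le (sq_nonneg ‖x k‖)))
    refine hx (PiLp.ext fun k => ?_)
    simpa [(hp k).ne'] using h0 k (Finset.mem_univ k)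

end BlockMap

/-- Variance as second moment minus squared mean; the signs of the weights play no role. -/
theorem sum_mul_norm_sub_sq {ι E : Type*} [Fintype ι] [NormedAddCommGroup E]
    [InnerProductSpace ℝ E] {w : ι → ℝ} (hw : ∑ i, w i = 1) (y : ι → E) :
    ∑ i, w i * ‖y i - ∑ j, w j • y j‖ ^ 2 = ∑ i, w i * ‖y i‖ ^ 2 - ‖∑ j, w j • y j‖ ^ 2 := by
  set b := ∑ j, w j • y j with hb
  have h1 : ∑ i, w i * inner ℝ (y i) b = ‖b‖ ^ 2 := by
    rw [← real_inner_self_eq_norm_sq]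
    nth_rewrite 2 [hb]
    rw [sum_inner]
    simp_rw [real_inner_smul_left]
  simp_rw [norm_sub_sq_real, mul_add, mul_sub, Finset.sum_add_distrib, Finset.sum_sub_distrib,
    ← Finset.sum_mul, hw]
  have h2 : ∑ i, w i * (2 * inner ℝ (y i) b) = 2 * ‖b‖ ^ 2 := by
    rw [← h1, Finset.mul_sum]
    exact Finset.sum_congr rfl fun i _ => by ring
  rw [h2]; ring

/-! ### Combination inside the groups: Perron vector, group means, contraction. -/

section Network

variable {N M G : ℕ} {nbr : Fin N → Finset (Fin N)} {group : Fin N → Fin G} {wo : NetVec N M}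
  {A : Matrix (Fin N) (Fin N) ℝ} {p : Fin N → ℝ} {E : Type*} [NormedAddCommGroup E]
  [InnerProductSpace ℝ E]

theorem IsCombination.nonneg (hA : IsCombination nbr group A) (l k : Fin N) : 0 ≤ A l k := by
  by_cases h : l ∈ nbr k ∧ group l = group k
  · exact (hA.pos l k h.1 h.2).le
  · exact (hA.zero l k h).ge

theorem IsCombination.eq_zero (hA : IsCombination nbr group A) {l k : Fin N}
    (h : group l ≠ group k) : A l k = 0 :=
  hA.zero l k fun h' => h h'.2

theorem IsPerronVector.sum_mul (hA : IsCombination nbr group A) (hp : IsPerronVector group A p)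
    (l : Fin N) : ∑ k, A l k * p k = p l := by
  rw [← hp.eigen (group l) l (by simp [groupAgents])]
  refine (Finset.sum_subset (Finset.subset_univ _) fun k _ hk => ?_).symm
  rw [hA.eq_zero, zero_mul]
  intro h
  exact hk (by simp [groupAgents, h])

/-- The positive part `p⁺` satisfies `p⁺ ≤ A p⁺` entrywise, and both sides have equal sums because
the columns of `A` sum to one. So `p⁺` is fixed by `A`, and positivity spreads backwards along links
from an agent with `p > 0`, which exists since the entries in a group sum to one. -/
theorem IsPerronVector.pos (hgroup : IsGrouping nbr group wo) (hA : IsCombination nbr group A)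
    (hp : IsPerronVector group A p) (k : Fin N) : 0 < p k := by
  have hle : ∀ l, max (p l) 0 ≤ ∑ k, A l k * max (p k) 0 := fun l => by
    refine max_le ?_ (Finset.sum_nonneg fun k _ => mul_nonneg (hA.nonneg l k) (le_max_right _ _))
    rw [← hp.sum_mul hA l]
    exact Finset.sum_le_sum fun k _ => mul_le_mul_of_nonneg_left (le_max_left _ _) (hA.nonneg l k)
  have hsum : ∑ l, ∑ k, A l k * max (p k) 0 = ∑ k, max (p k) 0 := by
    rw [Finset.sum_comm]
    refine Finset.sum_congr rfl fun k _ => ?_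
    rw [← Finset.sum_mul, hA.col_sum, one_mul]
  have heq : ∀ l, max (p l) 0 = ∑ k, A l k * max (p k) 0 := fun l =>
    (Finset.sum_eq_sum_iff_of_le fun l _ => hle l).1 hsum.symm l (Finset.mem_univ l)
  have hstep : ∀ l k, l ∈ nbr k ∧ group l = group k → 0 < p k → 0 < p l := by
    intro l k hlk hk
    have h1 : 0 < max (p l) 0 := by
      rw [heq l]
      refine lt_of_lt_of_le (mul_pos (hA.pos l k hlk.1 hlk.2) (lt_max_of_lt_left (b := p k) (c := 0) hk)) ?_
      exact Finset.single_le_sum (f := fun k => A l k * max (p k) 0)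
        (fun k _ => mul_nonneg (hA.nonneg l k) (le_max_right _ _)) (Finset.mem_univ k)
    simpa using h1
  obtain ⟨j, hj, hj0⟩ : ∃ j ∈ groupAgents group (group k), 0 < p j := by
    by_contra! h
    have := Finset.sum_nonpos h
    rw [hp.sum_one] at this
    linarith
  have hjk : group k = group j := by simpa [groupAgents, eq_comm] using hj
  have hpath := hgroup.connected k j hjk
  induction hpath using Relation.ReflTransGen.head_induction_on with
  | refl => exact hj0
  | head h _ ih => exact hstep _ _ h (ih (by rw [← h.2]; exact hj) (by rw [← h.2]; exact hjk))

/-- The matrix that replaces every block by the `p`-weighted mean over its group. -/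
def groupMean (group : Fin N → Fin G) (p : Fin N → ℝ) : Matrix (Fin N) (Fin N) ℝ :=
  Matrix.of fun k l => if group l = group k then p l else 0

theorem groupMean_apply (k l : Fin N) :
    groupMean group p k l = if group l = group k then p l else 0 := rfl

/-- This is `A p = p` read row by row. Together with `transpose_mul_groupMean`, which uses the
column sums, it makes combination and group averaging commute. -/
theorem groupMean_mul_transpose (hA : IsCombination nbr group A) (hp : IsPerronVector group A p) :
    groupMean group p * A.transpose = groupMean group p := by
  ext k l
  simp only [Matrix.mul_apply, groupMean_apply, Matrix.transpose_apply, ite_mul, zero_mul]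
  split_ifs with h
  · rw [← hp.sum_mul hA l]
    refine Finset.sum_congr rfl fun j _ => ?_
    split_ifs with hj
    · ring
    · rw [hA.eq_zero (by rw [h]; exact fun e => hj e.symm), zero_mul]
  · refine Finset.sum_eq_zero fun j _ => ?_
    split_ifs with hj
    · rw [hA.eq_zero (by rw [hj]; exact h), mul_zero]
    · rfl

theorem transpose_mul_groupMean (hA : IsCombination nbr group A) :
    A.transpose * groupMean group p = groupMean group p := by
  ext k l
  simp only [Matrix.mul_apply, groupMean_apply, Matrix.transpose_apply]
  have : ∀ j, A j k * (if group l = group j then p l else 0) =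
      A j k * (if group l = group k then p l else 0) := by
    intro j
    by_cases h : group j = group k
    · rw [h]
    · rw [hA.eq_zero h, zero_mul, zero_mul]
  simp_rw [this, ← Finset.sum_mul, hA.col_sum, one_mul]

theorem groupMean_mul_self (hp : IsPerronVector group A p) :
    groupMean group p * groupMean group p = groupMean group p := by
  ext k l
  simp only [Matrix.mul_apply, groupMean_apply]
  have : ∀ j, (if group j = group k then p j else 0) * (if group l = group j then p l else 0) =
      (if group j = group k then p j else 0) * (if group l = group k then p l else 0) := by
    intro j
    by_cases h : group j = group k
    · simp [h]
    · simp [h]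
  simp_rw [this, ← Finset.sum_mul]
  have h1 := hp.sum_one (group k)
  rw [groupAgents, Finset.sum_filter] at h1
  rw [h1, one_mul]

theorem blockMap_groupMean_congr {k l : Fin N} (h : group k = group l) (z : BlockVec N E) :
    blockMap (groupMean group p) z k = blockMap (groupMean group p) z l := by
  simp [blockMap_apply, groupMean_apply, h]

theorem blockMap_groupMean_of_const (hp : IsPerronVector group A p) {z : BlockVec N E}
    (h : ∀ k l, group k = group l → z k = z l) : blockMap (groupMean group p) z = z := by
  refine PiLp.ext fun k => ?_
  have h1 := hp.sum_one (group k)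
  rw [groupAgents, Finset.sum_filter] at h1
  rw [blockMap_apply]
  calc ∑ l, groupMean group p k l • z l = ∑ l, groupMean group p k l • z k := by
        refine Finset.sum_congr rfl fun l _ => ?_
        rw [groupMean_apply]
        split_ifs with hl
        · rw [h l k hl]
        · simp
    _ = z k := by
        rw [← Finset.sum_smul]
        simp_rw [groupMean_apply]
        rw [h1, one_smul]

/-- The weighted norm lost by combining equals the `p`-average of the variances over the
neighborhoods; `A p = p` collects the second moments. -/
theorem sum_mul_norm_sub_combine_sq (hA : IsCombination nbr group A)
    (hp : IsPerronVector group A p) (hpos : ∀ k, 0 < p k) (y : BlockVec N E) :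
    ∑ k, p k * ∑ l, A l k * ‖y l - blockMap A.transpose y k‖ ^ 2 =
      ‖sqrtScale p y‖ ^ 2 - ‖sqrtScale p (blockMap A.transpose y)‖ ^ 2 := by
  have h : ∀ k, ∑ l, A l k * ‖y l - blockMap A.transpose y k‖ ^ 2 =
      ∑ l, A l k * ‖y l‖ ^ 2 - ‖blockMap A.transpose y k‖ ^ 2 := fun k =>
    sum_mul_norm_sub_sq (hA.col_sum k) y
  simp_rw [h, mul_sub, Finset.sum_sub_distrib]
  rw [norm_sqrtScale_sq hpos, norm_sqrtScale_sq hpos]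
  congr 1
  simp_rw [Finset.mul_sum]
  rw [Finset.sum_comm]
  refine Finset.sum_congr rfl fun l _ => ?_
  rw [← hp.sum_mul hA l, Finset.sum_mul]
  exact Finset.sum_congr rfl fun k _ => by ring

/-- If the loss vanishes, neighbors agree, hence whole groups agree by connectedness, and the vector
equals its group mean. So the loss plus the squared group mean is positive definite, and compactness
supplies `δ`. -/
theorem exists_norm_sqrtScale_combine_sq_le [FiniteDimensional ℝ E] (hgroup : IsGrouping nbr group wo)
    (hA : IsCombination nbr group A) (hp : IsPerronVector group A p) :
    ∃ δ, 0 < δ ∧ ∀ y : BlockVec N E, ‖sqrtScale p (blockMap A.transpose y)‖ ^ 2 ≤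
      ‖sqrtScale p y‖ ^ 2 - δ * ‖y - blockMap (groupMean group p) y‖ ^ 2 := by
  have hpos := hp.pos hgroup hA
  have hvar := sum_mul_norm_sub_combine_sq (E := E) hA hp hpos
  have hQQ : ∀ y : BlockVec N E, blockMap (groupMean group p) (blockMap (groupMean group p) y) =
      blockMap (groupMean group p) y := fun y => by rw [← blockMap_mul, groupMean_mul_self hp]
  have hnn : ∀ (y : BlockVec N E) k, 0 ≤ p k * ∑ l, A l k * ‖y l - blockMap A.transpose y k‖ ^ 2 :=
    fun y k => mul_nonneg (hpos k).le
      (Finset.sum_nonneg fun l _ => mul_nonneg (hA.nonneg l k) (sq_nonneg _))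
  obtain ⟨δ, hδ, hle⟩ := exists_pos_mul_norm_sq_le (E := BlockVec N E)
    (f := fun y => ‖sqrtScale p y‖ ^ 2 - ‖sqrtScale p (blockMap A.transpose y)‖ ^ 2
      + ‖blockMap (groupMean group p) y‖ ^ 2) (by fun_prop)
    (fun c x => by simp only [map_smul, norm_smul, mul_pow, Real.norm_eq_abs, sq_abs]; ring)
    (fun y hy => by
      have h0 : 0 ≤ ‖sqrtScale p y‖ ^ 2 - ‖sqrtScale p (blockMap A.transpose y)‖ ^ 2 := by
        rw [← hvar]; exact Finset.sum_nonneg fun k _ => hnn y k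
      by_contra hcon
      have h1 : ‖sqrtScale p y‖ ^ 2 - ‖sqrtScale p (blockMap A.transpose y)‖ ^ 2 = 0 := by
        nlinarith [sq_nonneg ‖blockMap (groupMean group p) y‖]
      have h2 : blockMap (groupMean group p) y = 0 := by
        have : ‖blockMap (groupMean group p) y‖ ^ 2 = 0 := by
          nlinarith [sq_nonneg ‖blockMap (groupMean group p) y‖]
        simpa using this
      rw [← hvar, Finset.sum_eq_zero_iff_of_nonneg fun k _ => hnn y k] at h1
      have h3 : ∀ l k, l ∈ nbr k → group l = group k → y l = blockMap A.transpose y k := by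
        intro l k hl hlk
        have h4 := (mul_eq_zero.1 (h1 k (Finset.mem_univ k))).resolve_left (hpos k).ne'
        rw [Finset.sum_eq_zero_iff_of_nonneg fun l _ =>
          mul_nonneg (hA.nonneg l k) (sq_nonneg _)] at h4
        have h5 := (mul_eq_zero.1 (h4 l (Finset.mem_univ l))).resolve_left (hA.pos l k hl hlk).ne'
        exact sub_eq_zero.1 (norm_eq_zero.1 (pow_eq_zero_iff two_ne_zero |>.1 h5))
      -- Each neighbor of an agent carries the combined value at that agent; the agent is its own
      -- neighbor, so linked agents agree.
      have h6 : ∀ k l, group k = group l → y k = y l := by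
        intro k l hkl
        have hpath := hgroup.connected k l hkl
        clear hkl
        induction hpath with
        | refl => rfl
        | tail _ h ih => rw [ih, h3 _ _ h.1 h.2, ← h3 _ _ (hgroup.self_mem _) rfl]
      exact hy ((blockMap_groupMean_of_const hp h6).symm.trans h2))
  refine ⟨δ, hδ, fun y => ?_⟩
  -- Removing the group mean kills the extra term of the form, and the loss does not notice it:
  -- variances inside a group ignore a common shift.
  have h := hle (y - blockMap (groupMean group p) y)
  rw [map_sub (blockMap (groupMean group p)), hQQ, sub_self, norm_zero, ← hvar] at h
  have h7 : ∑ k, p k * ∑ l, A l k * ‖(y - blockMap (groupMean group p) y) l -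
      blockMap A.transpose (y - blockMap (groupMean group p) y) k‖ ^ 2 =
      ∑ k, p k * ∑ l, A l k * ‖y l - blockMap A.transpose y k‖ ^ 2 := by
    refine Finset.sum_congr rfl fun k _ => ?_
    congr 1
    refine Finset.sum_congr rfl fun l _ => ?_
    by_cases hlk : group l = group k
    · rw [map_sub, ← blockMap_mul A.transpose, transpose_mul_groupMean hA]
      simp only [PiLp.sub_apply]
      rw [blockMap_groupMean_congr hlk y, sub_sub_sub_cancel_right]
    · rw [hA.eq_zero hlk, zero_mul, zero_mul]
  rw [h7, hvar] at h
  linarith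

/-- The deviation of every block from the `p`-weighted mean over its group. -/
noncomputable def groupDeviation (group : Fin N → Fin G) (p : Fin N → ℝ) :
    BlockVec N E →L[ℝ] BlockVec N E :=
  ContinuousLinearMap.id ℝ _ - blockMap (groupMean group p)

theorem groupDeviation_apply (y : BlockVec N E) :
    groupDeviation group p y = y - blockMap (groupMean group p) y := rfl

/-- Combination commutes with taking deviations, so the previous loss applies to a vector of zero
group mean, where it is a fixed fraction of the weighted norm. -/
theorem exists_deviation_contraction [FiniteDimensional ℝ E] (hgroup : IsGrouping nbr group wo)
    (hA : IsCombination nbr group A) (hp : IsPerronVector group A p) :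
    ∃ ρ, 0 < ρ ∧ ρ ≤ 1 ∧ ∀ y : BlockVec N E,
      ‖sqrtScale p (groupDeviation group p (blockMap A.transpose y))‖ ^ 2 ≤
        (1 - ρ) * ‖sqrtScale p (groupDeviation group p y)‖ ^ 2 := by
  obtain ⟨δ, hδ, hle⟩ := exists_norm_sqrtScale_combine_sq_le (E := E) hgroup hA hp
  set S : BlockVec N E →L[ℝ] BlockVec N E := sqrtScale p
  set Q : BlockVec N E →L[ℝ] BlockVec N E := blockMap (groupMean group p) with hQ
  set L : BlockVec N E →L[ℝ] BlockVec N E := blockMap A.transpose with hL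
  have hQL : ∀ y, Q (L y) = L (Q y) := fun y => by
    rw [hQ, hL, ← blockMap_mul, ← blockMap_mul, groupMean_mul_transpose hA hp,
      transpose_mul_groupMean hA]
  have hQQ : ∀ y, Q (Q y) = Q y := fun y => by rw [hQ, ← blockMap_mul, groupMean_mul_self hp]
  -- The summand `δ` in the denominator gives `ρ ≤ 1` and avoids dividing by zero when `S = 0`.
  set ρ := δ / (δ + ‖S‖ ^ 2) with hρ
  have hρ0 : 0 < ρ := by positivity
  refine ⟨ρ, hρ0, div_le_one_of_le₀ (by linarith [sq_nonneg ‖S‖]) (by positivity), fun y => ?_⟩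
  change ‖S (L y - Q (L y))‖ ^ 2 ≤ (1 - ρ) * ‖S (y - Q y)‖ ^ 2
  have h1 := hle (y - Q y)
  rw [map_sub Q, hQQ, sub_self, sub_zero, map_sub L, ← hQL] at h1
  have h2 : ‖S (y - Q y)‖ ^ 2 ≤ ‖S‖ ^ 2 * ‖y - Q y‖ ^ 2 := by
    rw [← mul_pow]; gcongr; exact S.le_opNorm _
  have h3 : ρ * ‖S (y - Q y)‖ ^ 2 ≤ δ * ‖y - Q y‖ ^ 2 := by
    calc ρ * ‖S (y - Q y)‖ ^ 2 ≤ ρ * (‖S‖ ^ 2 * ‖y - Q y‖ ^ 2) := by gcongr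
      _ ≤ ρ * ((δ + ‖S‖ ^ 2) * ‖y - Q y‖ ^ 2) := by gcongr; linarith
      _ = _ := by rw [hρ]; field_simp
  linarith

/-- A zero of the form is constant on groups and vanishes at one agent of each group. -/
theorem exists_norm_sq_le_weighted_add [FiniteDimensional ℝ E] {w : Fin N → ℝ}
    (hw : ∀ k, 0 ≤ w k) (hw' : ∀ m, ∃ k ∈ groupAgents group m, 0 < w k) :
    ∃ c, 0 < c ∧ ∀ z : BlockVec N E, c * ‖z‖ ^ 2 ≤
      ∑ k, w k * ‖z k‖ ^ 2 + ‖z - blockMap (groupMean group p) z‖ ^ 2 := by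
  refine exists_pos_mul_norm_sq_le (by fun_prop) (fun c x => ?_) fun z hz => ?_
  · rw [map_smul, ← smul_sub, norm_smul, mul_pow, Real.norm_eq_abs, sq_abs, mul_add,
      Finset.mul_sum]
    congr 1
    refine Finset.sum_congr rfl fun k _ => ?_
    rw [PiLp.smul_apply, norm_smul, mul_pow, Real.norm_eq_abs, sq_abs]
    ring
  · by_contra hcon
    have hnn : ∀ k ∈ Finset.univ, 0 ≤ w k * ‖z k‖ ^ 2 :=
      fun k _ => mul_nonneg (hw k) (sq_nonneg _)
    have hs := Finset.sum_nonneg hnn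
    have h1 : ∑ k, w k * ‖z k‖ ^ 2 = 0 := by
      nlinarith [sq_nonneg ‖z - blockMap (groupMean group p) z‖]
    have h2 : z = blockMap (groupMean group p) z := by
      have : ‖z - blockMap (groupMean group p) z‖ ^ 2 = 0 := by
        nlinarith [sq_nonneg ‖z - blockMap (groupMean group p) z‖]
      exact sub_eq_zero.1 (norm_eq_zero.1 (pow_eq_zero_iff two_ne_zero |>.1 this))
    rw [Finset.sum_eq_zero_iff_of_nonneg hnn] at h1
    refine hz (PiLp.ext fun k => ?_)
    obtain ⟨j, hj, hwj⟩ := hw' (group k)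
    have hjk : group k = group j := by simpa [groupAgents, eq_comm] using hj
    have h3 := (mul_eq_zero.1 (h1 j (Finset.mem_univ j))).resolve_left hwj.ne'
    have h4 : z j = 0 := by simpa using h3
    rw [h2, blockMap_groupMean_congr hjk, ← h2, h4]; rfl

/-- Neither mechanism suffices alone: the drift may not see agents with `lam k = 0`, and combination
does not see group means. The drift gains order `t` and the loss on deviations order one, so for
small `t` their sum dominates `t ‖z‖²`, and the terms of order `t²` are absorbed. -/
theorem exists_drift_contraction [FiniteDimensional ℝ E] (hgroup : IsGrouping nbr group wo)
    (hA : IsCombination nbr group A) (hp : IsPerronVector group A p)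
    {μ lam : Fin N → ℝ} (hμ : ∀ k, 0 < μ k) (hlam : ∀ k, 0 ≤ lam k)
    (hlam' : ∀ m, ∃ k ∈ groupAgents group m, 0 < lam k) {g : BlockVec N E → BlockVec N E} {C : ℝ}
    (hC : ∀ z, ‖g z‖ ≤ C * ‖z‖)
    (hg : ∀ z k, inner ℝ (z k) (g z k) ≤ -(lam k * ‖z k‖ ^ 2)) :
    ∃ c, 0 < c ∧ ∀ᶠ t in 𝓝[>] (0 : ℝ), ∀ z,
      ‖sqrtScale p (blockMap A.transpose (z + t • blockMap (Matrix.diagonal μ) (g z)))‖ ^ 2 ≤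
        (1 - c * t) * ‖sqrtScale p z‖ ^ 2 := by
  have hpos := hp.pos hgroup hA
  obtain ⟨δ, hδ, hcontr⟩ := exists_norm_sqrtScale_combine_sq_le (E := E) hgroup hA hp
  obtain ⟨c, hc, hcoer⟩ := exists_norm_sq_le_weighted_add (E := E) (p := p)
    (w := fun k => p k * (μ k * lam k))
    (fun k => mul_nonneg (hpos k).le (mul_nonneg (hμ k).le (hlam k)))
    (fun m => by
      obtain ⟨k, hk, h⟩ := hlam' m
      exact ⟨k, hk, mul_pos (hpos k) (mul_pos (hμ k) h)⟩)
  set S : BlockVec N E →L[ℝ] BlockVec N E := sqrtScale p with hS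
  set D : BlockVec N E →L[ℝ] BlockVec N E := blockMap (Matrix.diagonal μ) with hD
  set Q : BlockVec N E →L[ℝ] BlockVec N E := blockMap (groupMean group p) with hQ
  set K₁ := ‖S.comp D‖ * C
  set K₂ := ‖D - Q.comp D‖ * C
  have hb : ∀ (T : BlockVec N E →L[ℝ] BlockVec N E) z, ‖T (g z)‖ ^ 2 ≤ (‖T‖ * C) ^ 2 * ‖z‖ ^ 2 := by
    intro T z
    rw [← mul_pow, mul_assoc]
    gcongr
    exact (T.le_opNorm _).trans (mul_le_mul_of_nonneg_left (hC z) (norm_nonneg _))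
  have hSn : (0 : ℝ) < ‖S‖ ^ 2 + 1 := by positivity
  refine ⟨c / (‖S‖ ^ 2 + 1), by positivity, ?_⟩
  -- The first threshold turns half of `δ` into a deviation gain of `2t`; the second keeps the terms
  -- of order `t²` below half of the resulting `2tc ‖z‖²`.
  have e1 : ∀ᶠ t in 𝓝[>] (0 : ℝ), t < δ / 4 :=
    nhdsWithin_le_nhds (gt_mem_nhds (by positivity))
  have e2 : ∀ᶠ t in 𝓝[>] (0 : ℝ), t < c / (K₁ ^ 2 + δ * K₂ ^ 2 + 1) :=
    nhdsWithin_le_nhds (gt_mem_nhds (by positivity))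
  filter_upwards [e1, e2, self_mem_nhdsWithin] with t ht1 ht2 ht0 z
  have ht0 : 0 < t := ht0
  rw [lt_div_iff₀ (by positivity)] at ht2
  have h1 := hcontr (z + t • D (g z))
  have h2 : ‖S (z + t • D (g z))‖ ^ 2 = ‖S z‖ ^ 2 + 2 * (t * inner ℝ (S z) (S (D (g z))))
      + t ^ 2 * ‖S (D (g z))‖ ^ 2 := by
    rw [map_add, map_smul, norm_add_sq_real, real_inner_smul_right, norm_smul, mul_pow,
      Real.norm_eq_abs, sq_abs]
  have h3 : inner ℝ (S z) (S (D (g z))) ≤ -∑ k, p k * (μ k * lam k) * ‖z k‖ ^ 2 := by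
    rw [hS, inner_sqrtScale hpos, ← Finset.sum_neg_distrib]
    refine Finset.sum_le_sum fun k _ => ?_
    rw [hD, blockMap_diagonal, real_inner_smul_right]
    have := mul_le_mul_of_nonneg_left (hg z k) (mul_pos (hpos k) (hμ k)).le
    linarith
  have h4 : ‖S (D (g z))‖ ^ 2 ≤ K₁ ^ 2 * ‖z‖ ^ 2 := hb (S.comp D) z
  have h5 : ‖D (g z) - Q (D (g z))‖ ^ 2 ≤ K₂ ^ 2 * ‖z‖ ^ 2 := hb (D - Q.comp D) z
  -- The loss is measured after the gradient step, so it is carried back to `z` at a cost of order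
  -- `t²`.
  have h6 : ‖z - Q z‖ ^ 2 ≤ 2 * ‖(z + t • D (g z)) - Q (z + t • D (g z))‖ ^ 2
      + 2 * (t ^ 2 * ‖D (g z) - Q (D (g z))‖ ^ 2) := by
    have e : z - Q z = ((z + t • D (g z)) - Q (z + t • D (g z))) -
        t • (D (g z) - Q (D (g z))) := by
      rw [map_add, map_smul, smul_sub]; abel
    have e' : t ^ 2 * ‖D (g z) - Q (D (g z))‖ ^ 2 = ‖t • (D (g z) - Q (D (g z)))‖ ^ 2 := by
      rw [norm_smul, mul_pow, Real.norm_eq_abs, sq_abs]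
    rw [e', e]
    set a := (z + t • D (g z)) - Q (z + t • D (g z))
    set b := t • (D (g z) - Q (D (g z)))
    have := parallelogram_law_with_norm ℝ a b
    nlinarith [sq_nonneg ‖a + b‖]
  have h7 := hcoer z
  set X := ∑ k, p k * (μ k * lam k) * ‖z k‖ ^ 2
  set Y := ‖z - Q z‖ ^ 2
  have hY : 0 ≤ Y := sq_nonneg _
  have h8 : ‖S z‖ ^ 2 ≤ (‖S‖ ^ 2 + 1) * ‖z‖ ^ 2 := by
    have : ‖S z‖ ^ 2 ≤ (‖S‖ * ‖z‖) ^ 2 := by gcongr; exact S.le_opNorm z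
    nlinarith [sq_nonneg ‖z‖]
  have h9 : c / (‖S‖ ^ 2 + 1) * t * ‖S z‖ ^ 2 ≤ c * t * ‖z‖ ^ 2 := by
    calc c / (‖S‖ ^ 2 + 1) * t * ‖S z‖ ^ 2
        ≤ c / (‖S‖ ^ 2 + 1) * t * ((‖S‖ ^ 2 + 1) * ‖z‖ ^ 2) := by gcongr
      _ = _ := by field_simp
  have h10 : ‖S (blockMap A.transpose (z + t • D (g z)))‖ ^ 2 ≤ ‖S z‖ ^ 2 - 2 * t * X
      - δ / 2 * Y + t ^ 2 * ((K₁ ^ 2 + δ * K₂ ^ 2) * ‖z‖ ^ 2) := by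
    have a1 := mul_le_mul_of_nonneg_left h3 ht0.le
    have a2 := mul_le_mul_of_nonneg_left h4 (sq_nonneg t)
    have a3 := mul_le_mul_of_nonneg_left h5 (mul_pos hδ (pow_pos ht0 2)).le
    have a4 := mul_le_mul_of_nonneg_left h6 hδ.le
    linarith
  have h11 : δ / 2 * Y ≥ 2 * t * Y := by gcongr; linarith
  have h12 : 2 * t * (c * ‖z‖ ^ 2) ≤ 2 * t * (X + Y) := by gcongr
  have h13 : t ^ 2 * ((K₁ ^ 2 + δ * K₂ ^ 2) * ‖z‖ ^ 2) ≤ t * c * ‖z‖ ^ 2 := by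
    have : t * (K₁ ^ 2 + δ * K₂ ^ 2) ≤ c := by linarith
    calc t ^ 2 * ((K₁ ^ 2 + δ * K₂ ^ 2) * ‖z‖ ^ 2)
        = t * (t * (K₁ ^ 2 + δ * K₂ ^ 2)) * ‖z‖ ^ 2 := by ring
      _ ≤ t * c * ‖z‖ ^ 2 := by gcongr
  linarith

end Network

/-! ### Mean value estimates for gradient maps. -/

section MeanValue

variable {F : Type*} [NormedAddCommGroup F] [InnerProductSpace ℝ F] {f : F → F} {f' : F → F →L[ℝ] F}

/-- Testing against a fixed `v` reduces this to the scalar mean value theorem, so the derivative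
need not be continuous. The point `ξ` depends on `v`; norm bounds follow by letting `v` be the
vector to be bounded. -/
theorem exists_inner_sub_eq_inner_fderiv (hf : ∀ x, HasFDerivAt f (f' x) x) (x w v : F) :
    ∃ ξ, ‖ξ - x‖ ≤ ‖w‖ ∧ inner ℝ v (f (x + w) - f x) = inner ℝ v (f' ξ w) := by
  have hd : ∀ s : ℝ, HasDerivAt (fun s : ℝ => inner ℝ v (f (x + s • w)))
      (inner ℝ v (f' (x + s • w) w)) s := by
    intro s
    have h1 : HasDerivAt (fun s : ℝ => x + s • w) w s := by
      simpa using ((hasDerivAt_id s).smul_const w).const_add x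
    have h2 := (hf (x + s • w)).comp_hasDerivAt s h1
    exact (innerSL ℝ v).hasFDerivAt.comp_hasDerivAt s h2
  obtain ⟨s, hs, h⟩ := exists_hasDerivAt_eq_slope _ _ (zero_lt_one' ℝ)
    (fun s _ => (hd s).continuousAt.continuousWithinAt) (fun s _ => hd s)
  refine ⟨x + s • w, ?_, ?_⟩
  · rw [add_sub_cancel_left, norm_smul, Real.norm_eq_abs, abs_of_pos hs.1]
    exact mul_le_of_le_one_left (norm_nonneg _) hs.2.le
  · rw [h]; simp [inner_sub_right]

theorem mul_norm_sq_le_inner_sub (hf : ∀ x, HasFDerivAt f (f' x) x) {a : ℝ}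
    (ha : ∀ x v, a * ‖v‖ ^ 2 ≤ inner ℝ v (f' x v)) (x w : F) :
    a * ‖w‖ ^ 2 ≤ inner ℝ w (f (x + w) - f x) := by
  obtain ⟨ξ, -, h⟩ := exists_inner_sub_eq_inner_fderiv hf x w w
  rw [h]; exact ha ξ w

/-- With `v` the increment, expand the nonnegative form of `f' ξ` at `v - (b + 1) • w`, whose cross
term is `‖v‖²`. Using `b + 1` in place of `b` keeps the factor to be cancelled positive. -/
theorem norm_sub_le_of_symmetric (hf : ∀ x, HasFDerivAt f (f' x) x) {b : ℝ} (hb0 : 0 ≤ b)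
    (h0 : ∀ x v, 0 ≤ inner ℝ v (f' x v)) (hb : ∀ x v, inner ℝ v (f' x v) ≤ b * ‖v‖ ^ 2)
    (hsymm : ∀ x v w, inner ℝ v (f' x w) = inner ℝ w (f' x v)) (x w : F) :
    ‖f (x + w) - f x‖ ≤ (b + 1) * ‖w‖ := by
  set v := f (x + w) - f x with hv
  obtain ⟨ξ, -, h⟩ := exists_inner_sub_eq_inner_fderiv hf x w v
  rw [← hv, real_inner_self_eq_norm_sq] at h
  have h1 := h0 ξ (v - (b + 1) • w)
  simp only [map_sub, map_smul, inner_sub_left, inner_sub_right, real_inner_smul_left,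
    real_inner_smul_right, hsymm ξ w v, ← h] at h1
  have h2 := hb ξ v
  have h3 := mul_le_mul_of_nonneg_left (hb ξ w) (sq_nonneg (b + 1))
  refine le_of_sq_le_sq ?_ (by positivity)
  have h4 : 2 * (b + 1) * ‖v‖ ^ 2 ≤ (b + 1) * (‖v‖ ^ 2 + (b + 1) ^ 2 * ‖w‖ ^ 2) := by
    nlinarith [sq_nonneg ‖v‖, sq_nonneg ((b + 1) * ‖w‖)]
  have h5 : (b + 1) * (2 * ‖v‖ ^ 2) ≤ (b + 1) * (‖v‖ ^ 2 + (b + 1) ^ 2 * ‖w‖ ^ 2) := by linarith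
  have h6 := le_of_mul_le_mul_left h5 (by linarith)
  nlinarith

theorem norm_sub_sub_le_of_lipschitz (hf : ∀ x, HasFDerivAt f (f' x) x) {κ : ℝ} (hκ : 0 ≤ κ)
    (x : F) (hL : ∀ y v w, inner ℝ v (f' y w - f' x w) ≤ κ * ‖y - x‖ * (‖v‖ * ‖w‖)) (w : F) :
    ‖f (x + w) - f x - f' x w‖ ≤ κ * ‖w‖ ^ 2 := by
  set v := f (x + w) - f x - f' x w with hv
  obtain ⟨ξ, hξ, h⟩ := exists_inner_sub_eq_inner_fderiv hf x w v
  have h1 : ‖v‖ * ‖v‖ ≤ ‖v‖ * (κ * ‖w‖ ^ 2) := by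
    calc ‖v‖ * ‖v‖ = inner ℝ v (f (x + w) - f x - f' x w) := by
          rw [← hv, real_inner_self_eq_norm_mul_norm]
      _ = inner ℝ v (f' ξ w - f' x w) := by rw [inner_sub_right, h, inner_sub_right]
      _ ≤ κ * ‖ξ - x‖ * (‖v‖ * ‖w‖) := hL ξ v w
      _ ≤ κ * ‖w‖ * (‖v‖ * ‖w‖) := by gcongr
      _ = _ := by ring
  by_cases hv0 : ‖v‖ = 0
  · rw [hv0]; positivity
  · exact le_of_mul_le_mul_left h1 ((norm_nonneg v).lt_of_ne' hv0)

end MeanValue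

theorem abs_dotProduct_mulVec_le {n : Type*} [Fintype n] [DecidableEq n] (A : Matrix n n ℝ)
    (v w : EuclideanSpace ℝ n) : |v.ofLp ⬝ᵥ A.mulVec w.ofLp| ≤ ‖A‖ * (‖v‖ * ‖w‖) := by
  have h := Matrix.inner_toEuclideanCLM A v w
  have h1 : v.ofLp ⬝ᵥ A.mulVec w.ofLp = inner ℝ v (Matrix.toEuclideanCLM (𝕜 := ℝ) A w) := by
    rw [h]
  rw [h1]
  calc _ ≤ ‖v‖ * ‖Matrix.toEuclideanCLM (𝕜 := ℝ) A w‖ := abs_real_inner_le_norm _ _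
    _ ≤ ‖v‖ * (‖A‖ * ‖w‖) := by
        gcongr
        rw [← Matrix.l2_opNorm_toEuclideanCLM]
        exact ContinuousLinearMap.le_opNorm _ _
    _ = _ := by ring

/-! ### Consequences of the cost assumptions. -/

section Cost

variable {N M G : ℕ}

theorem fderiv_gradient_eq (f : EuclideanSpace ℝ (Fin M) → ℝ) (x v : EuclideanSpace ℝ (Fin M)) :
    fderiv ℝ (gradient f) x v = Matrix.toEuclideanCLM (𝕜 := ℝ) (hessianMatrix f x) v := by
  have hv : v = ∑ b, v b • EuclideanSpace.single b (1 : ℝ) := by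
    have := (EuclideanSpace.basisFun (Fin M) ℝ).sum_repr v
    simpa using this.symm
  refine PiLp.ext fun a => ?_
  rw [Matrix.ofLp_toEuclideanCLM]
  conv_lhs => rw [hv]
  simp [Matrix.mulVec, dotProduct, hessianMatrix, mul_comm]

theorem inner_fderiv_gradient (f : EuclideanSpace ℝ (Fin M) → ℝ)
    (x v w : EuclideanSpace ℝ (Fin M)) :
    inner ℝ v (fderiv ℝ (gradient f) x w) = v.ofLp ⬝ᵥ (hessianMatrix f x).mulVec w.ofLp := by
  rw [fderiv_gradient_eq, Matrix.inner_toEuclideanCLM]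

theorem norm_single_sub_single {E : Type*} [NormedAddCommGroup E] (k : Fin N) (x y : E) :
    ‖(WithLp.toLp 2 (Pi.single k x) : BlockVec N E) - WithLp.toLp 2 (Pi.single k y)‖ =
      ‖x - y‖ := by
  rw [← sq_eq_sq₀ (norm_nonneg _) (norm_nonneg _), blockVec_norm_sq, Finset.sum_eq_single k]
  · simp
  · intro b _ hb; simp [hb]
  · simp

/-- Network vectors supported on the single block `k` isolate one diagonal block of the network
Hessian. -/
theorem dotProduct_hessian_sub_le (J : Fin N → EuclideanSpace ℝ (Fin M) → ℝ) {κ : ℝ}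
    (h : ∀ W₁ W₂ : NetVec N M, ‖networkHessian J W₁ - networkHessian J W₂‖ ≤ κ * ‖W₁ - W₂‖)
    (k : Fin N) (x y v w : EuclideanSpace ℝ (Fin M)) :
    v.ofLp ⬝ᵥ (hessianMatrix (J k) y - hessianMatrix (J k) x).mulVec w.ofLp ≤
      κ * ‖y - x‖ * (‖v‖ * ‖w‖) := by
  set emb : EuclideanSpace ℝ (Fin M) → EuclideanSpace ℝ (Fin N × Fin M) :=
    fun v => WithLp.toLp 2 fun z => if z.1 = k then v z.2 else 0 with hemb
  have hnorm : ∀ v, ‖emb v‖ = ‖v‖ := by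
    intro v
    rw [EuclideanSpace.norm_eq, EuclideanSpace.norm_eq, Fintype.sum_prod_type]
    congr 1
    rw [Finset.sum_eq_single k]
    · simp [hemb]
    · intro b _ hb; simp [hemb, hb]
    · simp
  set W : EuclideanSpace ℝ (Fin M) → NetVec N M := fun x => WithLp.toLp 2 (Pi.single k x) with hW
  have hWn : ‖W y - W x‖ = ‖y - x‖ := norm_single_sub_single k y x
  have h1 := (le_abs_self _).trans
    (abs_dotProduct_mulVec_le (networkHessian J (W y) - networkHessian J (W x)) (emb v) (emb w))
  have h2 : (emb v).ofLp ⬝ᵥ (networkHessian J (W y) - networkHessian J (W x)).mulVec (emb w).ofLp =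
      v.ofLp ⬝ᵥ (hessianMatrix (J k) y - hessianMatrix (J k) x).mulVec w.ofLp := by
    simp only [dotProduct, Matrix.mulVec, Fintype.sum_prod_type]
    rw [Finset.sum_eq_single k]
    · refine Finset.sum_congr rfl fun a _ => ?_
      rw [Finset.sum_eq_single k]
      · simp [hemb, networkHessian, hW]
      · intro b _ hb; simp [hemb, hb]
      · simp
    · intro b _ hb; simp [hemb, hb]
    · simp
  rw [h2, hnorm, hnorm] at h1
  refine h1.trans ?_
  gcongr
  exact (h _ _).trans_eq (by rw [hWn])

theorem dotProduct_mulVec_of_posSemidef_sub {n : Type*} [Fintype n] [DecidableEq n]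
    {A B : Matrix n n ℝ} (h : (A - B).PosSemidef) (v : n → ℝ) :
    v ⬝ᵥ B.mulVec v ≤ v ⬝ᵥ A.mulVec v := by
  have := h.dotProduct_mulVec_nonneg v
  rw [Matrix.sub_mulVec, dotProduct_sub] at this
  simpa using this

/-- The gradients at `wo - z`, as a function of the network error `z`. -/
noncomputable def gradError (J : Fin N → EuclideanSpace ℝ (Fin M) → ℝ) (wo z : NetVec N M) :
    NetVec N M :=
  WithLp.toLp 2 fun k => gradient (J k) (wo k - z k)

/-- What the recursion needs from the costs: dissipativity, linear growth and a quadratic Taylor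
remainder for `gradError`, and symmetry and lower bounds for the Hessians at the minimizers. The
signs are those of gradients taken at `wo - z`. -/
theorem CostAssumption.exists_bounds {group : Fin N → Fin G}
    {J : Fin N → EuclideanSpace ℝ (Fin M) → ℝ} {wo : NetVec N M} (h : CostAssumption group J wo) :
    ∃ (lam : Fin N → ℝ) (C κ : ℝ), (∀ k, 0 ≤ lam k) ∧
      (∀ m, ∃ k ∈ groupAgents group m, 0 < lam k) ∧ 0 ≤ C ∧ 0 ≤ κ ∧
      (∀ z k, inner ℝ (z k) (gradError J wo z k) ≤ -(lam k * ‖z k‖ ^ 2)) ∧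
      (∀ z, ‖gradError J wo z‖ ≤ C * ‖z‖) ∧
      (∀ z k, ‖gradError J wo z k +
        Matrix.toEuclideanCLM (𝕜 := ℝ) (hessianMatrix (J k) (wo k)) (z k)‖ ≤ κ * ‖z k‖ ^ 2) ∧
      (∀ k, (hessianMatrix (J k) (wo k)).IsHermitian) ∧
      (∀ k (v : EuclideanSpace ℝ (Fin M)), lam k * ‖v‖ ^ 2 ≤
        v.ofLp ⬝ᵥ (hessianMatrix (J k) (wo k)).mulVec v.ofLp) := by
  obtain ⟨lamL, lamU, hb, hpos⟩ := h.hessian_bounds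
  obtain ⟨κ, hκ, hlip⟩ := h.hessian_lipschitz
  have hgrad : ∀ k, gradient (J k) (wo k) = 0 := fun k => by
    rw [gradient, ((h.minimizer k).isLocalMin univ_mem).fderiv_eq_zero, map_zero]
  have hd : ∀ k x, HasFDerivAt (gradient (J k)) (fderiv ℝ (gradient (J k)) x) x :=
    fun k x => (h.twice_differentiable k x).hasFDerivAt
  have hone : ∀ (c : ℝ) (v : EuclideanSpace ℝ (Fin M)),
      v.ofLp ⬝ᵥ (c • (1 : Matrix (Fin M) (Fin M) ℝ)).mulVec v.ofLp = c * ‖v‖ ^ 2 := by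
    intro c v
    rw [Matrix.smul_mulVec, Matrix.one_mulVec, dotProduct_smul, smul_eq_mul,
      EuclideanSpace.real_norm_sq_eq]
    simp [dotProduct, sq]
  have hlow : ∀ k x (v : EuclideanSpace ℝ (Fin M)),
      lamL k * ‖v‖ ^ 2 ≤ inner ℝ v (fderiv ℝ (gradient (J k)) x v) := fun k x v => by
    rw [inner_fderiv_gradient, ← hone]
    exact dotProduct_mulVec_of_posSemidef_sub ((hb k).2.2 x).1 _
  have hup : ∀ k x (v : EuclideanSpace ℝ (Fin M)),
      inner ℝ v (fderiv ℝ (gradient (J k)) x v) ≤ lamU k * ‖v‖ ^ 2 := fun k x v => by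
    rw [inner_fderiv_gradient, ← hone]
    exact dotProduct_mulVec_of_posSemidef_sub ((hb k).2.2 x).2 _
  -- Symmetry comes from the lower Hessian bound: a positive semidefinite matrix is Hermitian by
  -- definition.
  have hherm : ∀ k x, (hessianMatrix (J k) x).IsHermitian := fun k x => by
    have h1 : (lamL k • (1 : Matrix (Fin M) (Fin M) ℝ)).IsHermitian := by
      rw [Matrix.IsHermitian, Matrix.conjTranspose_smul, Matrix.conjTranspose_one, star_trivial]
    simpa using ((hb k).2.2 x).1.1.add h1
  have hsymm : ∀ k x (v w : EuclideanSpace ℝ (Fin M)),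
      inner ℝ v (fderiv ℝ (gradient (J k)) x w) = inner ℝ w (fderiv ℝ (gradient (J k)) x v) := by
    intro k x v w
    rw [inner_fderiv_gradient, inner_fderiv_gradient, Matrix.dotProduct_mulVec,
      ← Matrix.mulVec_transpose, dotProduct_comm]
    congr 2
    exact hherm k x
  have hexp : ∀ (z : NetVec N M) k, gradError J wo z k =
      gradient (J k) (wo k + -z k) - gradient (J k) (wo k) := fun z k => by
    rw [hgrad, sub_zero, ← sub_eq_add_neg]; rfl
  refine ⟨lamL, ∑ k, (lamU k + 1), κ, fun k => (hb k).1, hpos,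
    Finset.sum_nonneg fun k _ => by linarith [(hb k).1, (hb k).2.1], hκ, fun z k => ?_,
    fun z => ?_, fun z k => ?_, fun k => hherm k _, fun k v => ?_⟩
  · have := mul_norm_sq_le_inner_sub (hd k) (hlow k) (wo k) (-z k)
    rw [norm_neg, inner_neg_left, ← hexp] at this
    linarith
  · have hk : ∀ k, ‖gradError J wo z k‖ ≤ (∑ k, (lamU k + 1)) * ‖z k‖ := fun k => by
      have := norm_sub_le_of_symmetric (hd k) ((hb k).1.trans (hb k).2.1)
        (fun x v => (mul_nonneg (hb k).1 (sq_nonneg _)).trans (hlow k x v)) (hup k) (hsymm k)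
        (wo k) (-z k)
      rw [norm_neg, ← hexp] at this
      refine this.trans (mul_le_mul_of_nonneg_right ?_ (norm_nonneg _))
      exact Finset.single_le_sum (f := fun k => lamU k + 1)
        (fun k _ => by linarith [(hb k).1, (hb k).2.1]) (Finset.mem_univ k)
    have hC : 0 ≤ ∑ k, (lamU k + 1) :=
      Finset.sum_nonneg fun k _ => by linarith [(hb k).1, (hb k).2.1]
    refine le_of_sq_le_sq ?_ (by positivity)
    rw [mul_pow, blockVec_norm_sq, blockVec_norm_sq z, Finset.mul_sum]
    refine Finset.sum_le_sum fun k _ => ?_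
    rw [← mul_pow]
    exact pow_le_pow_left₀ (norm_nonneg _) (hk k) 2
  · have := norm_sub_sub_le_of_lipschitz (hd k) hκ (wo k) (fun y v w => by
      rw [fderiv_gradient_eq, fderiv_gradient_eq, ← sub_apply, ← map_sub,
        Matrix.inner_toEuclideanCLM]
      simpa using dotProduct_hessian_sub_le J hlip k (wo k) y v w) (-z k)
    rw [← hexp, map_neg, sub_neg_eq_add, norm_neg, fderiv_gradient_eq] at this
    exact this
  · rw [← inner_fderiv_gradient]; exact hlow k _ v

theorem CostAssumption.continuous_gradError {group : Fin N → Fin G}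
    {J : Fin N → EuclideanSpace ℝ (Fin M) → ℝ} {wo : NetVec N M} (h : CostAssumption group J wo) :
    Continuous (gradError J wo) := by
  refine (PiLp.continuous_toLp 2 _).comp (continuous_pi fun k => ?_)
  exact (h.twice_differentiable k).continuous.comp
    (continuous_const.sub (PiLp.continuous_apply 2 _ k))

end Cost

/-! ### Moment bounds for the noisy recursion. -/

section Recursion

variable {Ω : Type*} [mΩ : MeasurableSpace Ω] {P : Measure Ω}
  {ℱ : Filtration ℕ mΩ} {V : Type*} [NormedAddCommGroup V] [InnerProductSpace ℝ V]

/-- The random recursion `z ↦ L (z + t D (g z)) + t L D s`, for every step-size `t`, driven by a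
martingale difference noise `s` whose fourth moment is controlled by that of `z`. -/
structure IsNoisyRecursion (P : Measure Ω) (ℱ : Filtration ℕ mΩ) (L D : V →L[ℝ] V) (g : V → V)
    (K : ℝ) (z s : ℝ → ℕ → Ω → V) : Prop where
  step : ∀ t i ω, z t (i + 1) ω =
    L (z t i ω + t • D (g (z t i ω))) + t • L (D (s t i ω))
  stronglyMeasurable : ∀ t i, StronglyMeasurable[ℱ i] (z t i)
  memLp : ∀ t i, MemLp (z t i) 4 P
  noise_memLp : ∀ t i, MemLp (s t i) 4 P
  noise_condExp : ∀ t i, P[s t i | ℱ i] =ᵐ[P] 0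
  noise_fourth : ∀ t i, ∫ ω, ‖s t i ω‖ ^ 4 ∂P ≤ K * (∫ ω, ‖z t i ω‖ ^ 4 ∂P + 1)

theorem MeasureTheory.MemLp.clm_comp {E F : Type*} [NormedAddCommGroup E] [NormedSpace ℝ E]
    [NormedAddCommGroup F] [NormedSpace ℝ F] (T : E →L[ℝ] F) {f : Ω → E} {q : ℝ≥0∞}
    (hf : MemLp f q P) : MemLp (fun ω => T (f ω)) q P :=
  hf.of_le_mul (T.continuous.comp_aestronglyMeasurable hf.1)
    (ae_of_all _ fun ω => T.le_opNorm (f ω))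

theorem condExp_clm_smul_eq_zero [CompleteSpace V] {F : Type*} [NormedAddCommGroup F] [NormedSpace ℝ F]
    [CompleteSpace F] {m : MeasurableSpace Ω} (T : V →L[ℝ] F) (t : ℝ) {f : Ω → V}
    (hf : Integrable f P) (h : P[f | m] =ᵐ[P] 0) : P[fun ω => t • T (f ω) | m] =ᵐ[P] 0 := by
  have h1 := (t • T).comp_condExp_comm hf (m := m)
  filter_upwards [h1, h] with ω h1 h2
  refine Eq.trans h1.symm ?_
  simp [h2]

variable [IsProbabilityMeasure P] {L D : V →L[ℝ] V} {g : V → V} {K : ℝ} {z s : ℝ → ℕ → Ω → V}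

/-- The fourth moment `u` in the `S`-norm obeys `u ↦ (1 - ct/4) u + K₂ t³`, with fixed point of
order `t²`. The exponent three arises because the noise contributes `t⁴` and the mixed term
multiplies it by `1 / t`. -/
theorem IsNoisyRecursion.exists_fourth_moment_le [CompleteSpace V] (h : IsNoisyRecursion P ℱ L D g K z s)
    (hK : 0 ≤ K) (hg : Continuous g) {C : ℝ} (hC : ∀ x, ‖g x‖ ≤ C * ‖x‖) {S : V →L[ℝ] V} {δ : ℝ}
    (hδ : 0 < δ) (hS : ∀ x, δ * ‖x‖ ^ 2 ≤ ‖S x‖ ^ 2) {c : ℝ} (hc : 0 < c)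
    (hcontr : ∀ᶠ t in 𝓝[>] (0 : ℝ), ∀ x, ‖S (L (x + t • D (g x)))‖ ^ 2 ≤
      (1 - c * t) * ‖S x‖ ^ 2) :
    ∃ K', 0 ≤ K' ∧ ∀ᶠ t in 𝓝[>] (0 : ℝ), ∀ᶠ i in atTop, ∫ ω, ‖z t i ω‖ ^ 4 ∂P ≤ K' * t ^ 2 := by
  set B := S.comp (L.comp D) with hB
  set K₂ := (32 / c + 3) * ‖B‖ ^ 4 * K * ((δ ^ 2)⁻¹ + 1) with hK₂
  have hK₂0 : 0 ≤ K₂ := by positivity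
  refine ⟨(δ ^ 2)⁻¹ * (4 * K₂ / c + 1), by positivity, ?_⟩
  have e1 : ∀ᶠ t in 𝓝[>] (0 : ℝ), t < 1 / c := nhdsWithin_le_nhds (gt_mem_nhds (by positivity))
  have e2 : ∀ᶠ t in 𝓝[>] (0 : ℝ), t < 1 := nhdsWithin_le_nhds (gt_mem_nhds one_pos)
  have e3 : ∀ᶠ t in 𝓝[>] (0 : ℝ), t < c / (4 * K₂ + 1) :=
    nhdsWithin_le_nhds (gt_mem_nhds (by positivity))
  filter_upwards [hcontr, e1, e2, e3, self_mem_nhdsWithin] with t ht ht1 ht2 ht3 ht0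
  have ht0 : 0 < t := ht0
  rw [lt_div_iff₀ hc] at ht1
  rw [lt_div_iff₀ (by positivity)] at ht3
  have hzS : ∀ x, ‖x‖ ^ 4 ≤ (δ ^ 2)⁻¹ * ‖S x‖ ^ 4 := fun x => by
    rw [le_inv_mul_iff₀ (by positivity)]
    calc δ ^ 2 * ‖x‖ ^ 4 = (δ * ‖x‖ ^ 2) ^ 2 := by ring
      _ ≤ (‖S x‖ ^ 2) ^ 2 := by gcongr; exact hS x
      _ = _ := by ring
  have hmemS : ∀ i, MemLp (fun ω => S (z t i ω)) 4 P := fun i => (h.memLp t i).clm_comp S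
  have hstep : ∀ i, ∫ ω, ‖S (z t (i + 1) ω)‖ ^ 4 ∂P ≤
      (1 - c * t / 4) * ∫ ω, ‖S (z t i ω)‖ ^ 4 ∂P + K₂ * t ^ 3 := by
    intro i
    set u := ∫ ω, ‖S (z t i ω)‖ ^ 4 ∂P with hu
    have hu0 : 0 ≤ u := integral_nonneg fun ω => by positivity
    have hgm : MemLp (fun ω => g (z t i ω)) 4 P := (h.memLp t i).of_le_mul
      (hg.comp_aestronglyMeasurable (h.memLp t i).1) (ae_of_all _ fun ω => hC _)
    have ha : StronglyMeasurable[ℱ i] fun ω => S (L (z t i ω + t • D (g (z t i ω)))) :=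
      Continuous.comp_stronglyMeasurable (g := fun x => S (L (x + t • D (g x))))
        (by fun_prop) (h.stronglyMeasurable t i)
    have ha4 : MemLp (fun ω => S (L (z t i ω + t • D (g (z t i ω))))) 4 P :=
      (((h.memLp t i).add ((hgm.clm_comp D).const_smul t)).clm_comp L).clm_comp S
    have hb4 : MemLp (fun ω => t • B (s t i ω)) 4 P :=
      ((h.noise_memLp t i).clm_comp B).const_smul t
    have hb0 := condExp_clm_smul_eq_zero (m := ℱ i) B t
      (h.noise_memLp t i).integrable_of_four (h.noise_condExp t i)
    -- Of the rate `ct`, this `θ` spends one half; the growth of the noise with `z` spends another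
    -- quarter.
    have key := integral_norm_add_pow_four_le_of_condExp_eq_zero (ℱ.le i) ha ha4 hb4 hb0
      (θ := c * t / 2) (by positivity)
    have hz : ∀ ω, S (z t (i + 1) ω) =
        S (L (z t i ω + t • D (g (z t i ω)))) + t • B (s t i ω) := fun ω => by
      rw [h.step, map_add S, map_smul S]; rfl
    simp_rw [hz]
    refine key.trans ?_
    have i1 : ∫ ω, ‖S (L (z t i ω + t • D (g (z t i ω))))‖ ^ 4 ∂P ≤ (1 - c * t) * u := by
      rw [hu, ← integral_const_mul]
      refine integral_mono ha4.integrable_norm_pow_four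
        ((hmemS i).integrable_norm_pow_four.const_mul _) fun ω => ?_
      have h1 : 0 ≤ 1 - c * t := by linarith
      calc ‖S (L (z t i ω + t • D (g (z t i ω))))‖ ^ 4
          = (‖S (L (z t i ω + t • D (g (z t i ω))))‖ ^ 2) ^ 2 := by ring
        _ ≤ ((1 - c * t) * ‖S (z t i ω)‖ ^ 2) ^ 2 := by gcongr; exact ht _
        _ = (1 - c * t) * (1 - c * t) * ‖S (z t i ω)‖ ^ 4 := by ring
        _ ≤ (1 - c * t) * 1 * ‖S (z t i ω)‖ ^ 4 := by
            gcongr; linarith [mul_pos hc ht0]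
        _ = _ := by ring
    have i2 : ∫ ω, ‖z t i ω‖ ^ 4 ∂P ≤ (δ ^ 2)⁻¹ * u := by
      rw [hu, ← integral_const_mul]
      exact integral_mono (h.memLp t i).integrable_norm_pow_four
        ((hmemS i).integrable_norm_pow_four.const_mul _) fun ω => hzS _
    have i3 : ∫ ω, ‖t • B (s t i ω)‖ ^ 4 ∂P ≤ t ^ 4 * (‖B‖ ^ 4 * (K * ((δ ^ 2)⁻¹ * u + 1))) := by
      calc ∫ ω, ‖t • B (s t i ω)‖ ^ 4 ∂P ≤ ∫ ω, t ^ 4 * (‖B‖ ^ 4 * ‖s t i ω‖ ^ 4) ∂P := by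
            refine integral_mono hb4.integrable_norm_pow_four
              (((h.noise_memLp t i).integrable_norm_pow_four.const_mul _).const_mul _) fun ω => ?_
            simp only
            rw [norm_smul, mul_pow, Real.norm_eq_abs, abs_of_pos ht0, ← mul_pow ‖B‖]
            gcongr
            exact B.le_opNorm _
        _ = t ^ 4 * (‖B‖ ^ 4 * ∫ ω, ‖s t i ω‖ ^ 4 ∂P) := by
            rw [integral_const_mul, integral_const_mul]
        _ ≤ _ := by
            gcongr
            exact (h.noise_fourth t i).trans (by gcongr)
    have i4 : (16 / (c * t / 2) + 3) * (t ^ 4 * (‖B‖ ^ 4 * (K * ((δ ^ 2)⁻¹ * u + 1)))) ≤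
        K₂ * t ^ 3 * (u + 1) := by
      have j1 : (16 / (c * t / 2) + 3) * t ^ 4 ≤ (32 / c + 3) * t ^ 3 := by
        have : (16 / (c * t / 2) + 3) * t ^ 4 = (32 / c + 3 * t) * t ^ 3 := by field_simp; ring
        rw [this]; gcongr; linarith
      have j2 : (δ ^ 2)⁻¹ * u + 1 ≤ ((δ ^ 2)⁻¹ + 1) * (u + 1) := by
        have : 0 < (δ ^ 2)⁻¹ := by positivity
        nlinarith
      calc _ = ((16 / (c * t / 2) + 3) * t ^ 4) * (‖B‖ ^ 4 * (K * ((δ ^ 2)⁻¹ * u + 1))) := by ring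
        _ ≤ ((32 / c + 3) * t ^ 3) * (‖B‖ ^ 4 * (K * (((δ ^ 2)⁻¹ + 1) * (u + 1)))) := by gcongr
        _ = _ := by rw [hK₂]; ring
    have i5 : (1 + c * t / 2) * ((1 - c * t) * u) ≤ (1 - c * t / 2) * u := by
      have : 0 ≤ (c * t) ^ 2 * u := by positivity
      nlinarith
    have i6 : K₂ * t ^ 3 * u ≤ c * t / 4 * u := by
      have : K₂ * t ^ 2 ≤ c / 4 := by nlinarith
      calc K₂ * t ^ 3 * u = t * (K₂ * t ^ 2) * u := by ring
        _ ≤ t * (c / 4) * u := by gcongr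
        _ = _ := by ring
    have i7 : (1 + c * t / 2) * ∫ ω, ‖S (L (z t i ω + t • D (g (z t i ω))))‖ ^ 4 ∂P ≤
        (1 + c * t / 2) * ((1 - c * t) * u) := by gcongr
    have i8 := mul_le_mul_of_nonneg_left i3 (by positivity : 0 ≤ 16 / (c * t / 2) + 3)
    linarith
  have hev := eventually_le_of_linear_recursion
    (u := fun i => ∫ ω, ‖S (z t i ω)‖ ^ 4 ∂P) (a := c * t / 4) (by positivity)
    (by linarith) (Eventually.of_forall hstep) (c := (4 * K₂ / c + 1) * t ^ 2) (by
      have : K₂ * t ^ 3 / (c * t / 4) = 4 * K₂ / c * t ^ 2 := by field_simp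
      rw [this]; nlinarith [pow_pos ht0 2])
  filter_upwards [hev] with i hi
  calc ∫ ω, ‖z t i ω‖ ^ 4 ∂P ≤ ∫ ω, (δ ^ 2)⁻¹ * ‖S (z t i ω)‖ ^ 4 ∂P :=
        integral_mono (h.memLp t i).integrable_norm_pow_four
          ((hmemS i).integrable_norm_pow_four.const_mul _) fun ω => hzS _
    _ = (δ ^ 2)⁻¹ * ∫ ω, ‖S (z t i ω)‖ ^ 4 ∂P := integral_const_mul _ _
    _ ≤ (δ ^ 2)⁻¹ * ((4 * K₂ / c + 1) * t ^ 2) := by gcongr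
    _ = _ := by ring

theorem integral_norm_sq_le_one_add {E : Type*} [NormedAddCommGroup E] {f : Ω → E}
    (hf : MemLp f 4 P) : ∫ ω, ‖f ω‖ ^ 2 ∂P ≤ 1 + ∫ ω, ‖f ω‖ ^ 4 ∂P := by
  have h1 : ∫ ω, ‖f ω‖ ^ 2 ∂P ≤ ∫ ω, (1 + ‖f ω‖ ^ 4) ∂P := by
    refine integral_mono hf.integrable_norm_sq_of_four
      ((integrable_const _).add hf.integrable_norm_pow_four) fun ω => ?_
    simp only
    nlinarith [sq_nonneg (‖f ω‖ ^ 2 - 1), sq_nonneg (‖f ω‖ ^ 2)]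
  rw [integral_add (integrable_const _) hf.integrable_norm_pow_four] at h1
  simpa using h1

theorem norm_add_sq_le_mul {E : Type*} [NormedAddCommGroup E] [InnerProductSpace ℝ E] (a b : E)
    {δ : ℝ} (hδ : 0 < δ) : ‖a + b‖ ^ 2 ≤ (1 + δ) * ‖a‖ ^ 2 + (1 + δ⁻¹) * ‖b‖ ^ 2 := by
  have h1 : ‖a + b‖ ^ 2 ≤ (‖a‖ + ‖b‖) ^ 2 := by gcongr; exact norm_add_le a b
  have h2 : 2 * (‖a‖ * ‖b‖) ≤ δ * ‖a‖ ^ 2 + δ⁻¹ * ‖b‖ ^ 2 := by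
    have h3 : 0 ≤ δ⁻¹ * (δ * ‖a‖ - ‖b‖) ^ 2 := by positivity
    have h4 : δ⁻¹ * (δ * ‖a‖ - ‖b‖) ^ 2 = δ * ‖a‖ ^ 2 + δ⁻¹ * ‖b‖ ^ 2 - 2 * (‖a‖ * ‖b‖) := by
      field_simp; ring
    linarith
  nlinarith

/-- Here `Q` is the deviation map. Since `ρ` does not depend on `t`, gradient and noise with merely
bounded second moments, entering with factor `t`, leave a mean square of order `t²`. Young's
inequality with parameter `ρ` degrades the rate to `(1 - ρ)(1 + ρ) = 1 - ρ²`. -/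
theorem IsNoisyRecursion.exists_deviation_le (h : IsNoisyRecursion P ℱ L D g K z s)
    (hK : 0 ≤ K) (hg : Continuous g) {C : ℝ} (hC : ∀ x, ‖g x‖ ≤ C * ‖x‖) {S Q : V →L[ℝ] V} {δ : ℝ}
    (hδ : 0 < δ) (hS : ∀ x, δ * ‖x‖ ^ 2 ≤ ‖S x‖ ^ 2) {ρ : ℝ} (hρ : 0 < ρ) (hρ1 : ρ ≤ 1)
    (hcontr : ∀ x, ‖S (Q (L x))‖ ^ 2 ≤ (1 - ρ) * ‖S (Q x)‖ ^ 2) {K' : ℝ} (hK' : 0 ≤ K')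
    (hfour : ∀ᶠ t in 𝓝[>] (0 : ℝ), ∀ᶠ i in atTop, ∫ ω, ‖z t i ω‖ ^ 4 ∂P ≤ K' * t ^ 2) :
    ∃ K'', 0 ≤ K'' ∧
      ∀ᶠ t in 𝓝[>] (0 : ℝ), ∀ᶠ i in atTop, ∫ ω, ‖Q (z t i ω)‖ ^ 2 ∂P ≤ K'' * t ^ 2 := by
  set B := S.comp (Q.comp D) with hB
  set K₃ := (1 + ρ⁻¹) * (‖B‖ ^ 2 * (2 * (C ^ 2 * (1 + K') + (1 + K * (K' + 1))))) with hK₃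
  have hK₃0 : 0 ≤ K₃ := by positivity
  refine ⟨δ⁻¹ * (K₃ / ρ ^ 2 + 1), by positivity, ?_⟩
  have e2 : ∀ᶠ t in 𝓝[>] (0 : ℝ), t < 1 := nhdsWithin_le_nhds (gt_mem_nhds one_pos)
  filter_upwards [hfour, e2, self_mem_nhdsWithin] with t ht ht2 ht0
  have ht0 : 0 < t := ht0
  have hmem : ∀ i, MemLp (fun ω => S (Q (z t i ω))) 4 P := fun i =>
    ((h.memLp t i).clm_comp Q).clm_comp S
  have hstep : ∀ᶠ i in atTop, ∫ ω, ‖S (Q (z t (i + 1) ω))‖ ^ 2 ∂P ≤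
      (1 - ρ ^ 2) * ∫ ω, ‖S (Q (z t i ω))‖ ^ 2 ∂P + K₃ * t ^ 2 := by
    filter_upwards [ht] with i hi
    have hgm : MemLp (fun ω => g (z t i ω)) 4 P := (h.memLp t i).of_le_mul
      (hg.comp_aestronglyMeasurable (h.memLp t i).1) (ae_of_all _ fun ω => hC _)
    have hz4 : ∫ ω, ‖z t i ω‖ ^ 4 ∂P ≤ K' := by
      refine hi.trans (mul_le_of_le_one_right hK' ?_)
      exact pow_le_one₀ ht0.le ht2.le
    have hb4 : MemLp (fun ω => g (z t i ω) + s t i ω) 4 P := hgm.add (h.noise_memLp t i)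
    have pt : ∀ ω, ‖S (Q (z t (i + 1) ω))‖ ^ 2 ≤ (1 - ρ ^ 2) * ‖S (Q (z t i ω))‖ ^ 2 +
        (1 + ρ⁻¹) * (t ^ 2 * (‖B‖ ^ 2 * (2 * (C ^ 2 * ‖z t i ω‖ ^ 2 + ‖s t i ω‖ ^ 2)))) := by
      intro ω
      have h1 : z t (i + 1) ω = L (z t i ω + t • D (g (z t i ω) + s t i ω)) := by
        rw [h.step, ← map_smul L, ← map_add L, map_add D, smul_add, add_assoc]
      have h2 : S (Q (z t i ω + t • D (g (z t i ω) + s t i ω))) =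
          S (Q (z t i ω)) + t • B (g (z t i ω) + s t i ω) := by
        rw [map_add Q, map_add S, map_smul Q, map_smul S]; rfl
      have h3 := hcontr (z t i ω + t • D (g (z t i ω) + s t i ω))
      rw [← h1, h2] at h3
      have h4 := norm_add_sq_le_mul (S (Q (z t i ω))) (t • B (g (z t i ω) + s t i ω)) hρ
      have h5 : ‖t • B (g (z t i ω) + s t i ω)‖ ^ 2 ≤
          t ^ 2 * (‖B‖ ^ 2 * (2 * (C ^ 2 * ‖z t i ω‖ ^ 2 + ‖s t i ω‖ ^ 2))) := by
        rw [norm_smul, mul_pow, Real.norm_eq_abs, sq_abs]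
        gcongr
        calc ‖B (g (z t i ω) + s t i ω)‖ ^ 2 ≤ (‖B‖ * ‖g (z t i ω) + s t i ω‖) ^ 2 := by
              gcongr; exact B.le_opNorm _
          _ = ‖B‖ ^ 2 * ‖g (z t i ω) + s t i ω‖ ^ 2 := mul_pow _ _ _
          _ ≤ _ := by
              gcongr
              have h6 := norm_add_sq_le_mul (g (z t i ω)) (s t i ω) one_pos
              have h7 : ‖g (z t i ω)‖ ^ 2 ≤ C ^ 2 * ‖z t i ω‖ ^ 2 := by
                rw [← mul_pow]; gcongr; exact hC _
              norm_num at h6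
              linarith
      have h8 : 0 ≤ ‖S (Q (z t i ω)) + t • B (g (z t i ω) + s t i ω)‖ ^ 2 := sq_nonneg _
      have h9 : 0 ≤ 1 - ρ := by linarith
      have hinv : 0 < ρ⁻¹ := by positivity
      calc _ ≤ (1 - ρ) * ((1 + ρ) * ‖S (Q (z t i ω))‖ ^ 2 +
            (1 + ρ⁻¹) * ‖t • B (g (z t i ω) + s t i ω)‖ ^ 2) :=
            h3.trans (mul_le_mul_of_nonneg_left h4 h9)
        _ = (1 - ρ ^ 2) * ‖S (Q (z t i ω))‖ ^ 2 +
            (1 - ρ) * ((1 + ρ⁻¹) * ‖t • B (g (z t i ω) + s t i ω)‖ ^ 2) := by ring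
        _ ≤ (1 - ρ ^ 2) * ‖S (Q (z t i ω))‖ ^ 2 +
            1 * ((1 + ρ⁻¹) * ‖t • B (g (z t i ω) + s t i ω)‖ ^ 2) := by
            gcongr; linarith
        _ ≤ _ := by rw [one_mul]; gcongr
    have iz := (h.memLp t i).integrable_norm_sq_of_four
    have is := (h.noise_memLp t i).integrable_norm_sq_of_four
    have izs : Integrable (fun ω => C ^ 2 * ‖z t i ω‖ ^ 2 + ‖s t i ω‖ ^ 2) P :=
      (iz.const_mul _).add is
    have iQ := (hmem i).integrable_norm_sq_of_four
    calc _ ≤ ∫ ω, ((1 - ρ ^ 2) * ‖S (Q (z t i ω))‖ ^ 2 + (1 + ρ⁻¹) * (t ^ 2 * (‖B‖ ^ 2 *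
          (2 * (C ^ 2 * ‖z t i ω‖ ^ 2 + ‖s t i ω‖ ^ 2))))) ∂P :=
          integral_mono (hmem (i + 1)).integrable_norm_sq_of_four ((iQ.const_mul _).add
            ((((izs.const_mul 2).const_mul _).const_mul _).const_mul _)) pt
      _ = (1 - ρ ^ 2) * ∫ ω, ‖S (Q (z t i ω))‖ ^ 2 ∂P + (1 + ρ⁻¹) * (t ^ 2 * (‖B‖ ^ 2 *
          (2 * (C ^ 2 * ∫ ω, ‖z t i ω‖ ^ 2 ∂P + ∫ ω, ‖s t i ω‖ ^ 2 ∂P)))) := by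
          rw [integral_add (iQ.const_mul _)
              ((((izs.const_mul 2).const_mul _).const_mul _).const_mul _),
            integral_const_mul, integral_const_mul, integral_const_mul, integral_const_mul,
            integral_const_mul, integral_add (iz.const_mul _) is, integral_const_mul]
      _ ≤ (1 - ρ ^ 2) * ∫ ω, ‖S (Q (z t i ω))‖ ^ 2 ∂P + (1 + ρ⁻¹) * (t ^ 2 * (‖B‖ ^ 2 *
          (2 * (C ^ 2 * (1 + K') + (1 + K * (K' + 1)))))) := by
          have k1 := integral_norm_sq_le_one_add (h.memLp t i)
          have k2 := integral_norm_sq_le_one_add (h.noise_memLp t i)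
          have k3 := h.noise_fourth t i
          have k4 : K * (∫ ω, ‖z t i ω‖ ^ 4 ∂P + 1) ≤ K * (K' + 1) := by gcongr
          have hinv : 0 < ρ⁻¹ := by positivity
          gcongr <;> linarith
      _ = _ := by rw [hK₃]; ring
  have hev := eventually_le_of_linear_recursion
    (u := fun i => ∫ ω, ‖S (Q (z t i ω))‖ ^ 2 ∂P) (a := ρ ^ 2) (by positivity)
    (pow_le_one₀ hρ.le hρ1) hstep (c := (K₃ / ρ ^ 2 + 1) * t ^ 2) (by
      have : K₃ * t ^ 2 / ρ ^ 2 = K₃ / ρ ^ 2 * t ^ 2 := by ring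
      rw [this]; nlinarith [pow_pos ht0 2])
  filter_upwards [hev] with i hi
  calc ∫ ω, ‖Q (z t i ω)‖ ^ 2 ∂P ≤ ∫ ω, δ⁻¹ * ‖S (Q (z t i ω))‖ ^ 2 ∂P := by
        refine integral_mono ((h.memLp t i).clm_comp Q).integrable_norm_sq_of_four
          ((hmem i).integrable_norm_sq_of_four.const_mul _) fun ω => ?_
        simp only
        rw [le_inv_mul_iff₀ hδ]
        exact hS _
    _ = δ⁻¹ * ∫ ω, ‖S (Q (z t i ω))‖ ^ 2 ∂P := integral_const_mul _ _
    _ ≤ δ⁻¹ * ((K₃ / ρ ^ 2 + 1) * t ^ 2) := by gcongr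
    _ = _ := by ring

end Recursion

/-! ### The noise covariance along the iterates. -/

/-- Once `x ^ γ` exceeds `ε`, the fourth power dominates because `γ ≤ 4`. This lets the fourth
moment control the covariance perturbation for every admissible exponent. -/
theorem Real.exists_rpow_le_add_mul_pow_four {γ ε : ℝ} (hγ : 0 < γ) (hγ4 : γ ≤ 4) (hε : 0 < ε) :
    ∃ C, 0 ≤ C ∧ ∀ x : ℝ, 0 ≤ x → x ^ γ ≤ ε + C * x ^ 4 := by
  refine ⟨ε ^ (1 - 4 / γ), Real.rpow_nonneg hε.le _, fun x hx => ?_⟩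
  rcases le_or_gt (x ^ γ) ε with h | h
  · have := Real.rpow_nonneg hε.le (1 - 4 / γ)
    have : 0 ≤ ε ^ (1 - 4 / γ) * x ^ 4 := by positivity
    linarith
  · have hu : 0 < x ^ γ := hε.trans h
    have h4 : x ^ 4 = (x ^ γ) ^ (4 / γ) := by
      rw [← Real.rpow_mul hx, mul_div_cancel₀ _ hγ.ne']
      norm_cast
    have h1 : (x ^ γ) ^ (1 - 4 / γ) ≤ ε ^ (1 - 4 / γ) :=
      Real.rpow_le_rpow_of_nonpos hε h.le (by
        rw [sub_nonpos, le_div_iff₀ hγ]; linarith)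
    calc x ^ γ = (x ^ γ) ^ (1 - 4 / γ) * (x ^ γ) ^ (4 / γ) := by
          rw [← Real.rpow_add hu]; simp
      _ ≤ ε ^ (1 - 4 / γ) * x ^ 4 := by rw [← h4]; gcongr
      _ ≤ _ := by linarith

section Noise

variable {N M : ℕ} {Ω : Type*} [mΩ : MeasurableSpace Ω] {P : Measure Ω}

theorem MeasureTheory.MemLp.netVec_entry {f : Ω → NetVec N M} {q : ℝ≥0∞} (hf : MemLp f q P)
    (x : Fin N × Fin M) : MemLp (fun ω => f ω x.1 x.2) q P := by
  have hc : Continuous fun v : NetVec N M => v x.1 x.2 :=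
    (PiLp.continuous_apply 2 _ x.2).comp (PiLp.continuous_apply 2 _ x.1)
  refine hf.of_le (hc.comp_aestronglyMeasurable hf.1) (ae_of_all _ fun ω => ?_)
  exact (PiLp.norm_apply_le (f ω x.1) x.2).trans (PiLp.norm_apply_le (f ω) x.1)

theorem abs_netVec_entry_mul_le (v : NetVec N M) (x y : Fin N × Fin M) :
    |v x.1 x.2 * v y.1 y.2| ≤ 1 + ‖v‖ ^ 4 := by
  have h : ∀ x : Fin N × Fin M, |v x.1 x.2| ≤ ‖v‖ := fun x =>
    (PiLp.norm_apply_le (v x.1) x.2).trans (PiLp.norm_apply_le v x.1)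
  rw [abs_mul]
  calc |v x.1 x.2| * |v y.1 y.2| ≤ ‖v‖ * ‖v‖ := by gcongr <;> apply h
    _ ≤ _ := by nlinarith [sq_nonneg (‖v‖ ^ 2 - 1), sq_nonneg (‖v‖ ^ 2)]

variable {ℱ : Filtration ℕ mΩ}
  {J : Fin N → EuclideanSpace ℝ (Fin M) → ℝ} {wo : NetVec N M}
  {gradHat : ℕ → Fin N → Ω → EuclideanSpace ℝ (Fin M) → EuclideanSpace ℝ (Fin M)}
  {Rs : NetMat N M}

theorem integrable_noiseCov (i : ℕ) (W : Ω → NetVec N M) (x y : Fin N × Fin M) :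
    Integrable (fun ω => noiseCov P ℱ J gradHat i W ω x y) P :=
  integrable_condExp

theorem integrable_dotProduct_noiseCov (i : ℕ) (W : Ω → NetVec N M) (c : Fin N × Fin M → ℝ) :
    Integrable (fun ω => c ⬝ᵥ (noiseCov P ℱ J gradHat i W ω).mulVec c) P := by
  refine integrable_finsetSum _ fun x _ => Integrable.const_mul ?_ _
  exact integrable_finsetSum _ fun y _ => Integrable.mul_const (integrable_noiseCov i W x y) _

variable [IsProbabilityMeasure P]

theorem integrable_netVec_entry_mul {f : Ω → NetVec N M} (hf : MemLp f 4 P)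
    (x y : Fin N × Fin M) : Integrable (fun ω => f ω x.1 x.2 * f ω y.1 y.2) P :=
  have h24 : (2 : ℝ≥0∞) ≤ 4 := by norm_num
  ((hf.netVec_entry x).mono_exponent h24).integrable_mul ((hf.netVec_entry y).mono_exponent h24)

/-- Expansion of the square and the tower property, entry by entry. -/
theorem integral_dotProduct_noiseCov {i : ℕ} {W : Ω → NetVec N M}
    (hs : MemLp (fun ω => gradNoise J gradHat i ω (W ω)) 4 P) (c : Fin N × Fin M → ℝ) :
    ∫ ω, (∑ x, c x * gradNoise J gradHat i ω (W ω) x.1 x.2) ^ 2 ∂P =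
      ∫ ω, c ⬝ᵥ (noiseCov P ℱ J gradHat i W ω).mulVec c ∂P := by
  have hint : ∀ x y : Fin N × Fin M, Integrable (fun ω =>
      gradNoise J gradHat i ω (W ω) x.1 x.2 * gradNoise J gradHat i ω (W ω) y.1 y.2) P :=
    fun x y => integrable_netVec_entry_mul hs x y
  have hcov : ∀ x y : Fin N × Fin M, ∫ ω, noiseCov P ℱ J gradHat i W ω x y ∂P = ∫ ω,
      gradNoise J gradHat i ω (W ω) x.1 x.2 * gradNoise J gradHat i ω (W ω) y.1 y.2 ∂P :=
    fun x y => integral_condExp (ℱ.le i)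
  have hL : ∀ ω, (∑ x, c x * gradNoise J gradHat i ω (W ω) x.1 x.2) ^ 2 =
      ∑ x, c x * ∑ y, (gradNoise J gradHat i ω (W ω) x.1 x.2 *
        gradNoise J gradHat i ω (W ω) y.1 y.2) * c y := by
    intro ω
    rw [sq, Finset.sum_mul_sum]
    simp_rw [Finset.mul_sum]
    exact Finset.sum_congr rfl fun x _ => Finset.sum_congr rfl fun y _ => by ring
  simp_rw [hL, dotProduct, Matrix.mulVec, dotProduct]
  rw [integral_finsetSum _ fun x _ => (integrable_finsetSum _ fun y _ =>
      (hint x y).mul_const _).const_mul _,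
    integral_finsetSum _ fun x _ => (integrable_finsetSum _ fun y _ =>
      (integrable_noiseCov i W x y).mul_const _).const_mul _]
  refine Finset.sum_congr rfl fun x _ => ?_
  rw [integral_const_mul, integral_const_mul,
    integral_finsetSum _ fun y _ => (hint x y).mul_const _,
    integral_finsetSum _ fun y _ => (integrable_noiseCov i W x y).mul_const _]
  congr 1
  refine Finset.sum_congr rfl fun y _ => ?_
  rw [integral_mul_const, integral_mul_const, hcov]

theorem NoiseAssumption.tendsto_integral_noiseCov (h : NoiseAssumption P ℱ J wo gradHat Rs)
    (x y : Fin N × Fin M) :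
    Tendsto (fun i => ∫ ω, noiseCov P ℱ J gradHat i (fun _ => wo) ω x y ∂P) atTop
      (𝓝 (Rs x y)) := by
  obtain ⟨α, σ, -, -, hσ⟩ := h.fourth_moment
  have hconst : ∀ i, StronglyMeasurable[ℱ i] fun _ : Ω => wo := fun i => stronglyMeasurable_const
  have hmem : MemLp (fun _ : Ω => wo) 4 P := memLp_const wo
  have hlim : Tendsto (fun i => ∫ ω, noiseCov P ℱ J gradHat i (fun _ => wo) ω x y ∂P) atTop
      (𝓝 (∫ _, Rs x y ∂P)) := by
    -- At `wo` the state-dependent part of the fourth moment bound vanishes, so `|s_x s_y| ≤ 1 +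
    -- ‖s‖⁴` yields a constant dominating function.
    refine tendsto_integral_of_dominated_convergence (fun _ => 1 + σ ^ 4)
      (fun i => (integrable_noiseCov i _ x y).1) (integrable_const _) (fun i => ?_) ?_
    · have hs := (h.measurable i _ (hconst i) hmem).2
      have i1 : Integrable (fun ω => gradNoise J gradHat i ω wo x.1 x.2 *
          gradNoise J gradHat i ω wo y.1 y.2) P :=
        integrable_netVec_entry_mul hs x y
      have i4 : Integrable (fun ω => ‖gradNoise J gradHat i ω wo‖ ^ 4) P :=
        hs.integrable_norm_pow_four
      have i2 : Integrable ((fun _ => (1 : ℝ)) + fun ω => ‖gradNoise J gradHat i ω wo‖ ^ 4) P :=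
        (integrable_const _).add i4
      have m1 := condExp_mono (m := ℱ i) i1 i2
        (ae_of_all _ fun ω => (le_abs_self _).trans (abs_netVec_entry_mul_le _ x y))
      have m2 := condExp_mono (m := ℱ i) i1.neg i2
        (ae_of_all _ fun ω => (neg_le_abs _).trans (abs_netVec_entry_mul_le _ x y))
      have m3 := condExp_neg (fun ω => gradNoise J gradHat i ω wo x.1 x.2 *
          gradNoise J gradHat i ω wo y.1 y.2) (ℱ i) (μ := P)
      have m4 := condExp_add (integrable_const (1 : ℝ)) i4 (ℱ i)
      rw [condExp_const (ℱ.le i)] at m4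
      filter_upwards [m1, m2, m3, m4, hσ i _ (hconst i) hmem] with ω h1 h2 h3 h4 h5
      rw [h4] at h1 h2
      rw [h3] at h2
      simp only [sub_self, norm_zero, Pi.add_apply, Pi.neg_apply] at h1 h2 h5
      rw [Real.norm_eq_abs, abs_le]
      simp only [noiseCov, Matrix.of_apply]
      constructor <;> linarith
    · filter_upwards [h.covariance_limit] with ω hω
      exact ((continuous_apply y).comp (continuous_apply x)).continuousAt.tendsto.comp hω
  simpa using hlim

/-- Moving the covariance from the iterate to `wo` costs at most `ε / 2` for small `t`; the limit of
the covariance at `wo` takes the other half. -/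
theorem NoiseAssumption.eventually_abs_integral_sq_sub_le
    (h : NoiseAssumption P ℱ J wo gradHat Rs) {W : ℝ → ℕ → Ω → NetVec N M}
    (hW : ∀ t i, StronglyMeasurable[ℱ i] (W t i)) (hW4 : ∀ t i, MemLp (W t i) 4 P) {K : ℝ}
    (hfour : ∀ᶠ t in 𝓝[>] (0 : ℝ), ∀ᶠ i in atTop, ∫ ω, ‖wo - W t i ω‖ ^ 4 ∂P ≤ K * t ^ 2)
    (c : Fin N × Fin M → ℝ) {ε : ℝ} (hε : 0 < ε) :
    ∀ᶠ t in 𝓝[>] (0 : ℝ), ∀ᶠ i in atTop,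
      |∫ ω, (∑ x, c x * gradNoise J gradHat i ω (W t i ω) x.1 x.2) ^ 2 ∂P -
        c ⬝ᵥ Rs.mulVec c| ≤ ε := by
  obtain ⟨κ, γ, hκ, hγ, hγ4, hlip⟩ := h.covariance_lipschitz
  set c' : EuclideanSpace ℝ (Fin N × Fin M) := WithLp.toLp 2 c with hc'
  set B := κ * (‖c'‖ * ‖c'‖) with hB
  have hB0 : 0 ≤ B := by positivity
  obtain ⟨C, hC0, hC⟩ := Real.exists_rpow_le_add_mul_pow_four hγ hγ4
    (show 0 < ε / (4 * (B + 1)) by positivity)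
  have hlim : Tendsto (fun i => ∫ ω, c ⬝ᵥ (noiseCov P ℱ J gradHat i (fun _ => wo) ω).mulVec c ∂P)
      atTop (𝓝 (c ⬝ᵥ Rs.mulVec c)) := by
    have he : ∀ i, ∫ ω, c ⬝ᵥ (noiseCov P ℱ J gradHat i (fun _ => wo) ω).mulVec c ∂P =
        ∑ x, c x * ∑ y, (∫ ω, noiseCov P ℱ J gradHat i (fun _ => wo) ω x y ∂P) * c y := by
      intro i
      simp_rw [dotProduct, Matrix.mulVec, dotProduct]
      rw [integral_finsetSum _ fun x _ => (integrable_finsetSum _ fun y _ =>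
        (integrable_noiseCov i _ x y).mul_const _).const_mul _]
      refine Finset.sum_congr rfl fun x _ => ?_
      rw [integral_const_mul,
        integral_finsetSum _ fun y _ => (integrable_noiseCov i _ x y).mul_const _]
      simp_rw [integral_mul_const]
    simp_rw [he]
    exact tendsto_finsetSum _ fun x _ => (tendsto_finsetSum _ fun y _ =>
      (h.tendsto_integral_noiseCov x y).mul_const _).const_mul _
  have hlim' : ∀ᶠ i in atTop,
      |∫ ω, c ⬝ᵥ (noiseCov P ℱ J gradHat i (fun _ => wo) ω).mulVec c ∂P -
        c ⬝ᵥ Rs.mulVec c| < ε / 2 :=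
    (Metric.tendsto_nhds.1 hlim) (ε / 2) (by positivity)
  have e1 : ∀ᶠ t in 𝓝[>] (0 : ℝ), t < 1 := nhdsWithin_le_nhds (gt_mem_nhds one_pos)
  have e2 : ∀ᶠ t in 𝓝[>] (0 : ℝ), t < ε / (4 * (B * C * |K| + 1)) :=
    nhdsWithin_le_nhds (gt_mem_nhds (by positivity))
  filter_upwards [hfour, e1, e2, self_mem_nhdsWithin] with t ht ht1 ht2 ht0
  have ht0 : 0 < t := ht0
  rw [lt_div_iff₀ (by positivity)] at ht2
  filter_upwards [ht, hlim'] with i hi hi'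
  have hz : MemLp (fun ω => wo - W t i ω) 4 P := (memLp_const wo).sub (hW4 t i)
  have hs := (h.measurable i _ (hW t i) (hW4 t i)).2
  rw [integral_dotProduct_noiseCov (ℱ := ℱ) hs]
  have hd : |∫ ω, c ⬝ᵥ (noiseCov P ℱ J gradHat i (W t i) ω).mulVec c ∂P -
      ∫ ω, c ⬝ᵥ (noiseCov P ℱ J gradHat i (fun _ => wo) ω).mulVec c ∂P| ≤
      B * (ε / (4 * (B + 1)) + C * ∫ ω, ‖wo - W t i ω‖ ^ 4 ∂P) := by
    rw [← integral_sub (integrable_dotProduct_noiseCov i _ c)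
      (integrable_dotProduct_noiseCov i _ c)]
    have hbd : Integrable (fun ω => B * (ε / (4 * (B + 1)) + C * ‖wo - W t i ω‖ ^ 4)) P :=
      ((integrable_const _).add (hz.integrable_norm_pow_four.const_mul C)).const_mul B
    refine (norm_integral_le_of_norm_le (G := ℝ) hbd ?_).trans_eq ?_
    · filter_upwards [hlip i _ (hW t i) (hW4 t i)] with ω hω
      rw [← dotProduct_sub, ← Matrix.sub_mulVec, Real.norm_eq_abs]
      refine (abs_dotProduct_mulVec_le _ c' c').trans ?_
      rw [norm_sub_rev]
      calc _ ≤ (κ * ‖wo - W t i ω‖ ^ γ) * (‖c'‖ * ‖c'‖) := by gcongr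
        _ = B * ‖wo - W t i ω‖ ^ γ := by rw [hB]; ring
        _ ≤ _ := by gcongr; exact hC _ (norm_nonneg _)
    · rw [integral_const_mul, integral_add (integrable_const _)
        (hz.integrable_norm_pow_four.const_mul C), integral_const_mul]
      simp
  have h1 : B * (ε / (4 * (B + 1))) ≤ ε / 4 := by
    rw [mul_div_assoc', div_le_div_iff₀ (by positivity) (by positivity)]
    nlinarith
  have h2 : B * (C * ∫ ω, ‖wo - W t i ω‖ ^ 4 ∂P) ≤ ε / 4 := by
    calc B * (C * ∫ ω, ‖wo - W t i ω‖ ^ 4 ∂P) ≤ B * (C * (|K| * (t * 1))) := by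
          gcongr
          refine hi.trans ?_
          calc K * t ^ 2 ≤ |K| * t ^ 2 := by gcongr; exact le_abs_self K
            _ ≤ |K| * (t * 1) := by gcongr; nlinarith
      _ ≤ ε / 4 := by nlinarith
  rw [mul_add] at hd
  rw [abs_le] at hd ⊢
  rw [abs_lt] at hi'
  constructor <;> linarith [hd.1, hd.2, hi'.1, hi'.2]

end Noise

/-! ### Steady state at leading order. -/

/-- The free parameter `η` balances the cross term in `y r`: the variable `y²` has size `t` and `r²`
has size `t²`, so a small fixed `η` makes the error a small multiple of `t²`. -/
theorem abs_affine_sq_sub_le {t lam η : ℝ} (ht : 0 < t) (hlam : 0 < lam) (hη : 0 < η)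
    (h : t * (2 * lam) ≤ 1) (y r : ℝ) :
    |((1 - t * lam) * y + t * r) ^ 2 - (1 - 2 * t * lam) * y ^ 2| ≤
      (t ^ 2 * lam ^ 2 + t * η) * y ^ 2 + (t / η + t ^ 2) * r ^ 2 := by
  have e : ((1 - t * lam) * y + t * r) ^ 2 - (1 - 2 * t * lam) * y ^ 2 =
      t ^ 2 * lam ^ 2 * y ^ 2 + (1 - t * lam) * (2 * t * (y * r)) + t ^ 2 * r ^ 2 := by ring
  have h2 : |2 * t * (y * r)| ≤ t * η * y ^ 2 + t / η * r ^ 2 := by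
    have p1 : 0 ≤ t * η⁻¹ * (η * y - r) ^ 2 := by positivity
    have p2 : 0 ≤ t * η⁻¹ * (η * y + r) ^ 2 := by positivity
    have q1 : t * η⁻¹ * (η * y - r) ^ 2 = t * η * y ^ 2 + t / η * r ^ 2 - 2 * t * (y * r) := by
      field_simp; ring
    have q2 : t * η⁻¹ * (η * y + r) ^ 2 = t * η * y ^ 2 + t / η * r ^ 2 + 2 * t * (y * r) := by
      field_simp; ring
    rw [abs_le]; constructor <;> linarith
  have h3 : |(1 - t * lam) * (2 * t * (y * r))| ≤ 1 * |2 * t * (y * r)| := by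
    rw [abs_mul]
    gcongr
    rw [abs_le]
    constructor <;> linarith [mul_pos ht hlam]
  rw [e]
  refine (abs_add_three _ _ _).trans ?_
  rw [abs_of_nonneg (by positivity : 0 ≤ t ^ 2 * lam ^ 2 * y ^ 2),
    abs_of_nonneg (by positivity : 0 ≤ t ^ 2 * r ^ 2)]
  linarith

section SteadyState

variable {Ω : Type*} [mΩ : MeasurableSpace Ω] {P : Measure Ω} [IsProbabilityMeasure P]
  {ℱ : Filtration ℕ mΩ} {V : Type*} [NormedAddCommGroup V] [InnerProductSpace ℝ V]
  {L D : V →L[ℝ] V} {g : V → V} {K : ℝ} {z s : ℝ → ℕ → Ω → V}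

-- Since `ℓ` is invariant under `L`, it follows a scalar recursion with rate `t lam`, remainder `r`
-- and noise. The distance of its second moment from `t v / (2 lam)` contracts by `1 - 2 t lam`,
-- with an error of at most `lam ε t²` per step.
set_option maxHeartbeats 800000 in
theorem IsNoisyRecursion.eventually_abs_integral_functional_sq_sub_le [CompleteSpace V]
    (h : IsNoisyRecursion P ℱ L D g K z s) (hg : Continuous g) {C : ℝ}
    (hC : ∀ x, ‖g x‖ ≤ C * ‖x‖) {Q : V →L[ℝ] V} {ℓ : V →L[ℝ] ℝ} (hL : ∀ x, ℓ (L x) = ℓ x)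
    {lam : ℝ} (hlam : 0 < lam) {C' : ℝ}
    (hdrift : ∀ x, |ℓ (D (g x)) + lam * ℓ x| ≤ C' * (‖Q x‖ + ‖x‖ ^ 2)) {K' : ℝ} (hK' : 0 ≤ K')
    (hfour : ∀ᶠ t in 𝓝[>] (0 : ℝ), ∀ᶠ i in atTop, ∫ ω, ‖z t i ω‖ ^ 4 ∂P ≤ K' * t ^ 2)
    {K'' : ℝ} (hK'' : 0 ≤ K'')
    (hdev : ∀ᶠ t in 𝓝[>] (0 : ℝ), ∀ᶠ i in atTop, ∫ ω, ‖Q (z t i ω)‖ ^ 2 ∂P ≤ K'' * t ^ 2)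
    {v : ℝ} (hnoise : ∀ ε > 0, ∀ᶠ t in 𝓝[>] (0 : ℝ), ∀ᶠ i in atTop,
      |∫ ω, ℓ (D (s t i ω)) ^ 2 ∂P - v| ≤ ε) {ε : ℝ} (hε : 0 < ε) :
    ∀ᶠ t in 𝓝[>] (0 : ℝ), ∀ᶠ i in atTop,
      |∫ ω, ℓ (z t i ω) ^ 2 ∂P - t * (v / (2 * lam))| ≤ ε * t := by
  set Ky := ‖ℓ‖ ^ 2 * (1 + K') with hKy
  set Kr := 2 * C' ^ 2 * (K'' + K') with hKr
  have hKy0 : 0 ≤ Ky := by positivity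
  have hKr0 : 0 ≤ Kr := by positivity
  -- Chosen so that `η Ky ≤ lam ε / 4`, where `Ky t` bounds the second moment of `ℓ z`.
  set η := lam * ε / (4 * (Ky + 1)) with hη
  have hη0 : 0 < η := by positivity
  have e1 : ∀ᶠ t in 𝓝[>] (0 : ℝ), t < 1 := nhdsWithin_le_nhds (gt_mem_nhds one_pos)
  have e2 : ∀ᶠ t in 𝓝[>] (0 : ℝ), t < 1 / (2 * lam) :=
    nhdsWithin_le_nhds (gt_mem_nhds (by positivity))
  have e3 : ∀ᶠ t in 𝓝[>] (0 : ℝ), t < lam * ε / (4 * (lam ^ 2 * Ky + Kr / η + Kr + 1)) :=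
    nhdsWithin_le_nhds (gt_mem_nhds (by positivity))
  filter_upwards [hfour, hdev, hnoise (lam * ε / 4) (by positivity), e1, e2, e3,
    self_mem_nhdsWithin] with t htf htd htn ht1 ht2 ht3 ht0
  have ht0 : 0 < t := ht0
  rw [lt_div_iff₀ (by positivity)] at ht2 ht3
  have hmem : ∀ i, MemLp (fun ω => ℓ (z t i ω)) 4 P := fun i => (h.memLp t i).clm_comp ℓ
  have isq : ∀ {f : Ω → ℝ}, MemLp f 4 P → Integrable (fun ω => f ω ^ 2) P := fun hf => by
    simpa using hf.integrable_norm_sq_of_four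
  have hstep : ∀ᶠ i in atTop, |∫ ω, ℓ (z t (i + 1) ω) ^ 2 ∂P - t * (v / (2 * lam))| ≤
      (1 - 2 * t * lam) * |∫ ω, ℓ (z t i ω) ^ 2 ∂P - t * (v / (2 * lam))| +
        t ^ 2 * (lam * ε) := by
    filter_upwards [htf, htd, htn] with i hf hd hn
    have hgm : MemLp (fun ω => g (z t i ω)) 4 P := (h.memLp t i).of_le_mul
      (hg.comp_aestronglyMeasurable (h.memLp t i).1) (ae_of_all _ fun ω => hC _)
    set r : Ω → ℝ := fun ω => ℓ (D (g (z t i ω))) + lam * ℓ (z t i ω) with hr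
    have hr4 : MemLp r 4 P := ((hgm.clm_comp D).clm_comp ℓ).add ((hmem i).const_mul lam)
    set a : Ω → ℝ := fun ω => (1 - t * lam) * ℓ (z t i ω) + t * r ω with ha
    have ha4 : MemLp a 4 P := ((hmem i).const_mul _).add (hr4.const_mul t)
    have hsm : StronglyMeasurable[ℱ i] a :=
      Continuous.comp_stronglyMeasurable
        (g := fun x => (1 - t * lam) * ℓ x + t * (ℓ (D (g x)) + lam * ℓ x))
        (by fun_prop) (h.stronglyMeasurable t i)
    have hb4 : MemLp (fun ω => t • (ℓ.comp D) (s t i ω)) 4 P :=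
      ((h.noise_memLp t i).clm_comp _).const_smul t
    have hb0 := condExp_clm_smul_eq_zero (m := ℱ i) (ℓ.comp D) t
      (h.noise_memLp t i).integrable_of_four (h.noise_condExp t i)
    have key := integral_norm_add_sq_of_condExp_eq_zero (ℱ.le i) hsm ha4 hb4 hb0
    simp only [Real.norm_eq_abs, sq_abs, ContinuousLinearMap.comp_apply, smul_eq_mul, mul_pow,
      integral_const_mul] at key
    have hz : ∀ ω, ℓ (z t (i + 1) ω) = a ω + t * ℓ (D (s t i ω)) := fun ω => by
      rw [h.step, map_add ℓ, map_smul ℓ, hL, hL, map_add ℓ, map_smul ℓ, ha, hr]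
      simp only [smul_eq_mul]
      ring
    simp_rw [hz]
    rw [key]
    set q := ∫ ω, ℓ (z t i ω) ^ 2 ∂P with hq
    have iy := isq (hmem i)
    have ir := isq hr4
    have hqle : q ≤ Ky * t := by
      have h1 : q ≤ ∫ ω, ‖ℓ‖ ^ 2 * ‖z t i ω‖ ^ 2 ∂P := by
        refine integral_mono iy ((h.memLp t i).integrable_norm_sq_of_four.const_mul _)
          fun ω => ?_
        simp only
        rw [← mul_pow, ← sq_abs]
        gcongr
        exact ℓ.le_opNorm _
      rw [integral_const_mul] at h1
      have h2 := integral_norm_sq_le_of_four (h.memLp t i) ht0 hf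
      calc q ≤ ‖ℓ‖ ^ 2 * ((1 + K') * t) := h1.trans (by gcongr)
        _ = _ := by rw [hKy]; ring
    have hrle : ∫ ω, r ω ^ 2 ∂P ≤ Kr * t ^ 2 := by
      have iQ := ((h.memLp t i).clm_comp Q).integrable_norm_sq_of_four
      have i4 := (h.memLp t i).integrable_norm_pow_four
      have h1 : ∫ ω, r ω ^ 2 ∂P ≤ ∫ ω, 2 * C' ^ 2 * (‖Q (z t i ω)‖ ^ 2 + ‖z t i ω‖ ^ 4) ∂P := by
        refine integral_mono ir ((iQ.add i4).const_mul _) fun ω => ?_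
        have h2 : r ω ^ 2 ≤ (C' * (‖Q (z t i ω)‖ + ‖z t i ω‖ ^ 2)) ^ 2 := by
          rw [← sq_abs]
          exact pow_le_pow_left₀ (abs_nonneg _) (hdrift _) 2
        refine h2.trans ?_
        nlinarith [mul_nonneg (sq_nonneg C') (sq_nonneg (‖Q (z t i ω)‖ - ‖z t i ω‖ ^ 2))]
      rw [integral_const_mul, integral_add iQ i4] at h1
      calc _ ≤ 2 * C' ^ 2 * (K'' * t ^ 2 + K' * t ^ 2) := h1.trans (by gcongr)
        _ = _ := by rw [hKr]; ring
    have hbd : |∫ ω, a ω ^ 2 ∂P - (1 - 2 * t * lam) * q| ≤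
        (t ^ 2 * lam ^ 2 + t * η) * q + (t / η + t ^ 2) * ∫ ω, r ω ^ 2 ∂P := by
      rw [hq, ← integral_const_mul, ← integral_sub (isq ha4) (iy.const_mul _),
        ← integral_const_mul, ← integral_const_mul,
        ← integral_add (iy.const_mul _) (ir.const_mul _)]
      refine norm_integral_le_of_norm_le (G := ℝ) ((iy.const_mul _).add (ir.const_mul _))
        (ae_of_all _ fun ω => ?_)
      exact abs_affine_sq_sub_le ht0 hlam hη0 ht2.le _ _
    have hsum : (t ^ 2 * lam ^ 2 + t * η) * q + (t / η + t ^ 2) * ∫ ω, r ω ^ 2 ∂P ≤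
        t ^ 2 * (3 * (lam * ε) / 4) := by
      have hηK : η * Ky ≤ lam * ε / 4 := by
        rw [hη, div_mul_eq_mul_div, div_le_div_iff₀ (by positivity) (by positivity)]
        nlinarith [mul_pos hlam hε]
      calc _ ≤ (t ^ 2 * lam ^ 2 + t * η) * (Ky * t) + (t / η + t ^ 2) * (Kr * t ^ 2) := by gcongr
        _ = t ^ 2 * (t * (lam ^ 2 * Ky + Kr / η + t * Kr) + η * Ky) := by field_simp; ring
        _ ≤ t ^ 2 * (t * (lam ^ 2 * Ky + Kr / η + 1 * Kr) + η * Ky) := by gcongr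
        _ ≤ _ := by
            gcongr
            nlinarith [mul_pos hlam hε]
    have hn2 : |t ^ 2 * ∫ ω, ℓ (D (s t i ω)) ^ 2 ∂P - t ^ 2 * v| ≤ t ^ 2 * (lam * ε / 4) := by
      rw [← mul_sub, abs_mul, abs_of_pos (pow_pos ht0 2)]
      gcongr
    -- The claimed value is the exact fixed point of the recursion without errors.
    have hfix : t * (v / (2 * lam)) = (1 - 2 * t * lam) * (t * (v / (2 * lam))) + t ^ 2 * v := by
      field_simp; ring
    have e : ∫ ω, a ω ^ 2 ∂P + t ^ 2 * ∫ ω, ℓ (D (s t i ω)) ^ 2 ∂P - t * (v / (2 * lam)) =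
        (1 - 2 * t * lam) * (q - t * (v / (2 * lam))) +
        (∫ ω, a ω ^ 2 ∂P - (1 - 2 * t * lam) * q) +
        (t ^ 2 * ∫ ω, ℓ (D (s t i ω)) ^ 2 ∂P - t ^ 2 * v) := by
      linear_combination -hfix
    rw [e]
    refine (abs_add_three _ _ _).trans ?_
    rw [abs_mul, abs_of_nonneg (by linarith : 0 ≤ 1 - 2 * t * lam)]
    linarith
  -- Dividing the error `lam ε t²` by the rate `2 t lam` gives `ε t / 2`, strictly below the target.
  refine eventually_le_of_linear_recursion
    (u := fun i => |∫ ω, ℓ (z t i ω) ^ 2 ∂P - t * (v / (2 * lam))|)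
    (a := 2 * t * lam) (by positivity) (by linarith) hstep ?_
  have : t ^ 2 * (lam * ε) / (2 * t * lam) = ε * t / 2 := by field_simp
  rw [this]
  linarith [mul_pos hε ht0]

/-- Here `Q` takes group means and `T` deviations. As `T z` has mean square of order `t²` and `Q z`
of order `t`, Young's inequality makes the cross term negligible against `t`. -/
theorem IsNoisyRecursion.eventually_abs_integral_norm_sq_sub_le
    (h : IsNoisyRecursion P ℱ L D g K z s) {Q T : V →L[ℝ] V}
    (hT : ∀ x, T x = x - Q x) {K' : ℝ} (hK' : 0 ≤ K')
    (hfour : ∀ᶠ t in 𝓝[>] (0 : ℝ), ∀ᶠ i in atTop, ∫ ω, ‖z t i ω‖ ^ 4 ∂P ≤ K' * t ^ 2)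
    {K'' : ℝ} (hK'' : 0 ≤ K'') (hdev : ∀ᶠ t in 𝓝[>] (0 : ℝ), ∀ᶠ i in atTop,
      ∫ ω, ‖T (z t i ω)‖ ^ 2 ∂P ≤ K'' * t ^ 2)
    {c : ℝ} (hc : ∀ ε > 0, ∀ᶠ t in 𝓝[>] (0 : ℝ), ∀ᶠ i in atTop,
      |∫ ω, ‖Q (z t i ω)‖ ^ 2 ∂P - t * c| ≤ ε * t) {ε : ℝ} (hε : 0 < ε) :
    ∀ᶠ t in 𝓝[>] (0 : ℝ), ∀ᶠ i in atTop,
      |∫ ω, ‖z t i ω‖ ^ 2 ∂P - t * c| ≤ ε * t := by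
  simp_rw [hT] at hdev
  set Kq := ‖Q‖ ^ 2 * (1 + K') with hKq
  have hKq0 : 0 ≤ Kq := by positivity
  set η := ε / (3 * (Kq + 1)) with hη
  have hη0 : 0 < η := by positivity
  have e1 : ∀ᶠ t in 𝓝[>] (0 : ℝ), t < ε / (3 * ((1 / η + 1) * K'' + 1)) :=
    nhdsWithin_le_nhds (gt_mem_nhds (by positivity))
  filter_upwards [hfour, hdev, hc (ε / 3) (by positivity), e1, self_mem_nhdsWithin]
    with t htf htd htc ht1 ht0
  have ht0 : 0 < t := ht0
  rw [lt_div_iff₀ (by positivity)] at ht1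
  filter_upwards [htf, htd, htc] with i hf hd hci
  have hQ4 := (h.memLp t i).clm_comp Q
  have iz := (h.memLp t i).integrable_norm_sq_of_four
  have iQ := hQ4.integrable_norm_sq_of_four
  have id : Integrable (fun ω => ‖z t i ω - Q (z t i ω)‖ ^ 2) P :=
    ((h.memLp t i).sub hQ4).integrable_norm_sq_of_four
  have hq : ∫ ω, ‖Q (z t i ω)‖ ^ 2 ∂P ≤ Kq * t := by
    have h1 : ∫ ω, ‖Q (z t i ω)‖ ^ 2 ∂P ≤ ∫ ω, ‖Q‖ ^ 2 * ‖z t i ω‖ ^ 2 ∂P := by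
      refine integral_mono iQ (iz.const_mul _) fun ω => ?_
      simp only
      rw [← mul_pow]
      gcongr
      exact Q.le_opNorm _
    rw [integral_const_mul] at h1
    have h2 := integral_norm_sq_le_of_four (h.memLp t i) ht0 hf
    calc _ ≤ ‖Q‖ ^ 2 * ((1 + K') * t) := h1.trans (by gcongr)
      _ = _ := by rw [hKq]; ring
  have hbd : |∫ ω, ‖z t i ω‖ ^ 2 ∂P - ∫ ω, ‖Q (z t i ω)‖ ^ 2 ∂P| ≤
      η * ∫ ω, ‖Q (z t i ω)‖ ^ 2 ∂P + (1 / η + 1) * ∫ ω, ‖z t i ω - Q (z t i ω)‖ ^ 2 ∂P := by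
    rw [← integral_sub iz iQ, ← integral_const_mul, ← integral_const_mul,
      ← integral_add (iQ.const_mul _) (id.const_mul _)]
    refine norm_integral_le_of_norm_le (G := ℝ) ((iQ.const_mul _).add (id.const_mul _))
      (ae_of_all _ fun ω => ?_)
    set a := Q (z t i ω)
    set b := z t i ω - a with hb
    have hz : z t i ω = a + b := by rw [hb]; abel
    have e := norm_add_sq_real a b
    have h2 : |2 * inner ℝ a b| ≤ η * ‖a‖ ^ 2 + 1 / η * ‖b‖ ^ 2 := by
      rw [abs_mul, abs_two]
      have h3 := abs_real_inner_le_norm a b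
      have p1 : 0 ≤ η⁻¹ * (η * ‖a‖ - ‖b‖) ^ 2 := by positivity
      have q1 : η⁻¹ * (η * ‖a‖ - ‖b‖) ^ 2 =
          η * ‖a‖ ^ 2 + 1 / η * ‖b‖ ^ 2 - 2 * (‖a‖ * ‖b‖) := by field_simp; ring
      linarith
    have e' : ‖z t i ω‖ ^ 2 - ‖a‖ ^ 2 = 2 * inner ℝ a b + ‖b‖ ^ 2 := by rw [hz, e]; ring
    rw [e', Real.norm_eq_abs]
    refine (abs_add_le _ _).trans ?_
    rw [abs_of_nonneg (sq_nonneg ‖b‖)]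
    linarith
  have h1 : η * ∫ ω, ‖Q (z t i ω)‖ ^ 2 ∂P ≤ ε / 3 * t := by
    have hηK : η * Kq ≤ ε / 3 := by
      rw [hη, div_mul_eq_mul_div, div_le_div_iff₀ (by positivity) (by positivity)]
      nlinarith
    calc _ ≤ η * (Kq * t) := by gcongr
      _ = η * Kq * t := by ring
      _ ≤ _ := by gcongr
  have h2 : (1 / η + 1) * ∫ ω, ‖z t i ω - Q (z t i ω)‖ ^ 2 ∂P ≤ ε / 3 * t := by
    calc _ ≤ (1 / η + 1) * (K'' * t ^ 2) := by gcongr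
      _ = (t * ((1 / η + 1) * K'')) * t := by ring
      _ ≤ _ := by gcongr; linarith
  rw [abs_le] at hbd hci ⊢
  constructor <;> linarith [hbd.1, hbd.2, hci.1, hci.2]

end SteadyState

/-! ### The diffusion error as a noisy recursion. -/

section RecursionStep

variable {Ω V : Type*} [NormedAddCommGroup V] [NormedSpace ℝ V] (L D : V →L[ℝ] V) (t : ℝ)

theorem stronglyMeasurable_recursion_step {m m' : MeasurableSpace Ω} (hm : m ≤ m') {g : V → V}
    (hg : Continuous g) {z s : Ω → V} (hz : StronglyMeasurable[m] z)
    (hs : StronglyMeasurable[m'] s) :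
    StronglyMeasurable[m'] fun ω => L (z ω + t • D (g (z ω))) + t • L (D (s ω)) := by
  have h1 : Continuous fun x => L (x + t • D (g x)) := by fun_prop
  have h2 : Continuous fun x => t • L (D x) := by fun_prop
  exact ((h1.comp_stronglyMeasurable hz).mono hm).add (h2.comp_stronglyMeasurable hs)

theorem memLp_recursion_step [MeasurableSpace Ω] {P : Measure Ω} {q : ℝ≥0∞} {z y s : Ω → V}
    (hz : MemLp z q P) (hy : MemLp y q P) (hs : MemLp s q P) :
    MemLp (fun ω => L (z ω + t • D (y ω)) + t • L (D (s ω))) q P :=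
  ((hz.add ((hy.clm_comp D).const_smul t)).clm_comp L).add
    (((hs.clm_comp D).clm_comp L).const_smul t)

end RecursionStep

section Diffusion

variable {N M G : ℕ} {Ω : Type*} {nbr : Fin N → Finset (Fin N)} {group : Fin N → Fin G}
  {J : Fin N → EuclideanSpace ℝ (Fin M) → ℝ} {wo : NetVec N M} {A : Matrix (Fin N) (Fin N) ℝ}
  {gradHat : ℕ → Fin N → Ω → EuclideanSpace ℝ (Fin M) → EuclideanSpace ℝ (Fin M)}
  {Rs : NetMat N M} {μ : Fin N → ℝ}

/-- The network error before iteration `i`. -/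
noncomputable def networkError (nbr : Fin N → Finset (Fin N)) (group : Fin N → Fin G)
    (A : Matrix (Fin N) (Fin N) ℝ)
    (gradHat : ℕ → Fin N → Ω → EuclideanSpace ℝ (Fin M) → EuclideanSpace ℝ (Fin M))
    (wo : NetVec N M) (μ : Fin N → ℝ) (i : ℕ) (ω : Ω) : NetVec N M :=
  wo - diffusion nbr group A gradHat μ i ω

theorem sum_nbr_inter_groupAgents (hA : IsCombination nbr group A) {E : Type*} [AddCommGroup E]
    [Module ℝ E] (k : Fin N) (y : Fin N → E) :
    ∑ l ∈ nbr k ∩ groupAgents group (group k), A l k • y l = ∑ l, A l k • y l := by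
  refine Finset.sum_subset (Finset.subset_univ _) fun l _ hl => ?_
  rw [hA.zero l k fun h => hl (by simp [groupAgents, h.1, h.2]), zero_smul]

theorem sum_combination_smul_minimizer (hgroup : IsGrouping nbr group wo)
    (hA : IsCombination nbr group A) (k : Fin N) : ∑ l, A l k • wo l = wo k := by
  calc ∑ l, A l k • wo l = ∑ l, A l k • wo k := by
        refine Finset.sum_congr rfl fun l _ => ?_
        by_cases h : group l = group k
        · rw [hgroup.same_cluster l k h]
        · rw [hA.eq_zero h, zero_smul, zero_smul]
    _ = wo k := by rw [← Finset.sum_smul, hA.col_sum, one_smul]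

/-- Combination preserves `wo`, and the stochastic gradient splits into the true gradient at `wo -
z` and the noise. -/
theorem networkError_succ (hgroup : IsGrouping nbr group wo) (hA : IsCombination nbr group A)
    (t : ℝ) (i : ℕ) (ω : Ω) :
    networkError nbr group A gradHat wo (t • μ) (i + 1) ω =
      blockMap A.transpose (networkError nbr group A gradHat wo (t • μ) i ω +
        t • blockMap (Matrix.diagonal μ)
          (gradError J wo (networkError nbr group A gradHat wo (t • μ) i ω))) +
      t • blockMap A.transpose (blockMap (Matrix.diagonal μ)
        (gradNoise J gradHat i ω (diffusion nbr group A gradHat (t • μ) i ω))) := by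
  rw [← map_smul (blockMap A.transpose), ← map_add (blockMap A.transpose)]
  refine PiLp.ext fun k => ?_
  rw [blockMap_apply]
  set W := diffusion nbr group A gradHat (t • μ) i ω with hW
  have h1 : networkError nbr group A gradHat wo (t • μ) (i + 1) ω k =
      wo k - ∑ l, A l k • (W l - (t * μ l) • gradHat i l ω (W l)) := by
    rw [← sum_nbr_inter_groupAgents hA]; rfl
  have h2 : ∀ l, (networkError nbr group A gradHat wo (t • μ) i ω +
      t • blockMap (Matrix.diagonal μ)
        (gradError J wo (networkError nbr group A gradHat wo (t • μ) i ω)) +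
      t • blockMap (Matrix.diagonal μ) (gradNoise J gradHat i ω W)) l =
      wo l - (W l - (t * μ l) • gradHat i l ω (W l)) := by
    intro l
    have h3 : gradError J wo (networkError nbr group A gradHat wo (t • μ) i ω) l =
        gradient (J l) (W l) := by
      change gradient (J l) (wo l - (wo l - W l)) = _
      rw [sub_sub_cancel]
    rw [PiLp.add_apply, PiLp.add_apply, PiLp.smul_apply, PiLp.smul_apply, blockMap_diagonal,
      blockMap_diagonal, h3]
    change wo l - W l + _ + t • μ l • (gradHat i l ω (W l) - gradient (J l) (W l)) = _
    rw [smul_smul, smul_smul, smul_sub]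
    abel
  simp_rw [h1, h2, Matrix.transpose_apply]
  nth_rewrite 1 [← sum_combination_smul_minimizer hgroup hA k]
  rw [← Finset.sum_sub_distrib]
  simp_rw [← smul_sub]

variable [mΩ : MeasurableSpace Ω] {P : Measure Ω} [IsProbabilityMeasure P] {ℱ : Filtration ℕ mΩ}

/-- Both claims need a joint induction: the noise assumptions at iteration `i` apply only to an `ℱ
i`-measurable point with finite fourth moment, and they return noise measurable for `ℱ (i + 1)`. -/
theorem diffusion_stronglyMeasurable_memLp (hgroup : IsGrouping nbr group wo)
    (hA : IsCombination nbr group A) (hcost : CostAssumption group J wo)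
    (hnoise : NoiseAssumption P ℱ J wo gradHat Rs) (t : ℝ) (i : ℕ) :
    StronglyMeasurable[ℱ i] (diffusion nbr group A gradHat (t • μ) i) ∧
      MemLp (diffusion nbr group A gradHat (t • μ) i) 4 P := by
  obtain ⟨lam, C, κ, -, -, -, -, -, hC, -⟩ := hcost.exists_bounds
  have hg := hcost.continuous_gradError
  induction i with
  | zero => exact ⟨stronglyMeasurable_const, memLp_const 0⟩
  | succ i ih =>
    obtain ⟨hs, hs4⟩ := hnoise.measurable i _ ih.1 ih.2
    have hz : StronglyMeasurable[ℱ i] (networkError nbr group A gradHat wo (t • μ) i) :=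
      stronglyMeasurable_const.sub ih.1
    have hz4 : MemLp (networkError nbr group A gradHat wo (t • μ) i) 4 P :=
      (memLp_const wo).sub ih.2
    have hgm : MemLp (fun ω => gradError J wo (networkError nbr group A gradHat wo (t • μ) i ω))
        4 P := hz4.of_le_mul (hg.comp_aestronglyMeasurable hz4.1) (ae_of_all _ fun ω => hC _)
    have he : diffusion nbr group A gradHat (t • μ) (i + 1) = fun ω =>
        wo - (blockMap A.transpose (networkError nbr group A gradHat wo (t • μ) i ω +
        t • blockMap (Matrix.diagonal μ)
          (gradError J wo (networkError nbr group A gradHat wo (t • μ) i ω))) +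
      t • blockMap A.transpose (blockMap (Matrix.diagonal μ)
        (gradNoise J gradHat i ω (diffusion nbr group A gradHat (t • μ) i ω)))) := by
      funext ω
      rw [← networkError_succ hgroup hA, networkError, sub_sub_cancel]
    rw [he]
    exact ⟨stronglyMeasurable_const.sub
      (stronglyMeasurable_recursion_step _ _ t (ℱ.mono (Nat.le_succ i)) hg hz hs),
      (memLp_const wo).sub (memLp_recursion_step _ _ t hz4 hgm hs4)⟩

theorem exists_isNoisyRecursion_networkError (hgroup : IsGrouping nbr group wo)
    (hA : IsCombination nbr group A) (hcost : CostAssumption group J wo)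
    (hnoise : NoiseAssumption P ℱ J wo gradHat Rs) : ∃ K, 0 ≤ K ∧
    IsNoisyRecursion P ℱ (blockMap A.transpose) (blockMap (Matrix.diagonal μ)) (gradError J wo) K
      (fun t i ω => networkError nbr group A gradHat wo (t • μ) i ω)
      (fun t i ω => gradNoise J gradHat i ω (diffusion nbr group A gradHat (t • μ) i ω)) := by
  obtain ⟨α, σ, -, -, h4⟩ := hnoise.fourth_moment
  have hW := diffusion_stronglyMeasurable_memLp (μ := μ) hgroup hA hcost hnoise
  have hz4 : ∀ t i, MemLp (networkError nbr group A gradHat wo (t • μ) i) 4 P :=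
    fun t i => (memLp_const wo).sub (hW t i).2
  refine ⟨α ^ 2 + σ ^ 4, by positivity, fun t i ω => networkError_succ hgroup hA t i ω,
    fun t i => stronglyMeasurable_const.sub (hW t i).1, hz4,
    fun t i => (hnoise.measurable i _ (hW t i).1 (hW t i).2).2,
    fun t i => hnoise.martingale_difference i _ (hW t i).1 (hW t i).2, fun t i => ?_⟩
  have iz := (hz4 t i).integrable_norm_pow_four
  have ib : Integrable (fun ω => α ^ 2 * ‖networkError nbr group A gradHat wo (t • μ) i ω‖ ^ 4
      + σ ^ 4) P := (iz.const_mul _).add (integrable_const _)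
  rw [← integral_condExp (ℱ.le i)]
  refine (integral_mono_ae integrable_condExp ib (h4 i _ (hW t i).1 (hW t i).2)).trans ?_
  rw [integral_add (iz.const_mul _) (integrable_const _), integral_const_mul]
  simp only [integral_const, probReal_univ, one_smul]
  have : 0 ≤ ∫ ω, ‖networkError nbr group A gradHat wo (t • μ) i ω‖ ^ 4 ∂P :=
    integral_nonneg fun ω => by positivity
  have hσ : 0 ≤ σ ^ 4 := by positivity
  have hα : 0 ≤ α ^ 2 := by positivity
  nlinarith

end Diffusion

/-! ### Scalar projections of the group means. -/

section GroupFunctional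

variable {N G : ℕ} {E : Type*} [NormedAddCommGroup E] [InnerProductSpace ℝ E]
  {group : Fin N → Fin G} {p : Fin N → ℝ}

/-- The component along `u` of the `p`-weighted mean over group `m`. -/
noncomputable def groupFunctional (group : Fin N → Fin G) (p : Fin N → ℝ) (m : Fin G) (u : E) :
    BlockVec N E →L[ℝ] ℝ where
  toFun z := ∑ k ∈ groupAgents group m, p k * inner ℝ u (z k)
  map_add' x y := by simp [inner_add_right, mul_add, Finset.sum_add_distrib]
  map_smul' c x := by simp [real_inner_smul_right, Finset.mul_sum, mul_left_comm]
  cont := by fun_prop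

theorem groupFunctional_apply (m : Fin G) (u : E) (z : BlockVec N E) :
    groupFunctional group p m u z = ∑ k ∈ groupAgents group m, p k * inner ℝ u (z k) := rfl

theorem groupFunctional_eq_inner {m : Fin G} {k : Fin N} (hk : group k = m) (u : E)
    (z : BlockVec N E) :
    groupFunctional group p m u z = inner ℝ u (blockMap (groupMean group p) z k) := by
  rw [groupFunctional_apply, blockMap_apply, inner_sum, groupAgents, Finset.sum_filter]
  refine Finset.sum_congr rfl fun l _ => ?_
  rw [groupMean_apply, real_inner_smul_right, hk, ite_mul, zero_mul]

theorem IsPerronVector.exists_mem_group {A : Matrix (Fin N) (Fin N) ℝ}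
    (hp : IsPerronVector group A p) (m : Fin G) : ∃ k, group k = m := by
  by_contra! h
  have h1 := hp.sum_one m
  rw [groupAgents, Finset.filter_false_of_mem fun k _ => h k] at h1
  simp at h1

theorem groupFunctional_combine {nbr : Fin N → Finset (Fin N)} {A : Matrix (Fin N) (Fin N) ℝ}
    (hA : IsCombination nbr group A) (hp : IsPerronVector group A p) (m : Fin G) (u : E)
    (z : BlockVec N E) :
    groupFunctional group p m u (blockMap A.transpose z) = groupFunctional group p m u z := by
  obtain ⟨k, hk⟩ := hp.exists_mem_group m
  rw [groupFunctional_eq_inner hk, groupFunctional_eq_inner hk, ← blockMap_mul,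
    groupMean_mul_transpose hA hp]

/-- All agents of a group carry the same mean, whence the cardinality; Parseval is applied in a
basis that may differ from group to group. -/
theorem norm_groupMean_sq {ι : Type*} [Fintype ι] (b : Fin G → OrthonormalBasis ι ℝ E)
    (z : BlockVec N E) : ‖blockMap (groupMean group p) z‖ ^ 2 =
      ∑ x : Fin G × ι, ((groupAgents group x.1).card : ℝ) *
        groupFunctional group p x.1 (b x.1 x.2) z ^ 2 := by
  rw [blockVec_norm_sq, Fintype.sum_prod_type,
    ← Finset.sum_fiberwise Finset.univ group fun k => ‖blockMap (groupMean group p) z k‖ ^ 2]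
  refine Finset.sum_congr rfl fun m _ => ?_
  simp only
  rw [← Finset.mul_sum, ← nsmul_eq_mul, ← Finset.sum_const]
  refine Finset.sum_congr rfl fun k hk => ?_
  have hk' : group k = m := (Finset.mem_filter.1 hk).2
  rw [← (b m).sum_sq_norm_inner_right]
  refine Finset.sum_congr rfl fun a _ => ?_
  rw [groupFunctional_eq_inner hk', Real.norm_eq_abs, sq_abs]

/-- Linearizing `g` costs `‖z‖²`, and replacing each block by its group mean costs the deviation. On
a common mean the weighted Hessians add up, and symmetry moves them onto the eigenvector `u`. -/
theorem abs_groupFunctional_drift_le {A : Matrix (Fin N) (Fin N) ℝ} (hp : IsPerronVector group A p) (hpos : ∀ k, 0 < p k)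
    {μ : Fin N → ℝ} (hμ : ∀ k, 0 < μ k) (H : Fin N → E →L[ℝ] E)
    (hH : ∀ k x y, inner ℝ x (H k y) = inner ℝ (H k x) y) {g : BlockVec N E → BlockVec N E}
    {κ : ℝ} (hκ : 0 ≤ κ) (hg : ∀ z k, ‖g z k + H k (z k)‖ ≤ κ * ‖z k‖ ^ 2) (m : Fin G) {u : E}
    {lam : ℝ} (hu : ∑ k ∈ groupAgents group m, (p k * μ k) • H k u = lam • u) :
    ∃ C, ∀ z, |groupFunctional group p m u (blockMap (Matrix.diagonal μ) (g z)) +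
      lam * groupFunctional group p m u z| ≤
        C * (‖groupDeviation group p z‖ + ‖z‖ ^ 2) := by
  obtain ⟨k₀, hk₀⟩ := hp.exists_mem_group m
  refine ⟨∑ k ∈ groupAgents group m, p k * μ k * (‖u‖ * (κ + ‖H k‖)), fun z => ?_⟩
  rw [groupDeviation_apply]
  set Q : BlockVec N E →L[ℝ] BlockVec N E := blockMap (groupMean group p)
  have e1 : lam * groupFunctional group p m u z =
      ∑ k ∈ groupAgents group m, p k * μ k * inner ℝ u (H k (Q z k)) := by
    rw [groupFunctional_eq_inner hk₀, ← real_inner_smul_left, ← hu, sum_inner]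
    refine Finset.sum_congr rfl fun k hk => ?_
    have hk' : group k₀ = group k := by rw [hk₀, (Finset.mem_filter.1 hk).2]
    rw [real_inner_smul_left, hH, blockMap_groupMean_congr hk']
  rw [e1, groupFunctional_apply, ← Finset.sum_add_distrib, Finset.sum_mul]
  refine (Finset.abs_sum_le_sum_abs _ _).trans (Finset.sum_le_sum fun k _ => ?_)
  have e2 : p k * inner ℝ u (blockMap (Matrix.diagonal μ) (g z) k) +
      p k * μ k * inner ℝ u (H k (Q z k)) =
      p k * μ k * inner ℝ u (g z k + H k (z k) - H k ((z - Q z) k)) := by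
    rw [blockMap_diagonal, real_inner_smul_right, PiLp.sub_apply, map_sub, inner_sub_right,
      inner_sub_right, inner_add_right]
    ring
  have hpm : 0 < p k * μ k := mul_pos (hpos k) (hμ k)
  rw [e2, abs_mul, abs_of_pos hpm, mul_assoc (p k * μ k)]
  gcongr
  refine (abs_real_inner_le_norm _ _).trans ?_
  rw [mul_assoc]
  gcongr
  refine (norm_sub_le _ _).trans ?_
  have n1 : ‖z k‖ ≤ ‖z‖ := PiLp.norm_apply_le z k
  have n2 : ‖(z - Q z) k‖ ≤ ‖z - Q z‖ := PiLp.norm_apply_le _ k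
  have n3 : ‖H k ((z - Q z) k)‖ ≤ ‖H k‖ * ‖z - Q z‖ :=
    ((H k).le_opNorm _).trans (by gcongr)
  have n4 : κ * ‖z k‖ ^ 2 ≤ κ * ‖z‖ ^ 2 := by gcongr
  have n5 := hg z k
  have n6 : 0 ≤ κ * ‖z - Q z‖ := by positivity
  have n7 : 0 ≤ ‖H k‖ * ‖z‖ ^ 2 := by positivity
  linarith

end GroupFunctional

/-- The trace is evaluated in the eigenbasis, where the inverse acts by reciprocal eigenvalues. -/
theorem Matrix.IsHermitian.trace_inv_mul_eq_sum {n : Type*} [Fintype n] [DecidableEq n]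
    {H : Matrix n n ℝ} (hH : H.IsHermitian) (hpos : ∀ a, 0 < hH.eigenvalues a)
    (R : Matrix n n ℝ) : Matrix.trace (H⁻¹ * R) = ∑ a, (hH.eigenvalues a)⁻¹ *
      ((hH.eigenvectorBasis a).ofLp ⬝ᵥ R.mulVec (hH.eigenvectorBasis a).ofLp) := by
  have hdet : IsUnit H.det := by
    rw [hH.det_eq_prod_eigenvalues]
    exact (Finset.prod_ne_zero_iff.2 fun a _ => by simpa using (hpos a).ne').isUnit
  have hinv : ∀ a, H⁻¹.mulVec (hH.eigenvectorBasis a).ofLp =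
      (hH.eigenvalues a)⁻¹ • (hH.eigenvectorBasis a).ofLp := fun a => by
    have h1 := congrArg (fun v => (hH.eigenvalues a)⁻¹ • H⁻¹.mulVec v)
      (hH.mulVec_eigenvectorBasis a)
    simp only [Matrix.mulVec_mulVec, Matrix.nonsing_inv_mul H hdet, Matrix.one_mulVec,
      Matrix.mulVec_smul, smul_smul, inv_mul_cancel₀ (hpos a).ne', one_smul] at h1
    exact h1.symm
  have htr : ∀ B : Matrix n n ℝ, B.trace = ∑ a, (hH.eigenvectorBasis a).ofLp ⬝ᵥ
      B.mulVec (hH.eigenvectorBasis a).ofLp := fun B => by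
    have h1 := LinearMap.trace_eq_sum_inner
      (Matrix.toEuclideanCLM (𝕜 := ℝ) B : EuclideanSpace ℝ n →ₗ[ℝ] EuclideanSpace ℝ n)
      hH.eigenvectorBasis
    have h2 : LinearMap.trace ℝ _
        (Matrix.toEuclideanCLM (𝕜 := ℝ) B : EuclideanSpace ℝ n →ₗ[ℝ] EuclideanSpace ℝ n) =
        B.trace := by
      rw [Matrix.coe_toEuclideanCLM_eq_toEuclideanLin,
        Matrix.toEuclideanLin_eq_toLin_orthonormal, Matrix.trace_toLin_eq]
    rw [← h2, h1]
    exact Finset.sum_congr rfl fun a _ => Matrix.inner_toEuclideanCLM B _ _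
  rw [Matrix.trace_mul_comm, htr]
  refine Finset.sum_congr rfl fun a _ => ?_
  rw [← Matrix.mulVec_mulVec, hinv, Matrix.mulVec_smul, dotProduct_smul, smul_eq_mul]

/-! ### Passage to the iterated limit. -/

section Limit

theorem eventually_abs_integral_weighted_sum_sub_le {Ω ι : Type*} [MeasurableSpace Ω]
    {P : Measure Ω} [Fintype ι] {f : ι → ℝ → ℕ → Ω → ℝ} (hf : ∀ j t i, Integrable (f j t i) P)
    {w c : ι → ℝ} (hw : ∀ j, 0 ≤ w j)
    (h : ∀ j, ∀ ε > 0, ∀ᶠ t in 𝓝[>] (0 : ℝ), ∀ᶠ i in atTop,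
      |∫ ω, f j t i ω ∂P - t * c j| ≤ ε * t) {ε : ℝ} (hε : 0 < ε) :
    ∀ᶠ t in 𝓝[>] (0 : ℝ), ∀ᶠ i in atTop,
      |∫ ω, ∑ j, w j * f j t i ω ∂P - t * ∑ j, w j * c j| ≤ ε * t := by
  have hW : 0 ≤ ∑ j, w j := Finset.sum_nonneg fun j _ => hw j
  have h1 := eventually_all.2 fun j => h j (ε / (∑ j, w j + 1)) (by positivity)
  filter_upwards [h1, self_mem_nhdsWithin] with t ht ht0
  have ht0 : 0 < t := ht0
  filter_upwards [eventually_all.2 ht] with i hi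
  have e : ∫ ω, ∑ j, w j * f j t i ω ∂P - t * ∑ j, w j * c j =
      ∑ j, w j * (∫ ω, f j t i ω ∂P - t * c j) := by
    rw [integral_finsetSum _ fun j _ => (hf j t i).const_mul _, Finset.mul_sum,
      ← Finset.sum_sub_distrib]
    refine Finset.sum_congr rfl fun j _ => ?_
    rw [integral_const_mul]; ring
  rw [e]
  calc _ ≤ ∑ j, |w j * (∫ ω, f j t i ω ∂P - t * c j)| := Finset.abs_sum_le_sum_abs _ _
    _ ≤ ∑ j, w j * (ε / (∑ j, w j + 1) * t) := by
        refine Finset.sum_le_sum fun j _ => ?_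
        rw [abs_mul, abs_of_nonneg (hw j)]
        exact mul_le_mul_of_nonneg_left (hi j) (hw j)
    _ = (∑ j, w j) / (∑ j, w j + 1) * (ε * t) := by rw [← Finset.sum_mul]; ring
    _ ≤ 1 * (ε * t) := by
        gcongr
        rw [div_le_one (by positivity)]
        linarith
    _ = ε * t := one_mul _

/-- For fixed `t` an eventual two-sided bound in `i` traps the upper limit. The inner sequence need
not converge. -/
theorem tendsto_limsup_ofReal {f : ℝ → ℕ → ℝ} {c : ℝ}
    (h : ∀ ε > 0, ∀ᶠ t in 𝓝[>] (0 : ℝ), ∀ᶠ i in atTop, |f t i - c| ≤ ε) :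
    Tendsto (fun t => limsup (fun i => ENNReal.ofReal (f t i)) atTop) (𝓝[>] 0)
      (𝓝 (ENNReal.ofReal c)) := by
  have hcont : ∀ s : ℝ, Tendsto (fun δ : ℝ => ENNReal.ofReal (c + s * δ)) (𝓝[>] 0)
      (𝓝 (ENNReal.ofReal c)) := fun s => by
    have : Continuous fun δ : ℝ => ENNReal.ofReal (c + s * δ) :=
      ENNReal.continuous_ofReal.comp (by fun_prop)
    have h0 := this.tendsto 0
    simp only [mul_zero, add_zero] at h0
    exact h0.mono_left nhdsWithin_le_nhds
  refine tendsto_order.2 ⟨fun b hb => ?_, fun b hb => ?_⟩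
  · obtain ⟨δ, hδb, hδ⟩ := (((hcont (-1)).eventually (lt_mem_nhds hb)).and
      self_mem_nhdsWithin).exists
    filter_upwards [h δ hδ] with t ht
    refine hδb.trans_le (le_limsup_of_frequently_le' (Eventually.frequently ?_))
    filter_upwards [ht] with i hi
    exact ENNReal.ofReal_le_ofReal (by linarith [(abs_le.1 hi).1])
  · obtain ⟨δ, hδb, hδ⟩ := (((hcont 1).eventually (gt_mem_nhds hb)).and
      self_mem_nhdsWithin).exists
    filter_upwards [h δ hδ] with t ht
    refine lt_of_le_of_lt (limsup_le_of_le (by isBoundedDefault) ?_) hδb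
    filter_upwards [ht] with i hi
    exact ENNReal.ofReal_le_ofReal (by linarith [(abs_le.1 hi).2])

end Limit

/-! ### Assembly over groups and eigenvectors. -/

section Main

variable {N M G : ℕ} {group : Fin N → Fin G} {J : Fin N → EuclideanSpace ℝ (Fin M) → ℝ}
  {wo : NetVec N M} {p μ : Fin N → ℝ}

/-- The weighted Hessian `∑_{k ∈ G_m} p_k μ_k H_k` of group `m`. -/
noncomputable def groupHessian (group : Fin N → Fin G) (J : Fin N → EuclideanSpace ℝ (Fin M) → ℝ)
    (wo : NetVec N M) (p μ : Fin N → ℝ) (m : Fin G) : Matrix (Fin M) (Fin M) ℝ :=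
  ∑ k ∈ groupAgents group m, (p k * μ k) • hessianMatrix (J k) (wo k)

/-- The weighted noise covariance `∑_{k, l ∈ G_m} p_k p_l μ_k μ_l R_{kl}` of group `m`. -/
noncomputable def groupCov (group : Fin N → Fin G) (Rs : NetMat N M) (p μ : Fin N → ℝ)
    (m : Fin G) : Matrix (Fin M) (Fin M) ℝ :=
  ∑ k ∈ groupAgents group m, ∑ l ∈ groupAgents group m,
    (p k * p l * (μ k * μ l)) • Rs.block k l

theorem groupHessian_isHermitian (h : ∀ k, (hessianMatrix (J k) (wo k)).IsHermitian) (m : Fin G) :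
    (groupHessian group J wo p μ m).IsHermitian := by
  rw [Matrix.IsHermitian, groupHessian, Matrix.conjTranspose_sum]
  refine Finset.sum_congr rfl fun k _ => ?_
  rw [Matrix.conjTranspose_smul, star_trivial, h k]

theorem toEuclideanCLM_groupHessian (m : Fin G) (v : EuclideanSpace ℝ (Fin M)) :
    Matrix.toEuclideanCLM (𝕜 := ℝ) (groupHessian group J wo p μ m) v =
      ∑ k ∈ groupAgents group m,
        (p k * μ k) • Matrix.toEuclideanCLM (𝕜 := ℝ) (hessianMatrix (J k) (wo k)) v := by
  rw [groupHessian, map_sum, sum_apply]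
  refine Finset.sum_congr rfl fun k _ => ?_
  rw [map_smul]; rfl

theorem Matrix.IsHermitian.toEuclideanCLM_eigenvectorBasis {n : Type*} [Fintype n] [DecidableEq n]
    {H : Matrix n n ℝ} (hH : H.IsHermitian) (a : n) :
    Matrix.toEuclideanCLM (𝕜 := ℝ) H (hH.eigenvectorBasis a) =
      hH.eigenvalues a • hH.eigenvectorBasis a := by
  refine PiLp.ext fun b => ?_
  rw [Matrix.ofLp_toEuclideanCLM, hH.mulVec_eigenvectorBasis]; rfl

/-- Each eigenvalue is its Rayleigh quotient, a sum of nonnegative terms of which the strongly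
convex agent's is positive. -/
theorem groupHessian_eigenvalues_pos (hpos : ∀ k, 0 < p k) (hμ : ∀ k, 0 < μ k)
    {lam : Fin N → ℝ} (hlam : ∀ k, 0 ≤ lam k)
    (hlow : ∀ k (v : EuclideanSpace ℝ (Fin M)), lam k * ‖v‖ ^ 2 ≤
      v.ofLp ⬝ᵥ (hessianMatrix (J k) (wo k)).mulVec v.ofLp) {m : Fin G}
    (hm : ∃ k ∈ groupAgents group m, 0 < lam k)
    (hH : (groupHessian group J wo p μ m).IsHermitian) (a : Fin M) : 0 < hH.eigenvalues a := by
  have h1 : hH.eigenvalues a = ∑ k ∈ groupAgents group m, p k * μ k *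
      ((hH.eigenvectorBasis a).ofLp ⬝ᵥ
        (hessianMatrix (J k) (wo k)).mulVec (hH.eigenvectorBasis a).ofLp) := by
    have h2 := congrArg (fun v => inner ℝ (hH.eigenvectorBasis a) v)
      (hH.toEuclideanCLM_eigenvectorBasis a)
    simp only [real_inner_smul_right, toEuclideanCLM_groupHessian, inner_sum,
      Matrix.inner_toEuclideanCLM, real_inner_self_eq_norm_sq,
      hH.eigenvectorBasis.norm_eq_one] at h2
    linarith
  rw [h1]
  have hle : ∀ k, p k * μ k * lam k ≤ p k * μ k * ((hH.eigenvectorBasis a).ofLp ⬝ᵥ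
      (hessianMatrix (J k) (wo k)).mulVec (hH.eigenvectorBasis a).ofLp) := fun k => by
    have h3 := hlow k (hH.eigenvectorBasis a)
    rw [hH.eigenvectorBasis.norm_eq_one, one_pow, mul_one] at h3
    exact mul_le_mul_of_nonneg_left h3 (mul_pos (hpos k) (hμ k)).le
  obtain ⟨k, hk, hlk⟩ := hm
  refine lt_of_lt_of_le (mul_pos (mul_pos (hpos k) (hμ k)) hlk) ((hle k).trans ?_)
  exact Finset.single_le_sum (f := fun k => p k * μ k * ((hH.eigenvectorBasis a).ofLp ⬝ᵥ
      (hessianMatrix (J k) (wo k)).mulVec (hH.eigenvectorBasis a).ofLp))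
    (fun j _ => le_trans (mul_nonneg (mul_pos (hpos j) (hμ j)).le (hlam j)) (hle j)) hk

/-- The coefficients of `s ↦ ⟨u, ∑_{k ∈ G_m} p_k μ_k s_k⟩`. -/
noncomputable def groupCoeff (group : Fin N → Fin G) (p μ : Fin N → ℝ) (m : Fin G)
    (u : EuclideanSpace ℝ (Fin M)) (x : Fin N × Fin M) : ℝ :=
  if group x.1 = m then p x.1 * μ x.1 * u x.2 else 0

theorem groupFunctional_diagonal_eq_sum (m : Fin G) (u : EuclideanSpace ℝ (Fin M))
    (s : NetVec N M) :
    groupFunctional group p m u (blockMap (Matrix.diagonal μ) s) =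
      ∑ x, groupCoeff group p μ m u x * s x.1 x.2 := by
  rw [groupFunctional_apply, groupAgents, Finset.sum_filter, Fintype.sum_prod_type]
  refine Finset.sum_congr rfl fun k _ => ?_
  simp only [groupCoeff]
  split_ifs with h
  · rw [blockMap_diagonal, real_inner_smul_right, PiLp.inner_apply, Finset.mul_sum,
      Finset.mul_sum]
    refine Finset.sum_congr rfl fun a _ => ?_
    simp only [RCLike.inner_apply, conj_trivial]
    ring
  · simp

theorem groupCoeff_dotProduct (Rs : NetMat N M) (m : Fin G) (u : EuclideanSpace ℝ (Fin M)) :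
    groupCoeff group p μ m u ⬝ᵥ Rs.mulVec (groupCoeff group p μ m u) =
      u.ofLp ⬝ᵥ (groupCov group Rs p μ m).mulVec u.ofLp := by
  have h1 : u.ofLp ⬝ᵥ (groupCov group Rs p μ m).mulVec u.ofLp =
      ∑ k ∈ groupAgents group m, ∑ l ∈ groupAgents group m, (p k * p l * (μ k * μ l)) *
        (u.ofLp ⬝ᵥ (Rs.block k l).mulVec u.ofLp) := by
    simp_rw [groupCov, Matrix.sum_mulVec, dotProduct_sum, Matrix.smul_mulVec, dotProduct_smul,
      smul_eq_mul]
  have h2 : ∀ k l, ∑ a, groupCoeff group p μ m u (k, a) *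
      ∑ b, Rs (k, a) (l, b) * groupCoeff group p μ m u (l, b) =
      if group k = m then if group l = m then (p k * p l * (μ k * μ l)) *
        (u.ofLp ⬝ᵥ (Rs.block k l).mulVec u.ofLp) else 0 else 0 := by
    intro k l
    by_cases hk : group k = m
    · by_cases hl : group l = m
      · simp only [groupCoeff, hk, hl, if_true, dotProduct, Matrix.mulVec, Finset.mul_sum]
        refine Finset.sum_congr rfl fun a _ => Finset.sum_congr rfl fun b _ => ?_
        simp only [NetMat.block, Matrix.of_apply]
        ring
      · simp [groupCoeff, hl]
    · simp [groupCoeff, hk]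
  have h3 : groupCoeff group p μ m u ⬝ᵥ Rs.mulVec (groupCoeff group p μ m u) =
      ∑ k, ∑ l, ∑ a, groupCoeff group p μ m u (k, a) *
        ∑ b, Rs (k, a) (l, b) * groupCoeff group p μ m u (l, b) := by
    simp only [dotProduct, Matrix.mulVec, Fintype.sum_prod_type, Finset.mul_sum]
    exact Finset.sum_congr rfl fun k _ => Finset.sum_comm
  rw [h1, h3, groupAgents, Finset.sum_filter]
  refine Finset.sum_congr rfl fun k _ => ?_
  simp_rw [h2]
  split_ifs with hk
  · rw [Finset.sum_filter]
  · simp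

theorem stepMax_smul {t : ℝ} (ht : 0 < t) : stepMax (t • μ) = t * stepMax μ := by
  simp only [stepMax, Pi.smul_apply, smul_eq_mul]
  exact (Real.mul_iSup_of_nonneg ht.le _).symm

theorem groupMSDSumCross_eq_groupMSDSum (Rs : NetMat N M)
    (h : ∀ k l, k ≠ l → group k = group l → Rs.block k l = 0) :
    groupMSDSumCross group J wo Rs p μ = groupMSDSum group J wo Rs p μ := by
  refine Finset.sum_congr rfl fun m _ => ?_
  congr 3
  refine Finset.sum_congr rfl fun k hk => ?_
  rw [Finset.sum_eq_single k]
  · rw [sq, sq]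
  · intro l hl hlk
    rw [h k l hlk.symm (by rw [(Finset.mem_filter.1 hk).2, (Finset.mem_filter.1 hl).2]), smul_zero]
  · exact fun h => absurd hk h

variable {Ω : Type*} [mΩ : MeasurableSpace Ω] {P : Measure Ω} [IsProbabilityMeasure P]
  {ℱ : Filtration ℕ mΩ} {nbr : Fin N → Finset (Fin N)} {A : Matrix (Fin N) (Fin N) ℝ}
  {gradHat : ℕ → Fin N → Ω → EuclideanSpace ℝ (Fin M) → EuclideanSpace ℝ (Fin M)}
  {Rs : NetMat N M}

theorem eventually_abs_integral_networkError_sq_sub_le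
    (hgroup : IsGrouping nbr group wo) (hcost : CostAssumption group J wo)
    (hA : IsCombination nbr group A) (hp : IsPerronVector group A p)
    (hnoise : NoiseAssumption P ℱ J wo gradHat Rs) (hμ : ∀ k, 0 < μ k) {ε : ℝ} (hε : 0 < ε) :
    ∀ᶠ t in 𝓝[>] (0 : ℝ), ∀ᶠ i in atTop,
      |∫ ω, ‖networkError nbr group A gradHat wo (t • μ) i ω‖ ^ 2 ∂P -
        t * ∑ m, ((groupAgents group m).card : ℝ) / 2 *
          Matrix.trace ((groupHessian group J wo p μ m)⁻¹ * groupCov group Rs p μ m)| ≤ ε * t := by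
  obtain ⟨lam, C, κ, hlam, hlam', -, hκ, hmono, hC, hquad, hherm, hlow⟩ := hcost.exists_bounds
  have hpos := hp.pos hgroup hA
  have hg := hcost.continuous_gradError
  obtain ⟨K, hK, hrec⟩ := exists_isNoisyRecursion_networkError (μ := μ) hgroup hA hcost hnoise
  obtain ⟨δ, hδ, hS⟩ := exists_norm_sq_le_norm_sqrtScale_sq
    (E := EuclideanSpace ℝ (Fin M)) hpos
  obtain ⟨c, hc, hcontr⟩ := exists_drift_contraction hgroup hA hp hμ hlam hlam' hC hmono
  obtain ⟨K', hK', hfour⟩ := hrec.exists_fourth_moment_le hK hg hC hδ hS hc hcontr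
  obtain ⟨ρ, hρ, hρ1, hdevc⟩ := exists_deviation_contraction
    (E := EuclideanSpace ℝ (Fin M)) hgroup hA hp
  obtain ⟨K'', hK'', hdev⟩ := hrec.exists_deviation_le hK hg hC hδ hS hρ hρ1 hdevc hK' hfour
  have hW := diffusion_stronglyMeasurable_memLp (μ := μ) hgroup hA hcost hnoise
  have hH := groupHessian_isHermitian (group := group) (p := p) (μ := μ) hherm
  have hev := fun m => groupHessian_eigenvalues_pos hpos hμ hlam hlow (hlam' m) (hH m)
  have hsymm : ∀ k (x y : EuclideanSpace ℝ (Fin M)),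
      inner ℝ x (Matrix.toEuclideanCLM (𝕜 := ℝ) (hessianMatrix (J k) (wo k)) y) =
      inner ℝ (Matrix.toEuclideanCLM (𝕜 := ℝ) (hessianMatrix (J k) (wo k)) x) y := by
    intro k x y
    rw [real_inner_comm y, Matrix.inner_toEuclideanCLM, Matrix.inner_toEuclideanCLM,
      Matrix.dotProduct_mulVec, ← Matrix.mulVec_transpose, dotProduct_comm]
    congr 2
    exact hherm k
  have hfun : ∀ x : Fin G × Fin M, ∀ ε > 0, ∀ᶠ t in 𝓝[>] (0 : ℝ), ∀ᶠ i in atTop,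
      |∫ ω, groupFunctional group p x.1 ((hH x.1).eigenvectorBasis x.2)
        (networkError nbr group A gradHat wo (t • μ) i ω) ^ 2 ∂P -
        t * ((((hH x.1).eigenvectorBasis x.2).ofLp ⬝ᵥ (groupCov group Rs p μ x.1).mulVec
          ((hH x.1).eigenvectorBasis x.2).ofLp) / (2 * (hH x.1).eigenvalues x.2))| ≤ ε * t := by
    rintro ⟨m, a⟩ ε hε
    obtain ⟨C', hC'⟩ := abs_groupFunctional_drift_le hp hpos hμ
      (fun k => Matrix.toEuclideanCLM (𝕜 := ℝ) (hessianMatrix (J k) (wo k))) hsymm hκ hquad m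
      (((toEuclideanCLM_groupHessian m _).symm.trans
        ((hH m).toEuclideanCLM_eigenvectorBasis a)))
    refine hrec.eventually_abs_integral_functional_sq_sub_le hg hC
      (groupFunctional_combine hA hp m _) (hev m a) hC' hK' hfour hK'' hdev (fun ε hε => ?_) hε
    have h1 := hnoise.eventually_abs_integral_sq_sub_le (fun t i => (hW t i).1)
      (fun t i => (hW t i).2) hfour
      (groupCoeff group p μ m ((hH m).eigenvectorBasis a)) hε
    simp_rw [groupFunctional_diagonal_eq_sum]
    rw [← groupCoeff_dotProduct]
    exact h1
  have hQ : ∀ ε > 0, ∀ᶠ t in 𝓝[>] (0 : ℝ), ∀ᶠ i in atTop,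
      |∫ ω, ‖blockMap (groupMean group p)
        (networkError nbr group A gradHat wo (t • μ) i ω)‖ ^ 2 ∂P -
        t * ∑ m, ((groupAgents group m).card : ℝ) / 2 *
          Matrix.trace ((groupHessian group J wo p μ m)⁻¹ * groupCov group Rs p μ m)| ≤ ε * t := by
    intro ε hε
    -- The sum of `v / (2λ)` over the eigenbasis of each group is half the trace.
    have hc : ∑ m, ((groupAgents group m).card : ℝ) / 2 *
        Matrix.trace ((groupHessian group J wo p μ m)⁻¹ * groupCov group Rs p μ m) =
        ∑ x : Fin G × Fin M, ((groupAgents group x.1).card : ℝ) *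
        ((((hH x.1).eigenvectorBasis x.2).ofLp ⬝ᵥ (groupCov group Rs p μ x.1).mulVec
          ((hH x.1).eigenvectorBasis x.2).ofLp) / (2 * (hH x.1).eigenvalues x.2)) := by
      rw [Fintype.sum_prod_type]
      refine Finset.sum_congr rfl fun m _ => ?_
      rw [(hH m).trace_inv_mul_eq_sum (hev m), Finset.mul_sum]
      refine Finset.sum_congr rfl fun a _ => ?_
      have := (hev m a).ne'
      field_simp
    simp_rw [norm_groupMean_sq fun m => (hH m).eigenvectorBasis, hc]
    refine eventually_abs_integral_weighted_sum_sub_le (fun x t i => ?_)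
      (fun x => Nat.cast_nonneg _) hfun hε
    have h4 := ((hrec.memLp t i).clm_comp
      (groupFunctional group p x.1 ((hH x.1).eigenvectorBasis x.2))).integrable_norm_sq_of_four
    simpa only [Real.norm_eq_abs, sq_abs] using h4
  exact hrec.eventually_abs_integral_norm_sq_sub_le groupDeviation_apply hK' hfour hK'' hdev hQ hε

theorem groupMSDSumCross_eq_div :
    groupMSDSumCross group J wo Rs p μ =
      (∑ m, ((groupAgents group m).card : ℝ) / 2 * Matrix.trace
        ((groupHessian group J wo p μ m)⁻¹ * groupCov group Rs p μ m)) / stepMax μ := by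
  rw [groupMSDSumCross, Finset.sum_div]
  refine Finset.sum_congr rfl fun m _ => ?_
  rw [groupHessian, groupCov]
  ring

theorem normalizedMSD_smul_eq (hW : ∀ i, MemLp (networkError nbr group A gradHat wo μ i) 4 P)
    (hμ : 0 < stepMax μ) :
    normalizedMSD P nbr group A gradHat wo μ = limsup (fun i => ENNReal.ofReal
      ((∫ ω, ‖networkError nbr group A gradHat wo μ i ω‖ ^ 2 ∂P) / stepMax μ)) atTop := by
  rw [normalizedMSD]
  congr 1
  funext i
  have h1 : ∫⁻ ω, ‖wo - diffusion nbr group A gradHat μ i ω‖ₑ ^ 2 ∂P =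
      ENNReal.ofReal (∫ ω, ‖networkError nbr group A gradHat wo μ i ω‖ ^ 2 ∂P) := by
    rw [ofReal_integral_eq_lintegral_ofReal (hW i).integrable_norm_sq_of_four
      (ae_of_all _ fun ω => sq_nonneg _)]
    refine lintegral_congr fun ω => ?_
    rw [ENNReal.ofReal_pow (norm_nonneg _), ofReal_norm]; rfl
  rw [h1, ENNReal.ofReal_div_of_pos hμ, ENNReal.div_eq_inv_mul]

end Main

theorem mainTheorem5 {N M G : ℕ} {Ω : Type*} [mΩ : MeasurableSpace Ω]
    (P : Measure Ω) [IsProbabilityMeasure P] (ℱ : Filtration ℕ mΩ)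
    (nbr : Fin N → Finset (Fin N)) (group : Fin N → Fin G)
    (J : Fin N → EuclideanSpace ℝ (Fin M) → ℝ) (wo : NetVec N M)
    (A : Matrix (Fin N) (Fin N) ℝ) (p : Fin N → ℝ)
    (gradHat : ℕ → Fin N → Ω → EuclideanSpace ℝ (Fin M) → EuclideanSpace ℝ (Fin M))
    (Rs : NetMat N M)
    (hgroup : IsGrouping nbr group wo)
    (hcost : CostAssumption group J wo)
    (hA : IsCombination nbr group A)
    (hp : IsPerronVector group A p)
    (hnoise : NoiseAssumption P ℱ J wo gradHat Rs)
    (μ : Fin N → ℝ) (hμ : ∀ k, 0 < μ k) :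
    Tendsto (fun t : ℝ => normalizedMSD P nbr group A gradHat wo (t • μ)) (𝓝[>] 0)
        (𝓝 (ENNReal.ofReal (groupMSDSumCross group J wo Rs p μ))) ∧
      ((∀ k l, k ≠ l → group k = group l → Rs.block k l = 0) →
        Tendsto (fun t : ℝ => normalizedMSD P nbr group A gradHat wo (t • μ)) (𝓝[>] 0)
          (𝓝 (ENNReal.ofReal (groupMSDSum group J wo Rs p μ)))) := by
  have hmain : Tendsto (fun t : ℝ => normalizedMSD P nbr group A gradHat wo (t • μ)) (𝓝[>] 0)
      (𝓝 (ENNReal.ofReal (groupMSDSumCross group J wo Rs p μ))) := by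
    -- Without agents `stepMax` is the supremum of an empty family, with default value zero, and
    -- cannot be divided by; both sides are then zero.
    rcases isEmpty_or_nonempty (Fin N) with hN | hN
    · have h1 : ∀ t : ℝ, normalizedMSD P nbr group A gradHat wo (t • μ) = 0 := fun t => by
        have : ∀ i ω, wo - diffusion nbr group A gradHat (t • μ) i ω = 0 := fun i ω =>
          PiLp.ext fun k => hN.elim k
        simp [normalizedMSD, this]
      have h2 : groupMSDSumCross group J wo Rs p μ = 0 := by
        simp [groupMSDSumCross, stepMax]
      simp_rw [h1, h2, ENNReal.ofReal_zero]
      exact tendsto_const_nhds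
    · obtain ⟨k₀⟩ := hN
      have hmax : 0 < stepMax μ := (hμ k₀).trans_le (le_ciSup (Set.finite_range μ).bddAbove k₀)
      have hW := diffusion_stronglyMeasurable_memLp (μ := μ) hgroup hA hcost hnoise
      have hz4 : ∀ (t : ℝ) i, MemLp (networkError nbr group A gradHat wo (t • μ) i) 4 P :=
        fun t i => (memLp_const wo).sub (hW t i).2
      have hlim := tendsto_limsup_ofReal (f := fun t i =>
        (∫ ω, ‖networkError nbr group A gradHat wo (t • μ) i ω‖ ^ 2 ∂P) / (t * stepMax μ))
        (c := groupMSDSumCross group J wo Rs p μ) (fun ε hε => by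
          filter_upwards [eventually_abs_integral_networkError_sq_sub_le hgroup hcost hA hp hnoise
            hμ (mul_pos hε hmax), self_mem_nhdsWithin] with t ht ht0
          have ht0 : 0 < t := ht0
          filter_upwards [ht] with i hi
          -- The right-hand side depends only on the ratios: `stepMax` scales by `t`, which cancels
          -- the factor `t` of the leading term.
          rw [groupMSDSumCross_eq_div, ← mul_div_mul_left _ (stepMax μ) ht0.ne', ← sub_div,
            abs_div, abs_of_pos (mul_pos ht0 hmax), div_le_iff₀ (mul_pos ht0 hmax)]
          linarith)
      refine hlim.congr' ?_
      filter_upwards [self_mem_nhdsWithin] with t ht0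
      have ht0 : 0 < t := ht0
      rw [normalizedMSD_smul_eq (hz4 t) (by rw [stepMax_smul ht0]; exact mul_pos ht0 hmax),
        stepMax_smul ht0]
  exact ⟨hmain, fun h => by rw [← groupMSDSumCross_eq_groupMSDSum Rs h]; exact hmain⟩
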